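/- **Setting.** Let $1\le d\le p$ be integers and write $\mathcal B^m_{x,R}=\{v\in\mathbb R^m:\|v-x\|_2^2<R\}$. Let $X_0\in\mathbb R^p$, $r,\mu,\kappa,M>0$ and $0<\varepsilon<1$. Assume the following. 1. *Manifold.* $\varphi:\mathcal B^d_{0,r}\to\mathbb R^p$ is three times differentiable, is a homeomorphism onto its image and an immersion, and $\varphi(0)=X_0$. Put $\mathcal M=\varphi(\mathcal B^d_{0,r})\cap\mathcal B^p_{X_0,\mu}$, a $d$-dimensional submanifold of $\mathbb R^p$. 2. *Data.* $X_1,X_2,\dots$ are i.i.d. random vectors in $\mathbb R^p$, and $\mathbb P(X_1\in S)=\int_{\varphi^{-1}(S)}F(z)\,dz$ for every Borel set $S\subseteq\mathcal B^p_{X_0,\mu}$, where $F\ge 0$ on $\mathcal B^d_{0,r}$ is three times differentiable with $F(0)>0$. 3. *Kernel and bandwidth.* $K:\mathbb R^p\to[0,\infty)$ is not identically zero, three times differentiable and radially symmetric; $h=h_n=\kappa n^{-1/(d+4)}$; and for $\gamma\in\{1,2\}$ and every measurable $w$ with $|w(x)|\le M(1+\|x\|^2)$, $$\mathbb E\bigl[K^\gamma((X_1-X_0)/h)\,w(X_1)\,\mathbf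 1(X_1\notin\mathcal B^p_{X_0,h^{1-\varepsilon}})\bigr]=o(h^{d+4})$$ as $n\to\infty$ (the expectation being finite for all large $n$). 4. *Regularization parameter.* $(\lambda_n)$ is nondecreasing, $\lambda_n/(nh^{d+2})\to\infty$ and $h\lambda_n/(nh^{d+2})\to0$. Let $X_{x_0}$ be the $n\times(p+1)$ matrix with rows $[1,\ (X_i-X_0)']$, $W_{x_0}=\operatorname{diag}(K_h(X_i-X_0))_{i\le n}$ with $K_h(u)=h^{-p}K(u/h)$, $H^{1/2}=\sqrt{nh^d}\,\operatorname{diag}(1,h\mathbb I_p)$, and $$\hat C_n=\begin{bmatrix}\hat C_n^{11}&\hat C_n^{12}\\ \hat C_n^{21}&\hat C_n^{22}\end{bmatrix}=h^pH^{-1/2}X_{x_0}'W_{x_0}X_{x_0}H^{-1/2},\qquad C^{22}=F(0)\,d\varphi(0)\Bigl[\int_{\mathbb R^d}K(d\varphi(0)u)\,uu'\,du\Bigr]d\varphi(0)'.$$ For a symmetric $p\times p$ matrix $A=U\operatorname{diag}(\lambda^1,\dots,\lambda^p)U'$ with $U$ orthogonal and $\lambda^1\ge\dots\ge\lambda^p$,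 let $U^N$ consist of the last $p-d$ columns of $U$. Let $\hat\Pi_n=\hat U^N\hat U^{N\prime}$ for any such decomposition of $A=\hat C_n^{22}$, let $\Pi=U^NU^{N\prime}$ for any such decomposition of $A=C^{22}$, and put $\hat P_n=\operatorname{diag}(0,\hat\Pi_n)$, $P=\operatorname{diag}(0,\Pi)$. Write $\mathcal R$ and $\mathcal N$ for range and null space, $\|\cdot\|_2$ for the spectral norm and $T_{X_0}\mathcal M$ for the tangent space. **Theorem.** Under these assumptions: (a) $\operatorname{rank}(C^{22})=d$ and $\mathcal R(C^{22})=T_{X_0}\mathcal M$; (b) $\mathcal R(\Pi)=\mathcal N(C^{22})$, $\mathcal N(\Pi)=\mathcal R(C^{22})$ and $\mathcal N(\Pi)\cap\mathcal N(C^{22})=\{0\}$; (c) $\|\hat P_n-P\|_2^2=\|\hat\Pi_n-\Pi\|_2^2=O_p(1/(nh^d))$; (d) $\mathbb P\bigl(\operatorname{rank}(\hat C_n+\lambda_n\hat P_n/(nh^{d+2}))=p+1\bigr)\to1$ as $n\to\infty$. -/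

import Mathlib

open MeasureTheory ProbabilityTheory Filter Topology Asymptotics
open scoped Matrix Matrix.Norms.L2Operator

noncomputable section

namespace ManifoldReg

/-- Euclidean space `ℝ^m` with the Euclidean norm. -/
abbrev Eucl (m : ℕ) : Type := EuclideanSpace ℝ (Fin m)

/-- The ball `B_{x,R} = {v : ‖v - x‖² < R}` (so `R` is the *squared* radius). -/
def sqBall {m : ℕ} (x : Eucl m) (R : ℝ) : Set (Eucl m) :=
  {v | ‖v - x‖ ^ 2 < R}

/-- `f` is three times (Fréchet) differentiable on the open set `U`. -/
def ThriceDifferentiableOn {V W : Type*} [NormedAddCommGroup V] [NormedSpace ℝ V]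
    [NormedAddCommGroup W] [NormedSpace ℝ W] (f : V → W) (U : Set V) : Prop :=
  DifferentiableOn ℝ f U ∧ DifferentiableOn ℝ (fderiv ℝ f) U ∧
    DifferentiableOn ℝ (fderiv ℝ (fderiv ℝ f)) U

/-- A kernel on `ℝ^p`: nonnegative, not identically zero, three times differentiable and
radially symmetric. -/
structure IsKernel {p : ℕ} (K : Eucl p → ℝ) : Prop where
  nonneg : ∀ x, 0 ≤ K x
  ne_zero : ∃ x, K x ≠ 0
  thrice_diff : ThriceDifferentiableOn K Set.univ
  radial : ∀ x y, ‖x‖ = ‖y‖ → K x = K y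

/-- `φ`, on the ball `B^d_{0,r}`, is (the inverse of) a local chart with `φ 0 = x₀` of a
`d`-dimensional embedded manifold in `ℝ^p`: it is three times differentiable, a homeomorphism
onto its image, and an immersion. -/
structure IsLocalChart {d p : ℕ} (φ : Eucl d → Eucl p) (r : ℝ) (x₀ : Eucl p) : Prop where
  map_zero : φ 0 = x₀
  thrice_diff : ThriceDifferentiableOn φ (sqBall 0 r)
  embedding : IsEmbedding ((sqBall (0 : Eucl d) r).domRestrict φ)
  immersion : ∀ u ∈ sqBall (0 : Eucl d) r, Function.Injective (fderiv ℝ φ u)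

/-- The manifold `M = {φ(u) ∈ B^p_{x₀,μ} : u ∈ B^d_{0,r}}`. -/
def localManifold {d p : ℕ} (φ : Eucl d → Eucl p) (r : ℝ) (x₀ : Eucl p) (μ : ℝ) :
    Set (Eucl p) :=
  φ '' sqBall 0 r ∩ sqBall x₀ μ

/-- The tangent space at `x` of a submanifold `S` of `ℝ^p`: velocities at time `0` of curves
in `S` that pass through `x` at time `0`. -/
def tangentVectors {p : ℕ} (S : Set (Eucl p)) (x : Eucl p) : Set (Eucl p) :=
  {v | ∃ c : ℝ → Eucl p, c 0 = x ∧ (∀ᶠ t in 𝓝 0, c t ∈ S) ∧ HasDerivAt c v 0}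

/-- Near `x₀` (inside `B^p_{x₀,μ}`) the law `ν` on `ℝ^p` is the image under `φ` of the measure
with density `F` on `B^d_{0,r}`; `F` is nonnegative, three times differentiable, and positive
at `0`. -/
structure HasChartDensity {d p : ℕ} (ν : Measure (Eucl p)) (φ : Eucl d → Eucl p) (r : ℝ)
    (x₀ : Eucl p) (μ : ℝ) (F : Eucl d → ℝ) : Prop where
  nonneg : ∀ z ∈ sqBall (0 : Eucl d) r, 0 ≤ F z
  thrice_diff : ThriceDifferentiableOn F (sqBall 0 r)
  pos_zero : 0 < F 0
  law : ∀ S : Set (Eucl p), MeasurableSet S → S ⊆ sqBall x₀ μ →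
    ν S = ∫⁻ z in sqBall 0 r ∩ φ ⁻¹' S, ENNReal.ofReal (F z)

/-- The bandwidth `h = κ n^{-1/(d+4)}`. -/
def bandwidth (κ : ℝ) (d n : ℕ) : ℝ :=
  κ * (n : ℝ) ^ (-1 / ((d : ℝ) + 4))

/-- The tail condition: for `γ ∈ {1, 2}` and every measurable `w` with
`|w(x)| ≤ M (1 + ‖x‖²)`,
`E[K^γ((X - x₀)/h) w(X) 1(X ∉ B_{x₀, h^{1-ε}})]` exists and is `o(h^{d+4})`. -/
def TailCondition {p : ℕ} (K : Eucl p → ℝ) (ν : Measure (Eucl p)) (x₀ : Eucl p) (d : ℕ)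
    (h : ℕ → ℝ) (ε M : ℝ) : Prop :=
  ∀ γ : ℕ, (γ = 1 ∨ γ = 2) → ∀ w : Eucl p → ℝ, Measurable w →
    (∀ x, |w x| ≤ M * (1 + ‖x‖ ^ 2)) →
    (∀ᶠ n in atTop, IntegrableOn (fun x => K ((h n)⁻¹ • (x - x₀)) ^ γ * w x)
      (sqBall x₀ (h n ^ (1 - ε)))ᶜ ν) ∧
    (fun n => ∫ x in (sqBall x₀ (h n ^ (1 - ε)))ᶜ, K ((h n)⁻¹ • (x - x₀)) ^ γ * w x ∂ν)
      =o[atTop] fun n => h n ^ (d + 4)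

/-- The scaled kernel `K_h(U) = h^{-p} K(U/h)`. -/
def scaledKernel {p : ℕ} (K : Eucl p → ℝ) (h : ℝ) (U : Eucl p) : ℝ :=
  (h ^ p)⁻¹ * K (h⁻¹ • U)

/-- The weight matrix `W_{x₀} = diag(K_h(X₁ - X₀), …, K_h(X_n - X₀))`. -/
def weightMatrix {p n : ℕ} (K : Eucl p → ℝ) (h : ℝ) (x₀ : Eucl p) (x : Fin n → Eucl p) :
    Matrix (Fin n) (Fin n) ℝ :=
  Matrix.diagonal fun i => scaledKernel K h (x i - x₀)

/-- The augmented data matrix, with rows `[1, (X_i - X₀)']`. -/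
def dataMatrix {p n : ℕ} (x₀ : Eucl p) (x : Fin n → Eucl p) :
    Matrix (Fin n) (Unit ⊕ Fin p) ℝ :=
  Matrix.fromCols (Matrix.of fun _ _ => 1) (Matrix.of fun i j => (x i - x₀) j)

/-- `H^{1/2} = √(n h^d) · [1, 0; 0, h I]`. -/
def bandwidthRoot (p d n : ℕ) (h : ℝ) : Matrix (Unit ⊕ Fin p) (Unit ⊕ Fin p) ℝ :=
  Real.sqrt (n * h ^ d) • Matrix.fromBlocks 1 0 0 (h • 1)

/-- The weighted Gram matrix `Ĉ_n = h^p H^{-1/2} X_{x₀}' W_{x₀} X_{x₀} H^{-1/2}`. -/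
def gram {p n : ℕ} (K : Eucl p → ℝ) (d : ℕ) (h : ℝ) (x₀ : Eucl p) (x : Fin n → Eucl p) :
    Matrix (Unit ⊕ Fin p) (Unit ⊕ Fin p) ℝ :=
  h ^ p • ((bandwidthRoot p d n h)⁻¹ * (dataMatrix x₀ x)ᵀ * weightMatrix K h x₀ x *
    dataMatrix x₀ x * (bandwidthRoot p d n h)⁻¹)

/-- `Q = U^N U^N'` for some eigenvalue decomposition
`A = [U^R U^N] diag(λ¹, …, λᵖ) [U^R U^N]'` with `λ¹ ≥ ⋯ ≥ λᵖ`, where `U^N` consists of the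
last `p - d` columns. -/
def IsNormalProjection {p : ℕ} (d : ℕ) (A Q : Matrix (Fin p) (Fin p) ℝ) : Prop :=
  ∃ (U : Matrix (Fin p) (Fin p) ℝ) (ev : Fin p → ℝ),
    U ∈ Matrix.orthogonalGroup (Fin p) ℝ ∧ Antitone ev ∧ A = U * Matrix.diagonal ev * Uᵀ ∧
    Q = U.submatrix id (fun j : {j : Fin p // d ≤ (j : ℕ)} => (j : Fin p)) *
      (U.submatrix id (fun j : {j : Fin p // d ≤ (j : ℕ)} => (j : Fin p)))ᵀ

/-- `diag(0, Q)`. -/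
def augment {p : ℕ} (Q : Matrix (Fin p) (Fin p) ℝ) : Matrix (Unit ⊕ Fin p) (Unit ⊕ Fin p) ℝ :=
  Matrix.fromBlocks 0 0 0 Q

/-- The Jacobian matrix of `φ` at `0`. -/
def jacobian {d p : ℕ} (φ : Eucl d → Eucl p) : Matrix (Fin p) (Fin d) ℝ :=
  Matrix.of fun i j => fderiv ℝ φ 0 (EuclideanSpace.single j 1) i

/-- `C²² = F(0) dφ [∫ K(dφ u) u u' du] dφ'`. -/
def popCov {d p : ℕ} (K : Eucl p → ℝ) (φ : Eucl d → Eucl p) (F : Eucl d → ℝ) :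
    Matrix (Fin p) (Fin p) ℝ :=
  F 0 • (jacobian φ *
    (Matrix.of fun i j => ∫ u : Eucl d, K (fderiv ℝ φ 0 u) * (u i * u j)) * (jacobian φ)ᵀ)

/-- `Y_n = O_p(a_n)`. -/
def IsBigOInProb {Ω : Type*} [MeasurableSpace Ω] (P : Measure Ω) (Y : ℕ → Ω → ℝ) (a : ℕ → ℝ) :
    Prop :=
  ∀ δ : ℝ, 0 < δ → ∃ C : ℝ, ∀ᶠ n in atTop, P {ω | C * a n < |Y n ω|} ≤ ENNReal.ofReal δ

/-- The range of a square matrix, as a subspace of `ℝ^p`. -/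
abbrev rangeOf {p : ℕ} (A : Matrix (Fin p) (Fin p) ℝ) : Submodule ℝ (Eucl p) :=
  LinearMap.range (Matrix.toEuclideanLin A)

/-- The null space of a square matrix, as a subspace of `ℝ^p`. -/
abbrev nullOf {p : ℕ} (A : Matrix (Fin p) (Fin p) ℝ) : Submodule ℝ (Eucl p) :=
  LinearMap.ker (Matrix.toEuclideanLin A)

end ManifoldReg

end

open ManifoldReg

/-! The bandwidth satisfies `n * h ^ (d + 4) = κ ^ (d + 4)`, so the rate 1/(n h^d) for the squared
error is h^4 up to a constant, and (c) amounts to saying that the projection is estimated with error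
O_p(h^2). Every entry of the rescaled Gram matrix is a kernel average. Its fluctuation has variance
of order 1/(n h^d), hence size h^2. In an eigenbasis of the limit, a perturbation moves the spectral
projection only through the off-diagonal block (a Davis-Kahan bound,
`exists_norm_projection_sub_le`). So the bias matters only for products of a tangential and a normal
coordinate. Such a product has size h, but its leading term is odd on the tangent space and
integrates to zero, which leaves a bias of order h^2 (`IsRadialChart.abs_setIntegral_mixed_le`).

Two devices make the mean computation exact. Nothing is known about derivatives of `K` at infinity,
so `K` must not be Taylor expanded. Instead the chart is rescaled radially into `x₀ + Φ` with `‖Φ y‖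
= ‖A y‖`, where `A` is the differential of `φ` at `0` (`exists_isRadialChart`). Since `K` is radial,
its value at a data point is exactly its value on the tangent space, and balls around `x₀` pull back
to symmetric sets. The moments of `K ∘ A` needed for dominated convergence are not assumed. They are
extracted from the tail condition by cutting the tangent space into shells along the sample sizes
2^k (`integrable_kernel_pow_mul`). Outside a ball of radius slowly shrinking to zero the data are
handled by Markov's inequality and the tail condition, inside it by Chebyshev
(`kernelAverage_deviation`).

Parts (a) and (b) follow because the quadratic form of the population matrix is an integral of `K`
times a square: it vanishes at `v` exactly when `v` is orthogonal to the range of `A`. For (d), both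
summands are positive semidefinite for large n, so a null vector is null for each quadratic form.
The penalty confines its spatial part to the leading `d` eigenvectors, where the Gram matrix is
bounded below, and the intercept decouples in the limit because `K` is even
(`rank_add_smul_augment`). -/

namespace ManifoldReg

/-! ### Taylor estimates at the origin -/

section Taylor

variable {E G : Type*} [NormedAddCommGroup E] [NormedSpace ℝ E]
  [NormedAddCommGroup G] [NormedSpace ℝ G]

lemma norm_image_sub_le_pow {f : E → G} {R C : ℝ} {k : ℕ} (hC : 0 ≤ C)
    (hf : ∀ z ∈ Metric.ball (0 : E) R, DifferentiableAt ℝ f z)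
    (hb : ∀ z ∈ Metric.ball (0 : E) R, ‖fderiv ℝ f z‖ ≤ C * ‖z‖ ^ k)
    {s : ℝ} (hs : s < R) {x y : E} (hx : ‖x‖ ≤ s) (hy : ‖y‖ ≤ s) :
    ‖f y - f x‖ ≤ C * s ^ k * ‖y - x‖ := by
  have hsub : ∀ z ∈ Metric.closedBall (0 : E) s, z ∈ Metric.ball (0 : E) R := fun z hz => by
    simp only [mem_closedBall_zero_iff, mem_ball_zero_iff] at hz ⊢
    exact hz.trans_lt hs
  refine (convex_closedBall (0 : E) s).norm_image_sub_le_of_norm_fderiv_le (𝕜 := ℝ)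
    (fun z hz => hf z (hsub z hz)) (fun z hz => (hb z (hsub z hz)).trans ?_)
    (by simpa using hx) (by simpa using hy)
  rw [mem_closedBall_zero_iff] at hz
  gcongr

/-- Integrating a power bound once raises the order by one. Applied repeatedly, this yields all
Taylor estimates from a bound at the level of second derivatives. -/
lemma norm_sub_zero_le_pow {f : E → G} {R C : ℝ} {k : ℕ} (hC : 0 ≤ C)
    (hf : ∀ z ∈ Metric.ball (0 : E) R, DifferentiableAt ℝ f z)
    (hb : ∀ z ∈ Metric.ball (0 : E) R, ‖fderiv ℝ f z‖ ≤ C * ‖z‖ ^ k)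
    {z : E} (hz : z ∈ Metric.ball (0 : E) R) : ‖f z - f 0‖ ≤ C * ‖z‖ ^ (k + 1) := by
  have := norm_image_sub_le_pow hC hf hb (by simpa using hz) (x := 0) (y := z) (s := ‖z‖)
    (by simp) le_rfl
  rw [sub_zero] at this
  linarith [this, pow_succ ‖z‖ k, mul_assoc C (‖z‖ ^ k) ‖z‖,
    congrArg (C * ·) (pow_succ ‖z‖ k)]

/-- Taylor estimates at `0` for a three times differentiable map, on a ball of radius `R`. -/
structure TaylorBounds (f : E → G) (A : E →L[ℝ] G) (R C : ℝ) : Prop where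
  pos : 0 < R
  nonneg : 0 ≤ C
  diff : ∀ z ∈ Metric.ball (0 : E) R, DifferentiableAt ℝ f z
  deriv_sub : ∀ z ∈ Metric.ball (0 : E) R, ‖fderiv ℝ f z - A‖ ≤ C * ‖z‖
  odd_part : ∀ z ∈ Metric.ball (0 : E) R, ‖f z - f (-z) - (2 : ℝ) • A z‖ ≤ C * ‖z‖ ^ 3

/-- The remainder is Lipschitz with a constant that shrinks with the radius. This two-point form
later compares remainders at points that differ only to second order. -/
lemma TaylorBounds.lipschitz_sub {f : E → G} {A : E →L[ℝ] G} {R C : ℝ}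
    (h : TaylorBounds f A R C) {s : ℝ} (hs : s < R) {x y : E} (hx : ‖x‖ ≤ s) (hy : ‖y‖ ≤ s) :
    ‖(f y - A y) - (f x - A x)‖ ≤ C * s * ‖y - x‖ := by
  have := norm_image_sub_le_pow (f := fun z => f z - A z) (k := 1) h.nonneg
    (fun z hz => (h.diff z hz).sub A.differentiableAt)
    (fun z hz => by
      rw [fderiv_fun_sub (h.diff z hz) A.differentiableAt, A.fderiv, pow_one]
      exact h.deriv_sub z hz) hs hx hy
  simpa using this

lemma TaylorBounds.sub_linear {f : E → G} {A : E →L[ℝ] G} {R C : ℝ}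
    (h : TaylorBounds f A R C) {z : E} (hz : z ∈ Metric.ball (0 : E) R) :
    ‖f z - f 0 - A z‖ ≤ C * ‖z‖ ^ 2 := by
  have := h.lipschitz_sub (by simpa using hz) (x := 0) (y := z) (s := ‖z‖) (by simp) le_rfl
  simp only [map_zero, sub_zero] at this
  calc ‖f z - f 0 - A z‖ = ‖f z - A z - f 0‖ := by congr 1; abel
    _ ≤ _ := by rw [pow_two, ← mul_assoc]; exact this

/-- Differentiability of the second derivative at the single point `0` makes it Lipschitz there,
with no continuity of the third derivative. In the odd combination f(z) - f(-z) - 2Az the quadratic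
terms cancel: its second derivative is f''(z) - f''(-z), of order ‖z‖, and two integrations give the
cubic bound. -/
lemma ThriceDifferentiableOn.exists_taylorBounds {f : E → G} {U : Set E} (hU : U ∈ 𝓝 (0 : E))
    (hUo : IsOpen U) (hf : ThriceDifferentiableOn f U) :
    ∃ R C, Metric.ball (0 : E) R ⊆ U ∧ TaylorBounds f (fderiv ℝ f 0) R C := by
  obtain ⟨h1, h2, h3⟩ := hf
  have h3' : DifferentiableAt ℝ (fderiv ℝ (fderiv ℝ f)) 0 := h3.differentiableAt hU
  obtain ⟨c, hc⟩ :=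
    (DifferentiableAt.isBigO_sub (𝕜 := ℝ) (E := E) (F := E →L[ℝ] E →L[ℝ] G) h3').bound
  obtain ⟨R, hR, hball⟩ := Metric.eventually_nhds_iff_ball.1 (hc.and hU)
  have hU' : Metric.ball (0 : E) R ⊆ U := fun z hz => (hball z hz).2
  have hc' : ∀ z ∈ Metric.ball (0 : E) R,
      ‖fderiv ℝ (fderiv ℝ f) z - fderiv ℝ (fderiv ℝ f) 0‖ ≤ |c| * ‖z‖ := fun z hz =>
    ((hball z hz).1.trans (by
      rw [sub_zero]; exact mul_le_mul_of_nonneg_right (le_abs_self c) (norm_nonneg _)))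
  have hd1 : ∀ z ∈ Metric.ball (0 : E) R, DifferentiableAt ℝ f z := fun z hz =>
    h1.differentiableAt (hUo.mem_nhds (hU' hz))
  have hd2 : ∀ z ∈ Metric.ball (0 : E) R, DifferentiableAt ℝ (fderiv ℝ f) z := fun z hz =>
    h2.differentiableAt (hUo.mem_nhds (hU' hz))
  have hneg : ∀ z ∈ Metric.ball (0 : E) R, -z ∈ Metric.ball (0 : E) R := fun z hz => by
    simpa using hz
  set A := fderiv ℝ f 0 with hA
  set Q := fderiv ℝ (fderiv ℝ f) 0 with hQ
  have hQb : ∀ z ∈ Metric.ball (0 : E) R,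
      ‖fderiv ℝ (fderiv ℝ f) z‖ ≤ (|c| * R + ‖Q‖) * ‖z‖ ^ 0 := fun z hz => by
    have hzR : ‖z‖ ≤ R := by simpa using (mem_ball_zero_iff.1 hz).le
    have e1 : ‖fderiv ℝ (fderiv ℝ f) z‖ ≤ ‖fderiv ℝ (fderiv ℝ f) z - Q‖ + ‖Q‖ := by
      simpa using norm_add_le (fderiv ℝ (fderiv ℝ f) z - Q) Q
    have e2 : |c| * ‖z‖ ≤ |c| * R := by gcongr
    rw [pow_zero, mul_one]
    linarith [hc' z hz]
  have hnn : 0 ≤ |c| * R + ‖Q‖ := by positivity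
  have hA1 : ∀ z ∈ Metric.ball (0 : E) R, ‖fderiv ℝ f z - A‖ ≤ (|c| * R + ‖Q‖) * ‖z‖ :=
    fun z hz => by simpa using norm_sub_zero_le_pow hnn hd2 hQb hz
  have hcn : ∀ g : E → G, ∀ z, DifferentiableAt ℝ g (-z) →
      HasFDerivAt (fun w => g (-w)) (-(fderiv ℝ g (-z))) z := fun g z hg => by
    have := hg.hasFDerivAt.comp z (hasFDerivAt_id z).fun_neg
    convert! this using 1
    ext v
    simp
  have hsym : ∀ z ∈ Metric.ball (0 : E) R,
      ‖fderiv ℝ f z + fderiv ℝ f (-z) - (2 : ℝ) • A‖ ≤ (2 * |c|) * ‖z‖ ^ 2 := fun z hz => by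
    have hder : ∀ w ∈ Metric.ball (0 : E) R,
        HasFDerivAt (fun w => fderiv ℝ f w + fderiv ℝ f (-w))
          (fderiv ℝ (fderiv ℝ f) w - fderiv ℝ (fderiv ℝ f) (-w)) w := fun w hw => by
      have h2 := (hd2 (-w) (hneg w hw)).hasFDerivAt.comp w (hasFDerivAt_id w).fun_neg
      convert! (hd2 w hw).hasFDerivAt.add h2 using 1
      ext v u
      simp [sub_eq_add_neg]
    have := norm_sub_zero_le_pow (f := fun w => fderiv ℝ f w + fderiv ℝ f (-w)) (k := 1)
      (C := 2 * |c|) (by positivity) (fun w hw => (hder w hw).differentiableAt)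
      (fun w hw => by
        rw [(hder w hw).fderiv, pow_one]
        have e1 := hc' w hw
        have e2 := hc' (-w) (hneg w hw)
        rw [norm_neg] at e2
        calc ‖fderiv ℝ (fderiv ℝ f) w - fderiv ℝ (fderiv ℝ f) (-w)‖
            = ‖(fderiv ℝ (fderiv ℝ f) w - Q) - (fderiv ℝ (fderiv ℝ f) (-w) - Q)‖ := by
              congr 1; abel
          _ ≤ ‖fderiv ℝ (fderiv ℝ f) w - Q‖ + ‖fderiv ℝ (fderiv ℝ f) (-w) - Q‖ :=
              norm_sub_le (E := E →L[ℝ] E →L[ℝ] G) _ _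
          _ ≤ _ := by linarith) hz
    simpa [two_smul] using this
  have hodd : ∀ z ∈ Metric.ball (0 : E) R,
      ‖f z - f (-z) - (2 : ℝ) • A z‖ ≤ (2 * |c|) * ‖z‖ ^ 3 := fun z hz => by
    have hder : ∀ w ∈ Metric.ball (0 : E) R,
        HasFDerivAt (fun w => f w - f (-w) - (2 : ℝ) • A w)
          (fderiv ℝ f w + fderiv ℝ f (-w) - (2 : ℝ) • A) w := fun w hw => by
      convert! ((hd1 w hw).hasFDerivAt.sub (hcn f w (hd1 (-w) (hneg w hw)))).sub
        (A.hasFDerivAt.const_smul (2 : ℝ)) using 1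
      simp
    have := norm_sub_zero_le_pow (f := fun w => f w - f (-w) - (2 : ℝ) • A w) (k := 2)
      (C := 2 * |c|) (by positivity) (fun w hw => (hder w hw).differentiableAt)
      (fun w hw => by rw [(hder w hw).fderiv]; exact hsym w hw) hz
    simpa using this
  refine ⟨R, max (|c| * R + ‖Q‖) (2 * |c|), hU', hR, le_max_of_le_left hnn, hd1,
    fun z hz => (hA1 z hz).trans (by gcongr; exact le_max_left _ _),
    fun z hz => (hodd z hz).trans (by gcongr; exact le_max_right _ _)⟩

end Taylor

/-! ### The radial rescaling and its derivative -/

section RadialMap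

variable {E H : Type*} [NormedAddCommGroup E] [NormedSpace ℝ E]
  [NormedAddCommGroup H] [InnerProductSpace ℝ H]

/-- The radial rescaling `z ↦ (‖f z‖ / ‖A z‖) z`, which satisfies
`‖A (radialMap f A z)‖ = ‖f z‖`. -/
noncomputable def radialMap (f : E → H) (A : E →L[ℝ] H) (z : E) : E := (‖f z‖ / ‖A z‖) • z

lemma norm_apply_radialMap {f : E → H} {A : E →L[ℝ] H} {z : E} (h : A z = 0 → f z = 0) :
    ‖A (radialMap f A z)‖ = ‖f z‖ := by
  rw [radialMap, map_smul, norm_smul, norm_div, norm_norm, norm_norm]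
  by_cases h0 : A z = 0
  · simp [h0, h h0]
  · rw [div_mul_cancel₀ _ (by simpa using h0)]

lemma norm_unit_sub_unit_le {a f : H} (hf : f ≠ 0) (ha : a ≠ 0) :
    ‖‖f‖⁻¹ • f - ‖a‖⁻¹ • a‖ ≤ 2 * ‖f - a‖ / ‖a‖ := by
  have hf' : 0 < ‖f‖ := norm_pos_iff.2 hf
  have ha' : 0 < ‖a‖ := norm_pos_iff.2 ha
  have e : ‖f‖⁻¹ • f - ‖a‖⁻¹ • a = ‖a‖⁻¹ • ((f - a) + ((‖a‖ - ‖f‖) * ‖f‖⁻¹) • f) := by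
    rw [sub_mul, sub_smul, mul_inv_cancel₀ hf'.ne', one_smul, smul_add, smul_sub, smul_sub,
      smul_smul, ← mul_assoc, inv_mul_cancel₀ ha'.ne', one_mul]
    abel
  rw [e, norm_smul, norm_inv, norm_norm, div_eq_inv_mul]
  gcongr
  refine (norm_add_le _ _).trans ?_
  rw [norm_smul, norm_mul, norm_inv, norm_norm, mul_assoc, inv_mul_cancel₀ hf'.ne', mul_one]
  have := abs_norm_sub_norm_le a f
  rw [norm_sub_rev] at this
  rw [Real.norm_eq_abs]
  linarith

lemma hasFDerivAt_norm_comp {f : E → H} {f' : E →L[ℝ] H} {z : E} (hf : HasFDerivAt f f' z)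
    (h0 : f z ≠ 0) :
    HasFDerivAt (fun w => ‖f w‖) ((innerSL ℝ (‖f z‖⁻¹ • f z)).comp f') z := by
  have h1 := hf.norm_sq.sqrt (by simpa using h0)
  simp only [Real.sqrt_sq (norm_nonneg _)] at h1
  convert! h1 using 1
  ext v
  simp
  ring

/-- The derivative of the radial rescaling away from `0` is close to the identity. -/
lemma hasFDerivAt_radialMap {f : E → H} {f' A : E →L[ℝ] H} {z : E} {C m : ℝ} (hm : 0 < m)
    (hC : 0 ≤ C) (hz : z ≠ 0) (hf : HasFDerivAt f f' z) (hAz : m * ‖z‖ ≤ ‖A z‖)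
    (h1 : ‖f z - A z‖ ≤ C * ‖z‖ ^ 2) (h2 : ‖f' - A‖ ≤ C * ‖z‖) (hsmall : C * ‖z‖ ≤ m / 2) :
    ∃ D : E →L[ℝ] E, HasFDerivAt (radialMap f A) D z ∧
      ‖D - ContinuousLinearMap.id ℝ E‖ ≤ (C / m + C * (1 + 3 * ‖A‖ / m) / m) * ‖z‖ := by
  have hz' : 0 < ‖z‖ := norm_pos_iff.2 hz
  have ha' : 0 < ‖A z‖ := lt_of_lt_of_le (by positivity) hAz
  have ha : A z ≠ 0 := norm_pos_iff.1 ha'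
  have h1a : ‖f z - A z‖ ≤ (m / 2) * ‖z‖ := h1.trans (by
    rw [pow_two, ← mul_assoc]; gcongr)
  have hfz : f z ≠ 0 := by
    rintro h
    rw [h, zero_sub, norm_neg] at h1a
    nlinarith
  have hN := hasFDerivAt_norm_comp hf hfz
  have hB := hasFDerivAt_norm_comp A.hasFDerivAt ha
  have hg : HasFDerivAt (fun w => ‖f w‖ / ‖A w‖)
      (‖A z‖⁻¹ • (((innerSL ℝ (‖f z‖⁻¹ • f z)).comp f') -
        (‖f z‖ / ‖A z‖) • ((innerSL ℝ (‖A z‖⁻¹ • A z)).comp A))) z := by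
    have hinv : HasFDerivAt (fun w => (‖A w‖)⁻¹)
        ((-(‖A z‖ ^ 2)⁻¹) • ((innerSL ℝ (‖A z‖⁻¹ • A z)).comp A)) z :=
      (hasDerivAt_inv ha'.ne').comp_hasFDerivAt z hB
    have := hN.mul hinv
    convert! this using 1
    ext v
    simp
    field_simp
    ring
  set g := ‖f z‖ / ‖A z‖ with hgdef
  set G := (‖A z‖⁻¹ • (((innerSL ℝ (‖f z‖⁻¹ • f z)).comp f') -
        g • ((innerSL ℝ (‖A z‖⁻¹ • A z)).comp A))) with hG
  have hg1 : |g - 1| ≤ C / m * ‖z‖ := by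
    rw [hgdef, div_sub_one ha'.ne', abs_div, abs_of_pos ha', div_le_iff₀ ha']
    calc |‖f z‖ - ‖A z‖| ≤ ‖f z - A z‖ := abs_norm_sub_norm_le _ _
      _ ≤ C * ‖z‖ ^ 2 := h1
      _ = C / m * ‖z‖ * (m * ‖z‖) := by field_simp
      _ ≤ _ := by gcongr
  -- The gradient of the ratio is a difference of two functionals divided by ‖A z‖. The difference
  -- splits into errors in the derivative, in the unit vector and in the ratio, each of order ‖z‖,
  -- so the singular factor 1/‖A z‖ is compensated.
  have hGn : ‖G‖ ≤ C * (1 + 3 * ‖A‖ / m) / m := by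
    have hu : ‖‖f z‖⁻¹ • f z‖ = 1 := by
      rw [norm_smul, norm_inv, norm_norm, inv_mul_cancel₀ (by simpa using hfz)]
    have hua : ‖‖A z‖⁻¹ • A z‖ = 1 := by
      rw [norm_smul, norm_inv, norm_norm, inv_mul_cancel₀ (by simpa using ha)]
    have hdiff : ‖‖f z‖⁻¹ • f z - ‖A z‖⁻¹ • A z‖ ≤ 2 * (C / m * ‖z‖) := by
      refine (norm_unit_sub_unit_le hfz ha).trans ?_
      rw [div_le_iff₀ ha']
      calc 2 * ‖f z - A z‖ ≤ 2 * (C * ‖z‖ ^ 2) := by gcongr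
        _ = 2 * (C / m * ‖z‖) * (m * ‖z‖) := by field_simp
        _ ≤ _ := by gcongr
    have hdec : ((innerSL ℝ (‖f z‖⁻¹ • f z)).comp f') - g • ((innerSL ℝ (‖A z‖⁻¹ • A z)).comp A)
        = (innerSL ℝ (‖f z‖⁻¹ • f z)).comp (f' - A)
          + (innerSL ℝ (‖f z‖⁻¹ • f z - ‖A z‖⁻¹ • A z)).comp A
          - (g - 1) • ((innerSL ℝ (‖A z‖⁻¹ • A z)).comp A) := by
      ext v
      simp only [sub_apply, add_apply,
        smul_apply, ContinuousLinearMap.comp_apply, innerSL_apply_apply,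
        inner_sub_left, inner_sub_right, smul_eq_mul]
      ring
    have hb1 : ‖(innerSL ℝ (‖f z‖⁻¹ • f z)).comp (f' - A)‖ ≤ C * ‖z‖ := by
      refine (ContinuousLinearMap.opNorm_comp_le _ _).trans ?_
      rw [innerSL_apply_norm, hu, one_mul]
      exact h2
    have hb2 : ‖(innerSL ℝ (‖f z‖⁻¹ • f z - ‖A z‖⁻¹ • A z)).comp A‖ ≤
        2 * (C / m * ‖z‖) * ‖A‖ := by
      refine (ContinuousLinearMap.opNorm_comp_le _ _).trans ?_
      rw [innerSL_apply_norm]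
      gcongr
    have hb3 : ‖(g - 1) • ((innerSL ℝ (‖A z‖⁻¹ • A z)).comp A)‖ ≤ C / m * ‖z‖ * ‖A‖ := by
      rw [norm_smul, Real.norm_eq_abs]
      refine mul_le_mul hg1 ?_ (norm_nonneg _) (by positivity)
      refine (ContinuousLinearMap.opNorm_comp_le _ _).trans ?_
      rw [innerSL_apply_norm, hua, one_mul]
    rw [hG, hdec, norm_smul, norm_inv, norm_norm, ← div_eq_inv_mul, div_le_iff₀ ha']
    calc _ ≤ C * ‖z‖ + 2 * (C / m * ‖z‖) * ‖A‖ + C / m * ‖z‖ * ‖A‖ :=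
          (norm_sub_le _ _).trans (add_le_add ((norm_add_le _ _).trans (add_le_add hb1 hb2)) hb3)
      _ = C * (1 + 3 * ‖A‖ / m) / m * (m * ‖z‖) := by field_simp; ring
      _ ≤ _ := by gcongr
  refine ⟨g • ContinuousLinearMap.id ℝ E + G.smulRight z, hg.smul (hasFDerivAt_id z), ?_⟩
  have : g • ContinuousLinearMap.id ℝ E + G.smulRight z - ContinuousLinearMap.id ℝ E =
      (g - 1) • ContinuousLinearMap.id ℝ E + G.smulRight z := by
    rw [sub_smul, one_smul]; abel
  rw [this, add_mul]
  refine (norm_add_le _ _).trans (add_le_add ?_ ?_)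
  · rw [norm_smul, Real.norm_eq_abs]
    calc _ ≤ C / m * ‖z‖ * 1 :=
          mul_le_mul hg1 ContinuousLinearMap.norm_id_le (norm_nonneg _) (by positivity)
      _ = _ := mul_one _
  · rw [ContinuousLinearMap.norm_smulRight_apply]
    gcongr

end RadialMap

/-! ### A chart that is exactly radial -/

lemma sqBall_eq_ball {m : ℕ} (x : Eucl m) (R : ℝ) :
    sqBall x R = Metric.ball x (Real.sqrt R) := by
  ext v
  simp only [sqBall, Set.mem_ofPred_eq, mem_ball_iff_norm]
  rw [Real.lt_sqrt (norm_nonneg _)]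

lemma contDiff_det {d : ℕ} : ContDiff ℝ 1 (fun D : Eucl d →L[ℝ] Eucl d => D.det) := by
  have : (fun D : Eucl d →L[ℝ] Eucl d => D.det) = fun D : Eucl d →L[ℝ] Eucl d =>
      ∑ s : Equiv.Perm (Fin d), (Equiv.Perm.sign s : ℝ) *
        ∏ i, (D (EuclideanSpace.single i 1)) (s i) := by
    ext D
    rw [ContinuousLinearMap.det,
      ← LinearMap.det_toMatrix (EuclideanSpace.basisFun (Fin d) ℝ).toBasis, Matrix.det_apply']
    simp [LinearMap.toMatrix_apply]
  rw [this]
  refine ContDiff.sum fun s _ => contDiff_const.mul (contDiff_prod fun i _ => ?_)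
  exact ((EuclideanSpace.proj (𝕜 := ℝ) (s i)).comp
    (ContinuousLinearMap.apply ℝ (Eucl d) (EuclideanSpace.single i (1 : ℝ)))).contDiff

/-- The determinant is a polynomial in the entries, hence locally Lipschitz at the identity. This
controls the Jacobian of the radial change of variables. -/
lemma exists_abs_det_sub_one_le (d : ℕ) : ∃ c η : ℝ, 0 ≤ c ∧ 0 < η ∧
    ∀ D : Eucl d →L[ℝ] Eucl d, ‖D - ContinuousLinearMap.id ℝ _‖ < η →
      |D.det - 1| ≤ c * ‖D - ContinuousLinearMap.id ℝ _‖ := by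
  obtain ⟨c, t, ht, hc⟩ := (contDiff_det (d := d)).contDiffAt
    (x := ContinuousLinearMap.id ℝ (Eucl d)) |>.exists_lipschitzOnWith
  obtain ⟨η, hη, hball⟩ := Metric.mem_nhds_iff.1 ht
  refine ⟨c, η, c.2, hη, fun D hD => ?_⟩
  have := hc.dist_le_mul D (hball (by simpa [dist_eq_norm] using hD)) _
    (mem_of_mem_nhds ht)
  simpa [dist_eq_norm, ContinuousLinearMap.det] using this

lemma exists_mul_norm_le {d p : ℕ} (A : Eucl d →L[ℝ] Eucl p) (hA : Function.Injective A) :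
    ∃ m : ℝ, 0 < m ∧ ∀ u, m * ‖u‖ ≤ ‖A u‖ := by
  obtain ⟨K, hK, h⟩ := (A : Eucl d →ₗ[ℝ] Eucl p).exists_antilipschitzWith
    (LinearMap.ker_eq_bot.2 hA)
  have hK' : (0 : ℝ) < K := hK
  refine ⟨(K : ℝ)⁻¹, inv_pos.2 hK', fun u => ?_⟩
  have := h.le_mul_dist u 0
  simp only [map_zero, dist_zero_right, ContinuousLinearMap.coe_coe] at this
  rw [inv_mul_le_iff₀ hK']
  exact this

/-- A chart `x₀ + Φ` around `x₀` that is exactly radial with respect to its differential `A`,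
together with the density `G` of `ν` in that chart. -/
structure IsRadialChart {d p : ℕ} (ν : Measure (Eucl p)) (x₀ : Eucl p) (A : Eucl d →L[ℝ] Eucl p)
    (F₀ : ℝ) (Φ : Eucl d → Eucl p) (G : Eucl d → ℝ) (ρ C : ℝ) : Prop where
  pos : 0 < ρ
  nonneg : 0 ≤ C
  meas_chart : Measurable Φ
  meas_density : Measurable G
  norm_eq : ∀ y, ‖A y‖ < ρ → ‖Φ y‖ = ‖A y‖
  density_ge : ∀ y, ‖A y‖ < ρ → F₀ / 2 ≤ G y
  density_sub : ∀ y, ‖A y‖ < ρ → |G y - F₀| ≤ C * ‖y‖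
  sub_linear : ∀ y, ‖A y‖ < ρ → ‖Φ y - A y‖ ≤ C * ‖y‖ ^ 2
  normal_even : ∀ b : Eucl p, (∀ u, inner ℝ b (A u) = 0) → ∀ y, ‖A y‖ < ρ →
    |inner ℝ b (Φ y) - inner ℝ b (Φ (-y))| ≤ C * ‖b‖ * ‖y‖ ^ 3
  law : ∀ S : Set (Eucl p), MeasurableSet S → S ⊆ Metric.ball x₀ ρ →
    ν S = ∫⁻ y in {y | ‖A y‖ < ρ} ∩ {y | x₀ + Φ y ∈ S}, ENNReal.ofReal (G y)

lemma norm_radialMap_sub_le {E H : Type*} [NormedAddCommGroup E] [NormedSpace ℝ E]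
    [NormedAddCommGroup H] [NormedSpace ℝ H] {f : E → H} {A : E →L[ℝ] H} {z : E} {C m : ℝ}
    (hm : 0 < m) (hC : 0 ≤ C) (hAz : m * ‖z‖ ≤ ‖A z‖) (h1 : ‖f z - A z‖ ≤ C * ‖z‖ ^ 2) :
    ‖(‖f z‖ / ‖A z‖) • z - z‖ ≤ C / m * ‖z‖ ^ 2 := by
  by_cases hz : z = 0
  · simp [hz]
  have hz' : 0 < ‖z‖ := norm_pos_iff.2 hz
  have ha' : 0 < ‖A z‖ := lt_of_lt_of_le (by positivity) hAz
  have e : (‖f z‖ / ‖A z‖) • z - z = (‖f z‖ / ‖A z‖ - 1) • z := by rw [sub_smul, one_smul]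
  rw [e, norm_smul, Real.norm_eq_abs, div_sub_one ha'.ne', abs_div, abs_of_pos ha', pow_two,
    ← mul_assoc]
  gcongr
  rw [div_le_iff₀ ha']
  calc |‖f z‖ - ‖A z‖| ≤ ‖f z - A z‖ := abs_norm_sub_norm_le _ _
    _ ≤ C * ‖z‖ ^ 2 := h1
    _ = C / m * ‖z‖ * (m * ‖z‖) := by field_simp
    _ ≤ _ := by gcongr

lemma measurable_indicator_of_continuousOn {X Y : Type*} [TopologicalSpace X]
    [MeasurableSpace X] [BorelSpace X] [TopologicalSpace Y] [MeasurableSpace Y] [BorelSpace Y]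
    [Zero Y] {f : X → Y} {s : Set X} (hs : MeasurableSet s) (hf : ContinuousOn f s) :
    Measurable (s.indicator f) := by
  classical
  rw [← Set.piecewise_eq_indicator]
  exact ContinuousOn.measurable_piecewise hf continuousOn_const hs

/-- The radial rescaling of a map with Taylor bounds is, on a small ball, differentiable with
derivative close to the identity. -/
lemma TaylorBounds.exists_radialMap {d p : ℕ} {f : Eucl d → Eucl p} {A : Eucl d →L[ℝ] Eucl p}
    {R C m : ℝ} (h : TaylorBounds f A R C) (h0 : f 0 = 0) (hm : 0 < m)
    (hA : ∀ u, m * ‖u‖ ≤ ‖A u‖) :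
    ∃ δ C', 0 < δ ∧ δ ≤ R ∧ 0 ≤ C' ∧ ∀ z ∈ Metric.ball (0 : Eucl d) δ,
      DifferentiableAt ℝ (radialMap f A) z ∧
      ‖fderiv ℝ (radialMap f A) z - ContinuousLinearMap.id ℝ _‖ ≤ C' * ‖z‖ ∧
      ‖radialMap f A z - z‖ ≤ C' * ‖z‖ ^ 2 := by
  have hC := h.nonneg
  have hR := h.pos
  set C' := C / m + C * (1 + 3 * ‖A‖ / m) / m with hC'
  have hCC' : C / m ≤ C' := by rw [hC']; linarith [show 0 ≤ C * (1 + 3 * ‖A‖ / m) / m by positivity]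
  have hq : ∀ z ∈ Metric.ball (0 : Eucl d) R, ‖f z - A z‖ ≤ C * ‖z‖ ^ 2 := fun z hz => by
    simpa [h0] using h.sub_linear hz
  have hs : ∀ z ∈ Metric.ball (0 : Eucl d) R, ‖radialMap f A z - z‖ ≤ C' * ‖z‖ ^ 2 :=
    fun z hz => (norm_radialMap_sub_le hm hC (hA z) (hq z hz)).trans (by gcongr)
  refine ⟨min R (m / (2 * (C + 1))), C', lt_min hR (by positivity), min_le_left _ _,
    by positivity, fun z hz => ?_⟩
  have hzR : z ∈ Metric.ball (0 : Eucl d) R := Metric.ball_subset_ball (min_le_left _ _) hz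
  by_cases hz0 : z = 0
  · subst hz0
    -- At the origin the ratio reads 0/0, so the quotient rule is unavailable; the quadratic
    -- estimate on the displacement gives the derivative directly.
    have hd : HasFDerivAt (radialMap f A) (ContinuousLinearMap.id ℝ (Eucl d)) 0 := by
      rw [hasFDerivAt_iff_isLittleO_nhds_zero]
      have hO : (fun z : Eucl d => radialMap f A (0 + z) - radialMap f A 0
          - ContinuousLinearMap.id ℝ (Eucl d) z) =O[𝓝 0] fun z => ‖z‖ ^ 2 := by
        refine IsBigO.of_bound C' ?_
        filter_upwards [Metric.ball_mem_nhds (0 : Eucl d) hR] with z hz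
        have := hs z hz
        simpa [radialMap] using this
      refine hO.trans_isLittleO ?_
      have := (isLittleO_norm_pow_id (E' := Eucl d) (n := 2) (by norm_num))
      exact this
    refine ⟨hd.differentiableAt, ?_, by simp [radialMap]⟩
    rw [hd.fderiv]
    simp
  · have hz2 : ‖z‖ < m / (2 * (C + 1)) := lt_of_lt_of_le (by simpa using hz) (min_le_right _ _)
    have hsmall : C * ‖z‖ ≤ m / 2 := by
      rw [lt_div_iff₀ (by positivity)] at hz2
      nlinarith [norm_nonneg z]
    obtain ⟨D, hD, hDn⟩ := hasFDerivAt_radialMap hm hC hz0 (h.diff z hzR).hasFDerivAt (hA z)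
      (hq z hzR) (h.deriv_sub z hzR) hsmall
    refine ⟨hD.differentiableAt, ?_, hs z hzR⟩
    rw [hD.fderiv]
    exact hDn

/-- A map whose derivative on a ball around `0` is close to the identity is an open partial
homeomorphism there, with image containing a quarter ball. -/
lemma exists_openPartialHomeomorph_of_fderiv_near_id {d : ℕ} (hd : 1 ≤ d) {ψ : Eucl d → Eucl d}
    {δ : ℝ} (hδ : 0 < δ) (h0 : ψ 0 = 0)
    (hdiff : ∀ z ∈ Metric.ball (0 : Eucl d) δ, DifferentiableAt ℝ ψ z)
    (hder : ∀ z ∈ Metric.ball (0 : Eucl d) δ,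
      ‖fderiv ℝ ψ z - ContinuousLinearMap.id ℝ _‖ ≤ 1 / 2) :
    ∃ e : OpenPartialHomeomorph (Eucl d) (Eucl d), (e : Eucl d → Eucl d) = ψ ∧
      e.source = Metric.ball 0 δ ∧ Metric.closedBall 0 (δ / 4) ⊆ e.target := by
  -- Positive dimension is what makes the operator norm of the identity equal to one.
  have : Nonempty (Fin d) := ⟨⟨0, hd⟩⟩
  have : Nontrivial (Eucl d) := inferInstance
  have happ : ApproximatesLinearOn ψ
      ((ContinuousLinearEquiv.refl ℝ (Eucl d) : Eucl d ≃L[ℝ] Eucl d) : Eucl d →L[ℝ] Eucl d)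
      (Metric.ball 0 δ) (1 / 2) := by
    intro x hx y hy
    have := (convex_ball (0 : Eucl d) δ).norm_image_sub_le_of_norm_hasFDerivWithin_le'
      (𝕜 := ℝ) (φ := ContinuousLinearMap.id ℝ _)
      (fun z hz => (hdiff z hz).hasFDerivAt.hasFDerivWithinAt) hder hy hx
    simpa using this
  have hN : ‖((ContinuousLinearEquiv.refl ℝ (Eucl d)).symm : Eucl d →L[ℝ] Eucl d)‖₊ = 1 := by
    rw [ContinuousLinearEquiv.refl_symm, ContinuousLinearEquiv.coe_refl]
    exact nnnorm_one (G := Eucl d →L[ℝ] Eucl d)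
  have hc : (1 / 2 : NNReal) <
      ‖((ContinuousLinearEquiv.refl ℝ (Eucl d)).symm : Eucl d →L[ℝ] Eucl d)‖₊⁻¹ := by
    rw [hN, inv_one]
    exact_mod_cast (by norm_num : (1 / 2 : ℝ) < 1)
  refine ⟨happ.toOpenPartialHomeomorph ψ _ (Or.inr hc) Metric.isOpen_ball, rfl, rfl, ?_⟩
  -- The image of a closed ball of radius δ/2 contains one of radius (1 - 1/2)(δ/2) = δ/4.
  have := happ.closedBall_subset_target (Or.inr hc) Metric.isOpen_ball (b := 0) (ε := δ / 2)
    (by positivity) (Metric.closedBall_subset_ball (by linarith))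
  refine Set.Subset.trans (Metric.closedBall_subset_closedBall ?_) (h0 ▸ this)
  rw [hN]
  push_cast
  linarith

lemma isOpen_sqBall {m : ℕ} (x : Eucl m) (R : ℝ) : IsOpen (sqBall x R) := by
  rw [sqBall_eq_ball]; exact Metric.isOpen_ball

lemma sqBall_mem_nhds {m : ℕ} (x : Eucl m) {R : ℝ} (hR : 0 < R) : sqBall x R ∈ 𝓝 x := by
  rw [sqBall_eq_ball]; exact Metric.ball_mem_nhds _ (Real.sqrt_pos.2 hR)

/-- Points of the chart domain whose image is close to `x₀` are close to `0`. -/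
lemma IsLocalChart.exists_preimage_subset {d p : ℕ} {φ : Eucl d → Eucl p} {r : ℝ} {x₀ : Eucl p}
    (hφ : IsLocalChart φ r x₀) (hr : 0 < r) {U : Set (Eucl d)} (hU : U ∈ 𝓝 (0 : Eucl d)) :
    ∃ ρ > 0, ∀ z ∈ sqBall (0 : Eucl d) r, ‖φ z - x₀‖ < ρ → z ∈ U := by
  have h0 : (0 : Eucl d) ∈ sqBall (0 : Eucl d) r := mem_of_mem_nhds (sqBall_mem_nhds _ hr)
  have hind := hφ.embedding.isInducing.nhds_eq_comap ⟨0, h0⟩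
  have hpre : (Subtype.val ⁻¹' U : Set (sqBall (0 : Eucl d) r)) ∈ 𝓝 ⟨0, h0⟩ :=
    continuous_subtype_val.continuousAt.preimage_mem_nhds hU
  rw [hind, mem_comap] at hpre
  obtain ⟨V, hV, hsub⟩ := hpre
  simp only [Set.domRestrict_apply, hφ.map_zero] at hV
  obtain ⟨ρ, hρ, hball⟩ := Metric.mem_nhds_iff.1 hV
  refine ⟨ρ, hρ, fun z hz hzρ => ?_⟩
  exact @hsub ⟨z, hz⟩ (hball (by simpa [dist_eq_norm] using hzρ))

-- Take new coordinates y = ψ(z) with ψ the radial rescaling of f = φ - x₀; then `‖A (ψ z)‖ = ‖f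
-- z‖`, so Φ = f ∘ ψ⁻¹ has the required norm, and the density becomes F / |det Dψ|. As ψ is the
-- identity up to second order, Φ keeps the linear part `A`. Normal components stay even up to third
-- order: the odd part of f is linear up to cubic terms, and the failure of ψ⁻¹ to be odd is
-- quadratic and enters only through the remainder of f, whose Lipschitz constant is O(‖y‖).
set_option maxHeartbeats 2000000 in
theorem exists_isRadialChart {d p : ℕ} (hd : 1 ≤ d) {ν : Measure (Eucl p)} {x₀ : Eucl p}
    {φ : Eucl d → Eucl p} {r μ : ℝ} (hr : 0 < r) (hμ : 0 < μ) (hφ : IsLocalChart φ r x₀)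
    {F : Eucl d → ℝ} (hF : HasChartDensity ν φ r x₀ μ F) :
    ∃ Φ G ρ C, IsRadialChart ν x₀ (fderiv ℝ φ 0) (F 0) Φ G ρ C := by
  set A := fderiv ℝ φ 0 with hAdef
  have h0mem : (0 : Eucl d) ∈ sqBall (0 : Eucl d) r := mem_of_mem_nhds (sqBall_mem_nhds _ hr)
  obtain ⟨m, hm, hA⟩ := exists_mul_norm_le A (hφ.immersion 0 h0mem)
  -- Taylor bounds for `f = φ - x₀`
  set f : Eucl d → Eucl p := fun z => φ z - x₀ with hf
  obtain ⟨R, C₁, hRU, hT⟩ := hφ.thrice_diff.exists_taylorBounds (sqBall_mem_nhds _ hr)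
    (isOpen_sqBall _ _)
  have hTf : TaylorBounds f A R C₁ := by
    refine ⟨hT.pos, hT.nonneg, fun z hz => (hT.diff z hz).sub_const x₀, fun z hz => ?_,
      fun z hz => ?_⟩
    · rw [hf, fderiv_sub_const]; exact hT.deriv_sub z hz
    · simpa [hf] using hT.odd_part z hz
  have hf0 : f 0 = 0 := by simp [hf, hφ.map_zero]
  obtain ⟨δ₁, C₂, hδ₁, hδ₁R, hC₂, hψ⟩ := hTf.exists_radialMap hf0 hm hA
  set ψ := radialMap f A with hψdef
  have hψ0 : ψ 0 = 0 := by simp [hψdef, radialMap]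
  obtain ⟨c, η, hc, hη, hdet⟩ := exists_abs_det_sub_one_le d
  -- the density near `0`
  have hFd : DifferentiableAt ℝ F 0 := hF.thrice_diff.1.differentiableAt (sqBall_mem_nhds _ hr)
  obtain ⟨C₃, hC₃⟩ := hFd.isBigO_sub.bound
  obtain ⟨δ₂, hδ₂, hFb⟩ := Metric.eventually_nhds_iff_ball.1 hC₃
  have hF0 := hF.pos_zero
  -- the radius
  set κ := 2 * C₂ + C₂ / η + 2 * c * C₂ + 4 * (|C₃| + F 0 * (c * C₂)) / F 0 + 1 with hκ
  have hκ1 : 1 ≤ κ := by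
    have : 0 ≤ 2 * C₂ + C₂ / η + 2 * c * C₂ + 4 * (|C₃| + F 0 * (c * C₂)) / F 0 := by positivity
    linarith
  -- With ‖z‖ < 1/(2κ) each summand of `κ` times ‖z‖ is at most 1/2. In order, the summands put Dψ
  -- within 1/2 of the identity and give ‖z‖ ≤ 2‖ψ z‖, enter the range of the determinant estimate,
  -- keep the Jacobian above 1/2, and keep the new density above half its value at `0`.
  set δ := min (min δ₁ δ₂) (1 / (2 * κ)) with hδdef
  have hδ : 0 < δ := lt_min (lt_min hδ₁ hδ₂) (by positivity)
  have hsmall : ∀ z ∈ Metric.ball (0 : Eucl d) δ, κ * ‖z‖ ≤ 1 / 2 := fun z hz => by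
    have : ‖z‖ < 1 / (2 * κ) := lt_of_lt_of_le (mem_ball_zero_iff.1 hz) (min_le_right _ _)
    rw [lt_div_iff₀ (by positivity)] at this
    nlinarith
  have hb1 : ∀ z ∈ Metric.ball (0 : Eucl d) δ, z ∈ Metric.ball (0 : Eucl d) δ₁ := fun z hz =>
    Metric.ball_subset_ball ((min_le_left _ _).trans (min_le_left _ _)) hz
  have hb2 : ∀ z ∈ Metric.ball (0 : Eucl d) δ, z ∈ Metric.ball (0 : Eucl d) δ₂ := fun z hz =>
    Metric.ball_subset_ball ((min_le_left _ _).trans (min_le_right _ _)) hz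
  have hbR : ∀ z ∈ Metric.ball (0 : Eucl d) δ, z ∈ Metric.ball (0 : Eucl d) R := fun z hz =>
    Metric.ball_subset_ball hδ₁R (hb1 z hz)
  have hκle : ∀ a : ℝ, a ≤ κ → ∀ z ∈ Metric.ball (0 : Eucl d) δ, a * ‖z‖ ≤ 1 / 2 :=
    fun a ha z hz => (mul_le_mul_of_nonneg_right ha (norm_nonneg z)).trans (hsmall z hz)
  have hp1 : 0 ≤ C₂ / η := by positivity
  have hp2 : 0 ≤ 2 * c * C₂ := by positivity
  have hp3 : 0 ≤ 4 * (|C₃| + F 0 * (c * C₂)) / F 0 := by positivity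
  have hC₂s : ∀ z ∈ Metric.ball (0 : Eucl d) δ, 2 * C₂ * ‖z‖ ≤ 1 / 2 :=
    hκle _ (by rw [hκ]; linarith)
  have hder : ∀ z ∈ Metric.ball (0 : Eucl d) δ,
      ‖fderiv ℝ ψ z - ContinuousLinearMap.id ℝ _‖ ≤ 1 / 2 := fun z hz => by
    have h1 := (hψ z (hb1 z hz)).2.1
    have h2 := hC₂s z hz
    nlinarith [norm_nonneg z]
  obtain ⟨e, heψ, hes, het⟩ := exists_openPartialHomeomorph_of_fderiv_near_id hd hδ hψ0
    (fun z hz => (hψ z (hb1 z hz)).1) hder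
  -- the Jacobian
  have hJ : ∀ z ∈ Metric.ball (0 : Eucl d) δ, |(fderiv ℝ ψ z).det - 1| ≤ c * C₂ * ‖z‖ ∧
      1 / 2 ≤ (fderiv ℝ ψ z).det := fun z hz => by
    have h1 := (hψ z (hb1 z hz)).2.1
    have h2 : C₂ / η * ‖z‖ ≤ 1 / 2 := hκle _ (by rw [hκ]; linarith) z hz
    have h3 : C₂ * ‖z‖ < η := by
      have : C₂ * ‖z‖ = η * (C₂ / η * ‖z‖) := by field_simp
      rw [this]; nlinarith
    have h4 := hdet _ (h1.trans_lt h3)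
    have h5 : |(fderiv ℝ ψ z).det - 1| ≤ c * C₂ * ‖z‖ := h4.trans (by rw [mul_assoc]; gcongr)
    have h6 : 2 * c * C₂ * ‖z‖ ≤ 1 / 2 := hκle _ (by rw [hκ]; linarith) z hz
    have h7 := (abs_le.1 h5).1
    exact ⟨h5, by nlinarith⟩
  have hFs : ∀ z ∈ Metric.ball (0 : Eucl d) δ, |F z - F 0| ≤ |C₃| * ‖z‖ := fun z hz => by
    have := hFb z (hb2 z hz)
    rw [sub_zero, Real.norm_eq_abs] at this
    exact this.trans (mul_le_mul_of_nonneg_right (le_abs_self _) (norm_nonneg _))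
  -- the inverse
  have hσ : ∀ y ∈ e.target, e.symm y ∈ Metric.ball (0 : Eucl d) δ ∧ ψ (e.symm y) = y :=
    fun y hy => ⟨hes ▸ e.map_target hy, heψ ▸ e.right_inv hy⟩
  have hσn : ∀ y ∈ e.target, ‖e.symm y‖ ≤ 2 * ‖y‖ ∧ ‖e.symm y - y‖ ≤ 4 * C₂ * ‖y‖ ^ 2 := by
    intro y hy
    obtain ⟨hz, hzy⟩ := hσ y hy
    set z := e.symm y
    have h1 := (hψ z (hb1 z hz)).2.2
    rw [hzy] at h1
    have h2 := hC₂s z hz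
    have h3 : ‖z‖ ≤ ‖y - z‖ + ‖y‖ := by
      have := norm_sub_le y (y - z)
      rw [sub_sub_cancel] at this; linarith
    have h4 : ‖z‖ ≤ 2 * ‖y‖ := by nlinarith [norm_nonneg z]
    refine ⟨h4, ?_⟩
    rw [norm_sub_rev]
    refine h1.trans ?_
    have : ‖z‖ ^ 2 ≤ (2 * ‖y‖) ^ 2 := by gcongr
    nlinarith
  -- the radius in the ambient space
  obtain ⟨ρ₁, hρ₁, hpre⟩ := hφ.exists_preimage_subset hr (Metric.ball_mem_nhds (0 : Eucl d) hδ)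
  -- The three bounds force preimages under φ into the small ball, place {‖A y‖ < ρ} in the domain
  -- of ψ⁻¹, and stay within the region where the law is given by the chart (`μ` is a squared
  -- radius).
  set ρ := min (min ρ₁ (m * (δ / 4))) (Real.sqrt μ) with hρdef
  have hρ : 0 < ρ := lt_min (lt_min hρ₁ (by positivity)) (Real.sqrt_pos.2 hμ)
  have htgt : ∀ y, ‖A y‖ < ρ → y ∈ e.target := fun y hy => by
    refine het (mem_closedBall_zero_iff.2 ?_)
    have h1 := hA y
    have h2 : ‖A y‖ < m * (δ / 4) :=
      hy.trans_le ((min_le_left _ _).trans (min_le_right _ _))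
    exact (lt_of_mul_lt_mul_left (h1.trans_lt h2) hm.le).le
  have hsub_sq : ∀ z ∈ Metric.ball (0 : Eucl d) δ, z ∈ sqBall (0 : Eucl d) r := fun z hz =>
    hRU (hbR z hz)
  have hφc : ContinuousOn φ (Metric.ball (0 : Eucl d) δ) := fun z hz =>
    (hT.diff z (hbR z hz)).continuousAt.continuousWithinAt
  have hFc : ContinuousOn F (Metric.ball (0 : Eucl d) δ) :=
    hF.thrice_diff.1.continuousOn.mono hsub_sq
  set B := Metric.ball (0 : Eucl d) δ with hB
  have hBm : MeasurableSet B := Metric.isOpen_ball.measurableSet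
  -- Extension by zero only serves to make Φ and G globally measurable; their values matter on {‖A
  -- y‖ < ρ} alone.
  set σ : Eucl d → Eucl d := e.target.indicator e.symm with hσdef
  have hσm : Measurable σ :=
    measurable_indicator_of_continuousOn e.open_target.measurableSet e.continuousOn_symm
  have hσe : ∀ y ∈ e.target, σ y = e.symm y := fun y hy => Set.indicator_of_mem hy _
  set Φ : Eucl d → Eucl p := fun y => B.indicator φ (σ y) - x₀ with hΦdef
  set G : Eucl d → ℝ := fun y => B.indicator F (σ y) / |(fderiv ℝ ψ (σ y)).det| with hGdef
  have hΦe : ∀ y ∈ e.target, Φ y = f (e.symm y) := fun y hy => by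
    simp only [hΦdef, hf, hσe y hy, Set.indicator_of_mem (hσ y hy).1]
  have hGe : ∀ y ∈ e.target, G y = F (e.symm y) / |(fderiv ℝ ψ (e.symm y)).det| := fun y hy => by
    simp only [hGdef, hσe y hy, Set.indicator_of_mem (hσ y hy).1]
  have hnormψ : ∀ z ∈ B, ‖A (ψ z)‖ = ‖f z‖ := fun z hz => by
    refine norm_apply_radialMap fun h => ?_
    have := hA z
    rw [h, norm_zero] at this
    have hz0 : z = 0 := by
      have : ‖z‖ ≤ 0 := by
        by_contra hcon
        push Not at hcon
        nlinarith
      simpa using this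
    rw [hz0, hf0]
  have hGsub : ∀ y, ‖A y‖ < ρ → |G y - F 0| ≤ 2 * (|C₃| + F 0 * (c * C₂)) * ‖e.symm y‖ := by
    intro y hy
    obtain ⟨hz, hzy⟩ := hσ y (htgt y hy)
    rw [hGe y (htgt y hy)]
    set z := e.symm y
    obtain ⟨hJ1, hJ2⟩ := hJ z hz
    set J := (fderiv ℝ ψ z).det
    have hJ0 : 0 < J := by linarith
    rw [abs_of_pos hJ0, div_sub' hJ0.ne', abs_div, abs_of_pos hJ0, div_le_iff₀ hJ0]
    have e1 : |F z - J * F 0| ≤ (|C₃| + F 0 * (c * C₂)) * ‖z‖ := by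
      calc |F z - J * F 0| = |(F z - F 0) - F 0 * (J - 1)| := by congr 1; ring
        _ ≤ |F z - F 0| + |F 0 * (J - 1)| := abs_sub _ _
        _ ≤ |C₃| * ‖z‖ + F 0 * (c * C₂ * ‖z‖) := by
            rw [abs_mul, abs_of_pos hF0]
            have := hFs z hz
            gcongr
        _ = _ := by ring
    refine e1.trans ?_
    have h0 : 0 ≤ (|C₃| + F 0 * (c * C₂)) * ‖z‖ := by positivity
    nlinarith
  set Cn := 4 * (|C₃| + F 0 * (c * C₂)) + (4 * C₁ + 4 * C₂ * ‖A‖) + (8 * C₁ + 16 * C₁ * C₂)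
    with hCn
  have hC₁ := hT.nonneg
  have hq1 : 0 ≤ 4 * (|C₃| + F 0 * (c * C₂)) := by positivity
  have hq2 : 0 ≤ 4 * C₁ + 4 * C₂ * ‖A‖ := by positivity
  have hq3 : 0 ≤ 8 * C₁ + 16 * C₁ * C₂ := by positivity
  refine ⟨Φ, G, ρ, Cn, hρ, by positivity, ?_, ?_, fun y hy => ?_, fun y hy => ?_, fun y hy => ?_,
    fun y hy => ?_, fun b hb y hy => ?_, fun S hS hSρ => ?_⟩
  · exact ((measurable_indicator_of_continuousOn hBm hφc).comp hσm).sub_const _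
  · exact ((measurable_indicator_of_continuousOn hBm hFc).comp hσm).div
      ((ContinuousLinearMap.continuous_det.measurable.comp
        ((measurable_fderiv ℝ ψ).comp hσm)).abs)
  · obtain ⟨hz, hzy⟩ := hσ y (htgt y hy)
    rw [hΦe y (htgt y hy), ← hnormψ _ hz, hzy]
  · obtain ⟨hz, hzy⟩ := hσ y (htgt y hy)
    have h1 := hGsub y hy
    have h2 : 4 * (|C₃| + F 0 * (c * C₂)) / F 0 * ‖e.symm y‖ ≤ 1 / 2 :=
      hκle _ (by rw [hκ]; linarith) _ hz
    rw [div_mul_eq_mul_div, div_le_iff₀ hF0] at h2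
    have h3 := (abs_le.1 h1).1
    nlinarith
  · have h2 := (hσn y (htgt y hy)).1
    refine (hGsub y hy).trans ?_
    calc 2 * (|C₃| + F 0 * (c * C₂)) * ‖e.symm y‖
        ≤ 2 * (|C₃| + F 0 * (c * C₂)) * (2 * ‖y‖) := by gcongr
      _ = 4 * (|C₃| + F 0 * (c * C₂)) * ‖y‖ := by ring
      _ ≤ Cn * ‖y‖ := by gcongr; rw [hCn]; linarith
  · obtain ⟨hz, hzy⟩ := hσ y (htgt y hy)
    obtain ⟨h1, h2⟩ := hσn y (htgt y hy)
    rw [hΦe y (htgt y hy)]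
    have h3 := hTf.sub_linear (hbR _ hz)
    rw [hf0, sub_zero] at h3
    calc ‖f (e.symm y) - A y‖ = ‖(f (e.symm y) - A (e.symm y)) + A (e.symm y - y)‖ := by
          rw [map_sub]; congr 1; abel
      _ ≤ C₁ * ‖e.symm y‖ ^ 2 + ‖A‖ * ‖e.symm y - y‖ :=
          (norm_add_le _ _).trans (add_le_add h3 (A.le_opNorm _))
      _ ≤ C₁ * (2 * ‖y‖) ^ 2 + ‖A‖ * (4 * C₂ * ‖y‖ ^ 2) := by gcongr
      _ = (4 * C₁ + 4 * C₂ * ‖A‖) * ‖y‖ ^ 2 := by ring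
      _ ≤ _ := by gcongr; rw [hCn]; linarith
  · have hy' : ‖A (-y)‖ < ρ := by simpa using hy
    obtain ⟨hz, hzy⟩ := hσ y (htgt y hy)
    obtain ⟨h1, h2⟩ := hσn y (htgt y hy)
    obtain ⟨hz', hzy'⟩ := hσ (-y) (htgt _ hy')
    obtain ⟨h1', h2'⟩ := hσn (-y) (htgt _ hy')
    rw [hΦe y (htgt y hy), hΦe _ (htgt _ hy')]
    set z := e.symm y
    set z' := e.symm (-y)
    rw [norm_neg] at h1' h2'
    have hzz : ‖-z - z'‖ ≤ 8 * C₂ * ‖y‖ ^ 2 := by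
      calc ‖-z - z'‖ = ‖(z - y) + (z' - -y)‖ := by rw [← norm_neg]; congr 1; abel
        _ ≤ _ := norm_add_le _ _
        _ ≤ _ := by linarith
    have e1 : ‖f z - f (-z) - (2 : ℝ) • A z‖ ≤ C₁ * (2 * ‖y‖) ^ 3 :=
      (hTf.odd_part z (hbR z hz)).trans (by gcongr)
    have e2 : ‖(f (-z) - A (-z)) - (f z' - A z')‖ ≤ C₁ * (2 * ‖y‖) * (8 * C₂ * ‖y‖ ^ 2) := by
      have hs : max ‖z‖ ‖z'‖ < R := max_lt (by simpa using hbR z hz) (by simpa using hbR z' hz')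
      refine (hTf.lipschitz_sub hs (x := z') (y := -z) (le_max_right _ _)
        (by rw [norm_neg]; exact le_max_left _ _)).trans ?_
      have : max ‖z‖ ‖z'‖ ≤ 2 * ‖y‖ := max_le h1 h1'
      gcongr
    -- Since b annihilates the range of A, linear terms can be inserted freely: what is left is the
    -- odd part of f at z and an increment of the remainder between -z and z'.
    have e3 : inner ℝ b (f z) - inner ℝ b (f z') =
        inner ℝ b ((f z - f (-z) - (2 : ℝ) • A z) + ((f (-z) - A (-z)) - (f z' - A z'))) := by
      simp only [inner_add_right, inner_sub_right, inner_smul_right, hb]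
      ring
    rw [e3]
    refine (abs_real_inner_le_norm _ _).trans ?_
    have e4 := (norm_add_le (f z - f (-z) - (2 : ℝ) • A z)
      ((f (-z) - A (-z)) - (f z' - A z'))).trans (add_le_add e1 e2)
    calc _ ≤ ‖b‖ * (C₁ * (2 * ‖y‖) ^ 3 + C₁ * (2 * ‖y‖) * (8 * C₂ * ‖y‖ ^ 2)) := by gcongr
      _ = (8 * C₁ + 16 * C₁ * C₂) * ‖b‖ * ‖y‖ ^ 3 := by ring
      _ ≤ _ := by gcongr; rw [hCn]; linarith
  · have hSμ : S ⊆ sqBall x₀ μ := hSρ.trans (by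
      rw [sqBall_eq_ball]; exact Metric.ball_subset_ball (min_le_right _ _))
    set s := B ∩ φ ⁻¹' S with hs
    -- Here the homeomorphism hypothesis enters: no distant piece of the chart domain is mapped back
    -- close to x₀.
    have hset : sqBall 0 r ∩ φ ⁻¹' S = s := by
      ext z
      refine ⟨fun ⟨h1, h2⟩ => ⟨hpre z h1 ?_, h2⟩, fun ⟨h1, h2⟩ => ⟨hsub_sq z h1, h2⟩⟩
      have := mem_ball_iff_norm.1 (hSρ h2)
      exact this.trans_le ((min_le_left _ _).trans (min_le_left _ _))
    have hsm : MeasurableSet s := by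
      have := measurable_indicator_of_continuousOn hBm hφc
      have hs2 : s = B ∩ (B.indicator φ) ⁻¹' S := by
        ext z
        simp only [hs, Set.mem_inter_iff, Set.mem_preimage]
        refine and_congr_right fun hz => ?_
        rw [Set.indicator_of_mem hz]
      rw [hs2]
      exact hBm.inter (this hS)
    have himg : {y | ‖A y‖ < ρ} ∩ {y | x₀ + Φ y ∈ S} = ψ '' s := by
      ext y
      constructor
      · rintro ⟨hy, hyS⟩
        obtain ⟨hz, hzy⟩ := hσ y (htgt y hy)
        refine ⟨e.symm y, ⟨hz, ?_⟩, hzy⟩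
        have hyS' : x₀ + Φ y ∈ S := hyS
        rw [hΦe y (htgt y hy)] at hyS'
        simpa [hf] using hyS'
      · rintro ⟨z, ⟨hz, hzS⟩, rfl⟩
        have h1 : ‖A (ψ z)‖ < ρ := by
          rw [hnormψ z hz]
          exact mem_ball_iff_norm.1 (hSρ hzS)
        refine ⟨h1, ?_⟩
        have h2 : e.symm (ψ z) = z := by
          have := e.left_inv (x := z) (hes ▸ hz)
          rwa [heψ] at this
        change x₀ + Φ (ψ z) ∈ S
        rw [hΦe _ (htgt _ h1), h2]
        simpa [hf] using hzS
    have hinj : Set.InjOn ψ s := by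
      have := e.injOn
      rw [heψ, hes] at this
      exact this.mono Set.inter_subset_left
    rw [hF.law S hS hSμ, hset, himg, lintegral_image_eq_lintegral_abs_det_fderiv_mul volume hsm
      (fun z hz => (hψ z (hb1 z hz.1)).1.hasFDerivAt.hasFDerivWithinAt) hinj]
    refine setLIntegral_congr_fun hsm fun z hz => ?_
    have hzt : ψ z ∈ e.target := by
      have := e.map_source (x := z) (hes ▸ hz.1)
      rwa [heψ] at this
    have h2 : e.symm (ψ z) = z := by
      have := e.left_inv (x := z) (hes ▸ hz.1)
      rwa [heψ] at this
    have hJ2 := (hJ z hz.1).2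
    rw [hGe _ hzt, h2, ← ENNReal.ofReal_mul (abs_nonneg _)]
    congr 1
    rw [mul_div_cancel₀]
    exact abs_ne_zero.2 (by linarith)

/-- A curve in the manifold lifts to u(t), which tends to 0 because φ is a homeomorphism onto its
image. The lower bound m‖u‖ ≤ ‖A u‖ upgrades this to u(t) = O(t), so A u(t)/t tends to the velocity,
and the range of A is closed. Conversely A w is the velocity of t ↦ φ(t w). -/
theorem tangentVectors_localManifold {d p : ℕ} {x₀ : Eucl p}
    {φ : Eucl d → Eucl p} {r μ : ℝ} (hr : 0 < r) (hμ : 0 < μ) (hφ : IsLocalChart φ r x₀) :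
    tangentVectors (localManifold φ r x₀ μ) x₀ = Set.range (fderiv ℝ φ 0) := by
  have h0mem : (0 : Eucl d) ∈ sqBall (0 : Eucl d) r := mem_of_mem_nhds (sqBall_mem_nhds _ hr)
  have hd0 : HasFDerivAt φ (fderiv ℝ φ 0) 0 :=
    (hφ.thrice_diff.1.differentiableAt (sqBall_mem_nhds _ hr)).hasFDerivAt
  set A := fderiv ℝ φ 0 with hAdef
  obtain ⟨m, hm, hA⟩ := exists_mul_norm_le A (hφ.immersion 0 h0mem)
  ext v
  constructor
  · rintro ⟨c, hc0, hcS, hcd⟩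
    -- a lift of the curve to the chart domain
    have hlift : ∀ t, ∃ u : Eucl d, c t ∈ localManifold φ r x₀ μ →
        u ∈ sqBall (0 : Eucl d) r ∧ φ u = c t := fun t => by
      by_cases h : c t ∈ localManifold φ r x₀ μ
      · obtain ⟨u, hu, hu'⟩ := h.1
        exact ⟨u, fun _ => ⟨hu, hu'⟩⟩
      · exact ⟨0, fun h' => absurd h' h⟩
    choose u hu using hlift
    have hut : Tendsto u (𝓝 0) (𝓝 0) := by
      refine tendsto_def.2 fun U hU => ?_
      obtain ⟨ρ, hρ, hpre⟩ := hφ.exists_preimage_subset hr hU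
      have hcont : ∀ᶠ t in 𝓝 (0 : ℝ), ‖c t - x₀‖ < ρ := by
        have := hcd.continuousAt.tendsto
        rw [hc0] at this
        simpa [dist_eq_norm] using this.eventually (Metric.ball_mem_nhds x₀ hρ)
      filter_upwards [hcS, hcont] with t ht1 ht2
      obtain ⟨h1, h2⟩ := hu t ht1
      exact hpre _ h1 (by rwa [h2])
    have hcu : ∀ᶠ t in 𝓝 (0 : ℝ), φ (u t) = c t := by
      filter_upwards [hcS] with t ht using (hu t ht).2
    have hlit : (fun t => φ (u t) - x₀ - A (u t)) =o[𝓝 (0 : ℝ)] u := by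
      have := hd0.isLittleO.comp_tendsto hut
      simpa [Function.comp_def, hφ.map_zero] using this
    have hAu : u =O[𝓝 (0 : ℝ)] fun t => A (u t) := by
      refine IsBigO.of_bound m⁻¹ (Eventually.of_forall fun t => ?_)
      rw [inv_mul_eq_div, le_div_iff₀ hm, mul_comm]
      exact hA _
    have hAc : (fun t => A (u t)) =O[𝓝 (0 : ℝ)] fun t => φ (u t) - x₀ := by
      have := (hlit.trans_isBigO hAu).right_isBigO_add
      simpa using this
    have hct : (fun t => φ (u t) - x₀) =O[𝓝 (0 : ℝ)] fun t => t := by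
      have h1 := hcd.differentiableAt.isBigO_sub
      simp only [hc0, sub_zero] at h1
      refine h1.congr' ?_ EventuallyEq.rfl
      filter_upwards [hcu] with t ht
      rw [ht]
    have hlit2 : (fun t => φ (u t) - x₀ - A (u t)) =o[𝓝 (0 : ℝ)] fun t => t :=
      hlit.trans_isBigO ((hAu.trans hAc).trans hct)
    -- the velocity is a limit of elements of the range
    have hlin : (fun t : ℝ => A (u t) - t • v) =o[𝓝 (0 : ℝ)] fun t => t := by
      have h1 := (hasDerivAt_iff_isLittleO_nhds_zero.1 hcd)
      simp only [zero_add, hc0] at h1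
      refine (h1.sub hlit2).congr' ?_ EventuallyEq.rfl
      filter_upwards [hcu] with t ht
      rw [ht]
      abel
    have hclosed : IsClosed (LinearMap.range (A : Eucl d →ₗ[ℝ] Eucl p) : Set (Eucl p)) :=
      Submodule.closed_of_finiteDimensional _
    have hlim : Tendsto (fun t : ℝ => t⁻¹ • A (u t)) (𝓝[≠] 0) (𝓝 v) := by
      have h1 := hlin.mono (nhdsWithin_le_nhds (a := (0 : ℝ)) (s := {0}ᶜ))
      have h2 : Tendsto (fun t : ℝ => t⁻¹ • (A (u t) - t • v)) (𝓝[≠] 0) (𝓝 0) := by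
        rw [tendsto_zero_iff_norm_tendsto_zero]
        have h3 := h1.norm_norm.tendsto_div_nhds_zero
        refine h3.congr fun t => ?_
        rw [norm_smul, norm_inv, div_eq_inv_mul]
      have h4 := h2.add_const v
      rw [zero_add] at h4
      refine h4.congr' ?_
      filter_upwards [self_mem_nhdsWithin] with t ht
      rw [smul_sub, smul_smul, inv_mul_cancel₀ ht, one_smul, sub_add_cancel]
    have := hclosed.mem_of_tendsto hlim (Eventually.of_forall fun t =>
      ⟨t⁻¹ • u t, by simp⟩)
    obtain ⟨w, hw⟩ := this
    exact ⟨w, hw⟩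
  · rintro ⟨w, rfl⟩
    have hline : HasDerivAt (fun t : ℝ => t • w) w 0 := by
      simpa using (hasDerivAt_id (0 : ℝ)).smul_const w
    have hd0' : HasFDerivAt φ A ((fun t : ℝ => t • w) 0) := by simpa using hd0
    have hcomp : HasDerivAt (fun t : ℝ => φ (t • w)) (A w) 0 := hd0'.comp_hasDerivAt 0 hline
    refine ⟨fun t => φ (t • w), by simp [hφ.map_zero], ?_, hcomp⟩
    have e1 : ∀ᶠ t in 𝓝 (0 : ℝ), t • w ∈ sqBall (0 : Eucl d) r :=
      hline.continuousAt.eventually_mem (by simpa using sqBall_mem_nhds (0 : Eucl d) hr)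
    have e2 : ∀ᶠ t in 𝓝 (0 : ℝ), φ (t • w) ∈ sqBall x₀ μ :=
      hcomp.continuousAt.eventually_mem (by simpa [hφ.map_zero] using sqBall_mem_nhds x₀ hμ)
    filter_upwards [e1, e2] with t h1 h2
    exact ⟨⟨_, h1, rfl⟩, h2⟩

/-! ### Integrals against the law in the radial chart -/

section ChartIntegrals

variable {d p : ℕ} {ν : Measure (Eucl p)} {x₀ : Eucl p} {A : Eucl d →L[ℝ] Eucl p}
  {F₀ : ℝ} {Φ : Eucl d → Eucl p} {G : Eucl d → ℝ} {ρ C : ℝ}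

lemma measurableSet_norm_apply_lt (A : Eucl d →L[ℝ] Eucl p) (s : ℝ) :
    MeasurableSet {y | ‖A y‖ < s} :=
  measurableSet_lt A.continuous.norm.measurable measurable_const

/-- Exactness of the norm identity is the point: the ball of radius s pulls back to {‖A y‖ < s}, a
set symmetric about the origin. -/
lemma IsRadialChart.restrict_eq (h : IsRadialChart ν x₀ A F₀ Φ G ρ C) {s : ℝ} (hs : s ≤ ρ) :
    ν.restrict (Metric.ball x₀ s) = Measure.map (fun y => x₀ + Φ y)
      ((volume.restrict {y | ‖A y‖ < s}).withDensity fun y => ENNReal.ofReal (G y)) := by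
  have hm : Measurable fun y => x₀ + Φ y := h.meas_chart.const_add x₀
  ext S hS
  rw [Measure.restrict_apply hS, Measure.map_apply hm hS, withDensity_apply _ (hm hS),
    Measure.restrict_restrict (hm hS), h.law _ (hS.inter Metric.isOpen_ball.measurableSet)
    (Set.inter_subset_right.trans (Metric.ball_subset_ball hs))]
  congr 2
  ext y
  simp only [Set.mem_inter_iff, Set.mem_preimage, mem_ball_iff_norm]
  constructor
  · rintro ⟨h1, h2, h3⟩
    refine ⟨h2, ?_⟩
    rw [add_sub_cancel_left, h.norm_eq y h1] at h3
    exact h3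
  · rintro ⟨h2, h1⟩
    have h1' : ‖A y‖ < s := h1
    have h1'' := h1'.trans_le hs
    exact ⟨h1'', h2, by rwa [add_sub_cancel_left, h.norm_eq y h1'']⟩

lemma IsRadialChart.setLIntegral_eq (h : IsRadialChart ν x₀ A F₀ Φ G ρ C) {s : ℝ} (hs : s ≤ ρ)
    {g : Eucl p → ENNReal} (hg : Measurable g) :
    ∫⁻ x in Metric.ball x₀ s, g x ∂ν =
      ∫⁻ y in {y | ‖A y‖ < s}, ENNReal.ofReal (G y) * g (x₀ + Φ y) := by
  have hm : Measurable fun y => x₀ + Φ y := h.meas_chart.const_add x₀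
  rw [h.restrict_eq hs, lintegral_map hg hm]
  exact lintegral_withDensity_eq_lintegral_mul _ h.meas_density.ennreal_ofReal (hg.comp hm)

lemma IsRadialChart.setIntegral_eq (h : IsRadialChart ν x₀ A F₀ Φ G ρ C) (hF₀ : 0 ≤ F₀)
    {s : ℝ} (hs : s ≤ ρ) {g : Eucl p → ℝ} (hg : Measurable g) :
    ∫ x in Metric.ball x₀ s, g x ∂ν = ∫ y in {y | ‖A y‖ < s}, G y * g (x₀ + Φ y) := by
  have hm : Measurable fun y => x₀ + Φ y := h.meas_chart.const_add x₀
  rw [h.restrict_eq hs, integral_map hm.aemeasurable hg.aestronglyMeasurable,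
    integral_withDensity_eq_integral_toReal_smul h.meas_density.ennreal_ofReal (by simp)]
  refine setIntegral_congr_fun (measurableSet_norm_apply_lt A s) fun y hy => ?_
  have hG : 0 ≤ G y := le_trans (by positivity) (h.density_ge y (lt_of_lt_of_le hy hs))
  simp [ENNReal.toReal_ofReal hG]

end ChartIntegrals

/-! ### Bandwidth arithmetic -/

section Bandwidth

variable {κ : ℝ} {d : ℕ}

lemma bandwidth_pos (hκ : 0 < κ) {n : ℕ} (hn : 0 < n) : 0 < bandwidth κ d n := by
  have : (0 : ℝ) < n := by exact_mod_cast hn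
  exact mul_pos hκ (Real.rpow_pos_of_pos this _)

lemma eventually_bandwidth_pos (hκ : 0 < κ) : ∀ᶠ n in atTop, 0 < bandwidth κ d n := by
  filter_upwards [eventually_gt_atTop 0] with n hn using bandwidth_pos hκ hn

lemma tendsto_bandwidth : Tendsto (bandwidth κ d) atTop (𝓝 0) := by
  have h1 : Tendsto (fun n : ℕ => (n : ℝ) ^ (-(1 / ((d : ℝ) + 4)))) atTop (𝓝 0) :=
    (tendsto_rpow_neg_atTop (by positivity)).comp tendsto_natCast_atTop_atTop
  have h2 := h1.const_mul κ
  rw [mul_zero] at h2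
  refine h2.congr fun n => ?_
  rw [bandwidth, neg_div]

/-- Squared bias h^4 and variance 1/(n h^d) are balanced; this identity converts one into the other.
-/
lemma natCast_mul_bandwidth_pow {n : ℕ} (hn : 0 < n) :
    n * bandwidth κ d n ^ (d + 4) = κ ^ (d + 4) := by
  have hn' : (0 : ℝ) < n := by exact_mod_cast hn
  rw [bandwidth, mul_pow, ← Real.rpow_natCast ((n : ℝ) ^ _), ← Real.rpow_mul hn'.le]
  have : -1 / ((d : ℝ) + 4) * ((d + 4 : ℕ) : ℝ) = -1 := by
    push_cast
    field_simp
  rw [this, Real.rpow_neg_one]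
  field_simp

/-- Along dyadic sample sizes the bandwidth is geometric, so the shell bounds below sum as geometric
series. -/
lemma bandwidth_two_pow (k : ℕ) :
    bandwidth κ d (2 ^ k) = κ * ((2 : ℝ) ^ (-1 / ((d : ℝ) + 4))) ^ k := by
  rw [bandwidth]
  push_cast
  rw [← Real.rpow_natCast, ← Real.rpow_mul (by norm_num), ← Real.rpow_natCast,
    ← Real.rpow_mul (by norm_num), mul_comm (k : ℝ)]

end Bandwidth

/-! ### The tail condition in usable form -/

lemma IsKernel.continuous {p : ℕ} {K : Eucl p → ℝ} (hK : IsKernel K) : Continuous K :=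
  continuous_iff_continuousAt.2 fun x =>
    ((hK.thrice_diff.1 x trivial).differentiableAt univ_mem).continuousAt

/-- The extremal admissible weight M(1 + ‖x‖²) dominates all the others, so one nonnegative integral
suffices. -/
lemma TailCondition.eventually_lintegral_le {p d : ℕ} {K : Eucl p → ℝ} (hK : IsKernel K)
    {ν : Measure (Eucl p)} {x₀ : Eucl p} {h : ℕ → ℝ} {ε M : ℝ} (hM : 0 < M)
    (hh : ∀ᶠ n in atTop, 0 < h n) (htail : TailCondition K ν x₀ d h ε M)
    {γ : ℕ} (hγ : γ = 1 ∨ γ = 2) {θ : ℝ} (hθ : 0 < θ) :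
    ∀ᶠ n in atTop, ∫⁻ x in (Metric.ball x₀ (Real.sqrt (h n ^ (1 - ε))))ᶜ,
      ENNReal.ofReal (K ((h n)⁻¹ • (x - x₀)) ^ γ * (1 + ‖x‖ ^ 2)) ∂ν
        ≤ ENNReal.ofReal (θ * h n ^ (d + 4)) := by
  obtain ⟨h1, h2⟩ := htail γ hγ (fun x => M * (1 + ‖x‖ ^ 2)) (by fun_prop)
    (fun x => by rw [abs_of_nonneg (by positivity)])
  have h3 := h2.bound (mul_pos hM hθ)
  filter_upwards [h1, h3, hh] with n hn1 hn2 hn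
  rw [← sqBall_eq_ball]
  set I := fun x => K ((h n)⁻¹ • (x - x₀)) ^ γ * (1 + ‖x‖ ^ 2) with hI
  have hI0 : ∀ x, 0 ≤ I x := fun x => mul_nonneg (pow_nonneg (hK.nonneg _) _) (by positivity)
  have heq : (fun x => K ((h n)⁻¹ • (x - x₀)) ^ γ * (M * (1 + ‖x‖ ^ 2))) = fun x => M * I x := by
    ext x; simp only [hI]; ring
  rw [heq] at hn1 hn2
  have hint : IntegrableOn I (sqBall x₀ (h n ^ (1 - ε)))ᶜ ν := by
    have := hn1.const_mul M⁻¹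
    simpa [← mul_assoc, inv_mul_cancel₀ hM.ne', IntegrableOn] using this
  rw [← ofReal_integral_eq_lintegral_ofReal hint (Eventually.of_forall hI0)]
  refine ENNReal.ofReal_le_ofReal ?_
  rw [integral_const_mul, norm_mul, Real.norm_of_nonneg hM.le,
    Real.norm_of_nonneg (integral_nonneg hI0), Real.norm_of_nonneg (by positivity), mul_assoc] at hn2
  exact le_of_mul_le_mul_left hn2 hM

lemma lintegral_comp_smul_eucl {d : ℕ} {h : ℝ} (hh : 0 < h) {g : Eucl d → ENNReal}
    (hg : Measurable g) :
    ∫⁻ u, g (h • u) = ENNReal.ofReal ((h ^ d)⁻¹) * ∫⁻ y, g y := by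
  have := Measure.map_addHaar_smul (volume : Measure (Eucl d)) hh.ne'
  rw [← lintegral_map hg (measurable_const_smul h), this, lintegral_smul_measure, smul_eq_mul]
  rw [abs_of_pos (by positivity), finrank_euclideanSpace_fin]

/-! ### Fourth moments of the kernel on the tangent space -/

section Moments

variable {d p : ℕ} {ν : Measure (Eucl p)} {x₀ : Eucl p} {A : Eucl d →L[ℝ] Eucl p}
  {F₀ : ℝ} {Φ : Eucl d → Eucl p} {G : Eucl d → ℝ} {ρ C : ℝ}

/-- The mass of the kernel on a shell is controlled by its mass under `ν`. -/
lemma IsRadialChart.lintegral_shell_le (hc : IsRadialChart ν x₀ A F₀ Φ G ρ C) (hF₀ : 0 < F₀)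
    {K : Eucl p → ℝ} (hK : IsKernel K) (γ : ℕ) {h s θ : ℝ} (hh : 0 < h)
    (hle : ∫⁻ x in (Metric.ball x₀ s)ᶜ,
      ENNReal.ofReal (K (h⁻¹ • (x - x₀)) ^ γ * (1 + ‖x‖ ^ 2)) ∂ν
        ≤ ENNReal.ofReal (θ * h ^ (d + 4))) :
    ∫⁻ u in {u | s / h ≤ ‖A u‖ ∧ ‖A u‖ < ρ / h}, ENNReal.ofReal (K (A u) ^ γ)
      ≤ ENNReal.ofReal (2 / F₀ * θ * h ^ 4) := by
  have hKc := hK.continuous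
  set S : Set (Eucl d) := {y | s ≤ ‖A y‖ ∧ ‖A y‖ < ρ} with hS
  have hSm : MeasurableSet S := (measurableSet_le measurable_const A.continuous.norm.measurable).inter
    (measurableSet_norm_apply_lt A ρ)
  have hS' : {u | s / h ≤ ‖A u‖ ∧ ‖A u‖ < ρ / h} = {u | h • u ∈ S} := by
    ext u
    simp only [hS, Set.mem_ofPred_eq, map_smul, norm_smul, Real.norm_of_nonneg hh.le,
      div_le_iff₀ hh, lt_div_iff₀ hh, mul_comm h]
  have hS'm : MeasurableSet {u : Eucl d | h • u ∈ S} := measurable_const_smul h hSm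
  set g : Eucl d → ENNReal := S.indicator fun y => ENNReal.ofReal (K (h⁻¹ • A y) ^ γ) with hg
  have hgm : Measurable g := Measurable.indicator (by fun_prop) hSm
  have e1 : ∫⁻ u in {u | s / h ≤ ‖A u‖ ∧ ‖A u‖ < ρ / h}, ENNReal.ofReal (K (A u) ^ γ)
      = ∫⁻ u, g (h • u) := by
    rw [hS', ← lintegral_indicator hS'm]
    refine lintegral_congr fun u => ?_
    by_cases hu : h • u ∈ S
    · rw [Set.indicator_of_mem (show u ∈ {u : Eucl d | h • u ∈ S} from hu), hg,
        Set.indicator_of_mem hu, map_smul, smul_smul, inv_mul_cancel₀ hh.ne', one_smul]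
    · rw [Set.indicator_of_notMem (show u ∉ {u : Eucl d | h • u ∈ S} from hu), hg,
        Set.indicator_of_notMem hu]
  rw [e1, lintegral_comp_smul_eucl hh hgm]
  set q : Eucl p → ENNReal := (Metric.ball x₀ s)ᶜ.indicator
    fun x => ENNReal.ofReal (K (h⁻¹ • (x - x₀)) ^ γ * (1 + ‖x‖ ^ 2)) with hq
  have hbm : MeasurableSet (Metric.ball x₀ s)ᶜ := Metric.isOpen_ball.measurableSet.compl
  have hqm : Measurable q := Measurable.indicator (by fun_prop) hbm
  -- The density is at least half its central value on the chart, so Lebesgue mass is at most 2/F₀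
  -- times mass under the law; radial symmetry of `K` exchanges `A y` for `Φ y`.
  have e2 : ∫⁻ y, g y ≤ ENNReal.ofReal (2 / F₀) *
      ∫⁻ y in {y | ‖A y‖ < ρ}, ENNReal.ofReal (G y) * q (x₀ + Φ y) := by
    rw [← lintegral_const_mul' _ _ ENNReal.ofReal_ne_top,
      ← lintegral_indicator (measurableSet_norm_apply_lt A ρ)]
    refine lintegral_mono fun y => ?_
    by_cases hy : y ∈ S
    · have hyρ : ‖A y‖ < ρ := hy.2
      rw [hg, Set.indicator_of_mem hy, Set.indicator_of_mem (show y ∈ {y | ‖A y‖ < ρ} from hyρ),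
        hq, Set.indicator_of_mem]
      · have hG := hc.density_ge y hyρ
        have hK1 : K (h⁻¹ • A y) = K (h⁻¹ • (x₀ + Φ y - x₀)) :=
          hK.radial _ _ (by rw [add_sub_cancel_left, norm_smul, norm_smul, hc.norm_eq y hyρ])
        rw [hK1, ← ENNReal.ofReal_mul (by linarith), ← ENNReal.ofReal_mul (by positivity)]
        refine ENNReal.ofReal_le_ofReal ?_
        have hK0 : 0 ≤ K (h⁻¹ • (x₀ + Φ y - x₀)) ^ γ := pow_nonneg (hK.nonneg _) _
        set k := K (h⁻¹ • (x₀ + Φ y - x₀)) ^ γ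
        have h1 : 1 ≤ 2 / F₀ * G y := by
          rw [div_mul_eq_mul_div, le_div_iff₀ hF₀]; linarith
        calc k = 1 * (k * 1) := by ring
          _ ≤ (2 / F₀ * G y) * (k * (1 + ‖x₀ + Φ y‖ ^ 2)) := by
            gcongr
            linarith [sq_nonneg ‖x₀ + Φ y‖]
          _ = _ := by ring
      · have : s ≤ ‖Φ y‖ := by rw [hc.norm_eq y hyρ]; exact hy.1
        simpa [mem_ball_iff_norm] using this
    · rw [hg, Set.indicator_of_notMem hy]
      exact zero_le
  have e3 : ∫⁻ y in {y | ‖A y‖ < ρ}, ENNReal.ofReal (G y) * q (x₀ + Φ y)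
      ≤ ENNReal.ofReal (θ * h ^ (d + 4)) := by
    rw [← hc.setLIntegral_eq le_rfl hqm]
    refine (setLIntegral_le_lintegral _ _).trans ?_
    rw [hq, lintegral_indicator hbm]
    exact hle
  calc ENNReal.ofReal (h ^ d)⁻¹ * ∫⁻ y, g y
      ≤ ENNReal.ofReal (h ^ d)⁻¹ *
        (ENNReal.ofReal (2 / F₀) * ENNReal.ofReal (θ * h ^ (d + 4))) := by
        gcongr
        exact e2.trans (by gcongr)
    _ = ENNReal.ofReal (2 / F₀ * θ * h ^ 4) := by
        rw [← ENNReal.ofReal_mul (by positivity), ← ENNReal.ofReal_mul (by positivity)]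
        congr 1
        rw [pow_add]
        field_simp

lemma tendsto_sqrt_rpow {h : ℕ → ℝ} (h0 : Tendsto h atTop (𝓝 0)) {ε : ℝ} (hε : ε < 1) :
    Tendsto (fun n => Real.sqrt (h n ^ (1 - ε))) atTop (𝓝 0) := by
  have h1 : Tendsto (fun n => h n ^ (1 - ε)) atTop (𝓝 0) := by
    have := h0.rpow_const (p := 1 - ε) (Or.inr (by linarith))
    rwa [Real.zero_rpow (by linarith)] at this
  simpa using h1.sqrt

lemma tendsto_sqrt_rpow_div {h : ℕ → ℝ} (h0 : Tendsto h atTop (𝓝 0))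
    (hpos : ∀ᶠ n in atTop, 0 < h n) {ε : ℝ} (hε : 0 < ε) :
    Tendsto (fun n => Real.sqrt (h n ^ (1 - ε)) / h n) atTop atTop := by
  have h0' : Tendsto h atTop (𝓝[>] 0) := tendsto_nhdsWithin_iff.2 ⟨h0, hpos⟩
  have h1 : Tendsto (fun n => (h n) ^ (-(1 + ε) / 2)) atTop atTop :=
    (tendsto_rpow_neg_nhdsGT_zero (by linarith)).comp h0'
  refine h1.congr' ?_
  filter_upwards [hpos] with n hn
  rw [Real.sqrt_eq_rpow, ← Real.rpow_mul hn.le]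
  nth_rewrite 3 [← Real.rpow_one (h n)]
  rw [← Real.rpow_sub hn]
  congr 1
  ring

/-- Let h_k be the bandwidth at 2^k and s_k the truncation radius. The tail condition at that sample
size bounds the mass of `K ^ γ` on the shell s_k/h_k ≤ ‖A u‖ < s_{k+1}/h_{k+1} by a multiple of
h_k^4. There ‖u‖^4 is at most a multiple of s_{k+1}^4/h_{k+1}^4, and s_{k+1}^4 = h_{k+1}^{2(1-ε)}.
The product is of order h_{k+1}^{2(1-ε)}, which is summable since ε < 1. -/
theorem integrable_kernel_pow_mul (hc : IsRadialChart ν x₀ A F₀ Φ G ρ C) (hF₀ : 0 < F₀)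
    {m : ℝ} (hm : 0 < m) (hA : ∀ u, m * ‖u‖ ≤ ‖A u‖)
    {K : Eucl p → ℝ} (hK : IsKernel K) {κ : ℝ} (hκ : 0 < κ) {M ε : ℝ} (hM : 0 < M)
    (hε0 : 0 < ε) (hε1 : ε < 1) (htail : TailCondition K ν x₀ d (bandwidth κ d) ε M)
    {γ : ℕ} (hγ : γ = 1 ∨ γ = 2) :
    Integrable fun u : Eucl d => K (A u) ^ γ * (1 + ‖u‖ ^ 4) := by
  have hKc := hK.continuous
  have hρ := hc.pos
  set h : ℕ → ℝ := fun k => bandwidth κ d (2 ^ k) with hh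
  set q : ℝ := (2 : ℝ) ^ (-1 / ((d : ℝ) + 4)) with hq
  have hq0 : 0 < q := Real.rpow_pos_of_pos (by norm_num) _
  have hq1 : q < 1 := Real.rpow_lt_one_of_one_lt_of_neg (by norm_num)
    (div_neg_of_neg_of_pos (by norm_num) (by positivity))
  have hhk : ∀ k, h k = κ * q ^ k := fun k => bandwidth_two_pow k
  have hpos : ∀ k, 0 < h k := fun k => by rw [hhk]; positivity
  have htp : Tendsto (fun k : ℕ => 2 ^ k) atTop atTop :=
    tendsto_pow_atTop_atTop_of_one_lt (by norm_num)
  have h0 : Tendsto h atTop (𝓝 0) := tendsto_bandwidth.comp htp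
  set s : ℕ → ℝ := fun k => Real.sqrt (h k ^ (1 - ε)) with hs
  have hs0 : Tendsto s atTop (𝓝 0) := tendsto_sqrt_rpow h0 hε1
  have hR : Tendsto (fun k => s k / h k) atTop atTop :=
    tendsto_sqrt_rpow_div h0 (Eventually.of_forall hpos) hε0
  have hev1 := htp.eventually (htail.eventually_lintegral_le hK hM (eventually_bandwidth_pos hκ) hγ
    one_pos)
  -- Because h_{k+1} = q h_k, this keeps the whole k-th shell, after scaling by h_k, inside the
  -- chart.
  have hev2 : ∀ᶠ k in atTop, s (k + 1) ≤ ρ * q :=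
    ((tendsto_add_atTop_iff_nat 1).2 hs0).eventually_le_const (by positivity)
  obtain ⟨k₀, hk₀⟩ := eventually_atTop.1 (hev1.and hev2)
  set S : ℕ → Set (Eucl d) := fun k => {u | s k / h k ≤ ‖A u‖ ∧ ‖A u‖ < s (k + 1) / h (k + 1)}
    with hS
  set I : Eucl d → ℝ := fun u => K (A u) ^ γ * (1 + ‖u‖ ^ 4) with hI
  have hIc : Continuous I := by fun_prop
  have hI0 : ∀ u, 0 ≤ I u := fun u => mul_nonneg (pow_nonneg (hK.nonneg _) _) (by positivity)
  refine ⟨hIc.aestronglyMeasurable, ?_⟩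
  rw [hasFiniteIntegral_iff_ofReal (Eventually.of_forall hI0)]
  -- the shells
  set c : ℕ → ℝ := fun k => 2 / F₀ * h k ^ 4 +
    2 / F₀ * (m ^ 4)⁻¹ * (q ^ 4)⁻¹ * (h (k + 1) ^ (1 - ε)) ^ 2 with hcdef
  have hc0 : ∀ k, 0 ≤ c k := fun k => by
    have := (hpos k).le
    positivity
  have hshell : ∀ k, k₀ ≤ k → ∫⁻ u in S k, ENNReal.ofReal (I u) ≤ ENNReal.ofReal (c k) := by
    intro k hk
    obtain ⟨h1, h2⟩ := hk₀ k hk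
    have hk1 : h (k + 1) = q * h k := by rw [hhk, hhk, pow_succ]; ring
    have h3 := hc.lintegral_shell_le hF₀ hK γ (hpos k) h1
    set b := 1 + (s (k + 1) / h (k + 1) / m) ^ 4 with hb
    have hsub : S k ⊆ {u | s k / h k ≤ ‖A u‖ ∧ ‖A u‖ < ρ / h k} := fun u hu => by
      refine ⟨hu.1, hu.2.trans_le ?_⟩
      rw [hk1, div_le_div_iff₀ (mul_pos hq0 (hpos k)) (hpos k)]
      nlinarith [hpos k]
    have hSm : MeasurableSet (S k) :=
      (measurableSet_le measurable_const A.continuous.norm.measurable).inter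
        (measurableSet_norm_apply_lt A _)
    calc ∫⁻ u in S k, ENNReal.ofReal (I u)
        ≤ ∫⁻ u in S k, ENNReal.ofReal b * ENNReal.ofReal (K (A u) ^ γ) := by
          refine setLIntegral_mono (by fun_prop) fun u hu => ?_
          rw [← ENNReal.ofReal_mul (by positivity)]
          refine ENNReal.ofReal_le_ofReal ?_
          have : ‖u‖ ≤ s (k + 1) / h (k + 1) / m := by
            rw [le_div_iff₀ hm, mul_comm]
            exact (hA u).trans hu.2.le
          have hK0 : 0 ≤ K (A u) ^ γ := pow_nonneg (hK.nonneg _) _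
          rw [hI, hb, mul_comm]
          dsimp only
          gcongr
      _ ≤ ENNReal.ofReal b * ENNReal.ofReal (2 / F₀ * 1 * h k ^ 4) := by
          rw [lintegral_const_mul _ (by fun_prop)]
          gcongr
          exact (lintegral_mono_set hsub).trans h3
      _ = ENNReal.ofReal (c k) := by
          rw [← ENNReal.ofReal_mul (by positivity)]
          congr 1
          have hs4 : s (k + 1) ^ 4 = (h (k + 1) ^ (1 - ε)) ^ 2 := by
            rw [hs]
            dsimp only
            rw [show 4 = 2 * 2 from rfl, pow_mul,
              Real.sq_sqrt (Real.rpow_nonneg (hpos _).le _)]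
          rw [hb, hcdef]
          dsimp only
          rw [div_pow, div_pow, hs4]
          have := hpos k
          rw [hk1, mul_pow]
          field_simp
  have hsum : Summable c := by
    refine Summable.add ?_ ?_
    · refine Summable.mul_left _ ?_
      have : (fun k => h k ^ 4) = fun k => κ ^ 4 * (q ^ 4) ^ k := by
        ext k; rw [hhk, mul_pow, ← pow_mul, ← pow_mul, mul_comm k]
      rw [this]
      exact (summable_geometric_of_lt_one (by positivity)
        (pow_lt_one₀ hq0.le hq1 (by norm_num))).mul_left _
    · refine Summable.mul_left _ ?_
      refine (summable_nat_add_iff (f := fun k => (h k ^ (1 - ε)) ^ 2) 1).2 ?_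
      have : (fun k => (h k ^ (1 - ε)) ^ 2) =
          fun k => (κ ^ (1 - ε)) ^ 2 * ((q ^ (1 - ε)) ^ 2) ^ k := by
        ext k
        rw [hhk, Real.mul_rpow hκ.le (by positivity), mul_pow, ← Real.rpow_natCast q k,
          ← Real.rpow_mul hq0.le, mul_comm (k : ℝ), Real.rpow_mul hq0.le, Real.rpow_natCast,
          ← pow_mul, ← pow_mul, mul_comm k]
      rw [this]
      exact (summable_geometric_of_lt_one (by positivity)
        (pow_lt_one₀ (by positivity) (Real.rpow_lt_one hq0.le hq1 (by linarith))
          (by norm_num))).mul_left _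
  set B : Set (Eucl d) := Metric.closedBall 0 (s k₀ / h k₀ / m) with hB
  have hcover : (Set.univ : Set (Eucl d)) ⊆ B ∪ ⋃ j, S (k₀ + j) := by
    intro u _
    by_cases hu : ‖A u‖ < s k₀ / h k₀
    · left
      rw [hB, mem_closedBall_zero_iff, le_div_iff₀ hm, mul_comm]
      exact (hA u).trans hu.le
    · right
      push Not at hu
      have hex : ∃ j, ‖A u‖ < s (k₀ + j) / h (k₀ + j) := by
        obtain ⟨k, hk1, hk2⟩ := ((hR.eventually_gt_atTop ‖A u‖).and
          (eventually_ge_atTop k₀)).exists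
        exact ⟨k - k₀, by rwa [Nat.add_sub_cancel' hk2]⟩
      classical
      -- The first truncation radius exceeding ‖A u‖ has positive index because u lies beyond the
      -- central ball, so u is in the preceding shell.
      set j := Nat.find hex with hj
      have hj1 := Nat.find_spec hex
      rw [← hj] at hj1
      have hj0 : j ≠ 0 := by
        intro h'
        rw [h', add_zero] at hj1
        exact absurd hj1 (not_lt.2 hu)
      obtain ⟨i, hi⟩ := Nat.exists_eq_succ_of_ne_zero hj0
      have hi1 : ¬ ‖A u‖ < s (k₀ + i) / h (k₀ + i) := Nat.find_min hex (by rw [← hj, hi]; simp)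
      refine Set.mem_iUnion.2 ⟨i, not_lt.1 hi1, ?_⟩
      rw [hi, Nat.succ_eq_add_one, ← add_assoc] at hj1
      exact hj1
  have hBfin : ∫⁻ u in B, ENNReal.ofReal (I u) < ⊤ := by
    have hint : IntegrableOn I B := hIc.continuousOn.integrableOn_compact
      (isCompact_closedBall _ _)
    exact (hasFiniteIntegral_iff_ofReal (Eventually.of_forall hI0)).1 hint.2
  calc ∫⁻ u, ENNReal.ofReal (I u) = ∫⁻ u in Set.univ, ENNReal.ofReal (I u) := by
        rw [Measure.restrict_univ]
    _ ≤ ∫⁻ u in B ∪ ⋃ j, S (k₀ + j), ENNReal.ofReal (I u) := lintegral_mono_set hcover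
    _ ≤ (∫⁻ u in B, ENNReal.ofReal (I u)) + ∫⁻ u in ⋃ j, S (k₀ + j), ENNReal.ofReal (I u) :=
        lintegral_union_le _ _ _
    _ ≤ (∫⁻ u in B, ENNReal.ofReal (I u)) + ∑' j, ∫⁻ u in S (k₀ + j), ENNReal.ofReal (I u) := by
        gcongr
        exact lintegral_iUnion_le _ _
    _ ≤ (∫⁻ u in B, ENNReal.ofReal (I u)) + ∑' j, ENNReal.ofReal (c (k₀ + j)) := by
        gcongr with j
        exact hshell _ (Nat.le_add_right _ _)
    _ < ⊤ := by
        refine ENNReal.add_lt_top.2 ⟨hBfin, ?_⟩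
        have hs' : Summable fun j => c (k₀ + j) := by
          simpa [add_comm] using (summable_nat_add_iff k₀).2 hsum
        rw [← ENNReal.ofReal_tsum_of_nonneg (fun j => hc0 _) hs']
        exact ENNReal.ofReal_lt_top

end Moments

/-! ### Means over the shrinking ball and their bias -/

section LocalMeans

variable {d p : ℕ} {ν : Measure (Eucl p)} {x₀ : Eucl p} {A : Eucl d →L[ℝ] Eucl p}
  {F₀ : ℝ} {Φ : Eucl d → Eucl p} {G : Eucl d → ℝ} {ρ C : ℝ} {K : Eucl p → ℝ} {m : ℝ}

-- Substituting y = h u, the kernel factor becomes exactly `K (A u)` by radial symmetry. Only `f`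
-- and the density still depend on h.
open scoped Pointwise in
lemma IsRadialChart.setIntegral_kernel_eq (hc : IsRadialChart ν x₀ A F₀ Φ G ρ C) (hF₀ : 0 < F₀)
    (hK : IsKernel K) (γ : ℕ) {f : Eucl p → ℝ} (hf : Measurable f) {h s : ℝ} (hh : 0 < h)
    (hs : s ≤ ρ) :
    ∫ x in Metric.ball x₀ s, K (h⁻¹ • (x - x₀)) ^ γ * f (h⁻¹ • (x - x₀)) ∂ν =
      h ^ d * ∫ u in {u | ‖A u‖ < s / h}, K (A u) ^ γ * (f (h⁻¹ • Φ (h • u)) * G (h • u)) := by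
  have hKc := hK.continuous
  rw [hc.setIntegral_eq hF₀.le hs (by fun_prop)]
  have hset : {u | ‖A u‖ < s / h} = (h⁻¹ : ℝ) • {y | ‖A y‖ < s} := by
    ext u
    rw [Set.mem_smul_set_iff_inv_smul_mem₀ (inv_ne_zero hh.ne'), inv_inv]
    simp only [Set.mem_ofPred_eq, map_smul, norm_smul, Real.norm_of_nonneg hh.le,
      lt_div_iff₀ hh, mul_comm h]
  have key := Measure.setIntegral_comp_smul_of_pos (volume : Measure (Eucl d))
    (fun y => K (h⁻¹ • A y) ^ γ * (f (h⁻¹ • Φ y) * G y)) {u | ‖A u‖ < s / h} hh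
  rw [hset, smul_smul, mul_inv_cancel₀ hh.ne', one_smul, ← hset, finrank_euclideanSpace_fin,
    smul_eq_mul] at key
  have e1 : ∫ u in {u | ‖A u‖ < s / h}, K (A u) ^ γ * (f (h⁻¹ • Φ (h • u)) * G (h • u)) =
      ∫ u in {u | ‖A u‖ < s / h},
        K (h⁻¹ • A (h • u)) ^ γ * (f (h⁻¹ • Φ (h • u)) * G (h • u)) := by
    refine integral_congr_ae (Eventually.of_forall fun u => ?_)
    simp only [map_smul, smul_smul, inv_mul_cancel₀ hh.ne', one_smul]
  rw [e1, key, ← mul_assoc, mul_inv_cancel₀ (by positivity), one_mul]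
  refine setIntegral_congr_fun (measurableSet_norm_apply_lt A s) fun y hy => ?_
  have hK1 : K (h⁻¹ • (x₀ + Φ y - x₀)) = K (h⁻¹ • A y) :=
    hK.radial _ _ (by
      rw [add_sub_cancel_left, norm_smul, norm_smul, hc.norm_eq y (lt_of_lt_of_le hy hs)])
  rw [hK1, add_sub_cancel_left]
  ring

lemma IsRadialChart.density_le (hc : IsRadialChart ν x₀ A F₀ Φ G ρ C) (hF₀ : 0 < F₀)
    (hm : 0 < m) (hA : ∀ u, m * ‖u‖ ≤ ‖A u‖) {y : Eucl d} (hy : ‖A y‖ < ρ) :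
    |G y| ≤ F₀ + C * (ρ / m) := by
  have h1 := hc.density_sub y hy
  have h2 : ‖y‖ ≤ ρ / m := by
    rw [le_div_iff₀ hm, mul_comm]; exact (hA y).trans hy.le
  have h3 : C * ‖y‖ ≤ C * (ρ / m) := mul_le_mul_of_nonneg_left h2 hc.nonneg
  have h4 : |G y| ≤ |G y - F₀| + |F₀| := by
    simpa using abs_add_le (G y - F₀) F₀
  rw [abs_of_pos hF₀] at h4
  linarith

/-- A majorant independent of h exists because ‖h⁻¹ Φ(h u)‖ = ‖A u‖. Quartic growth is allowed since
the variance involves squares of quadratic functions. -/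
lemma IsRadialChart.norm_integrand_le (hc : IsRadialChart ν x₀ A F₀ Φ G ρ C) (hF₀ : 0 < F₀)
    (hm : 0 < m) (hA : ∀ u, m * ‖u‖ ≤ ‖A u‖) (hK : IsKernel K) (γ : ℕ) {f : Eucl p → ℝ}
    {Cf : ℝ} (hfb : ∀ y, |f y| ≤ Cf * (1 + ‖y‖ ^ 4)) {h : ℝ} (hh : 0 < h) {u : Eucl d}
    (hu : ‖A u‖ < ρ / h) :
    ‖K (A u) ^ γ * (f (h⁻¹ • Φ (h • u)) * G (h • u))‖ ≤
      Cf * (1 + ‖A‖ ^ 4) * (F₀ + C * (ρ / m)) * (K (A u) ^ γ * (1 + ‖u‖ ^ 4)) := by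
  have hu' : ‖A (h • u)‖ < ρ := by
    rw [map_smul, norm_smul, Real.norm_of_nonneg hh.le, mul_comm]
    exact (lt_div_iff₀ hh).1 hu
  have hK0 : 0 ≤ K (A u) ^ γ := pow_nonneg (hK.nonneg _) _
  have hCf : 0 ≤ Cf := by
    have := (abs_nonneg _).trans (hfb 0)
    simpa using this
  have hC := hc.nonneg
  have hρ := hc.pos
  have hn : ‖h⁻¹ • Φ (h • u)‖ = ‖A u‖ := by
    rw [norm_smul, hc.norm_eq _ hu', map_smul, ← norm_smul, smul_smul, inv_mul_cancel₀ hh.ne',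
      one_smul]
  have h1 : |f (h⁻¹ • Φ (h • u))| ≤ Cf * ((1 + ‖A‖ ^ 4) * (1 + ‖u‖ ^ 4)) := by
    refine (hfb _).trans ?_
    rw [hn]
    have : ‖A u‖ ^ 4 ≤ (‖A‖ * ‖u‖) ^ 4 := by gcongr; exact A.le_opNorm u
    rw [mul_pow] at this
    have h2 : 0 ≤ ‖A‖ ^ 4 := by positivity
    have h3 : 0 ≤ ‖u‖ ^ 4 := by positivity
    refine mul_le_mul_of_nonneg_left ?_ hCf
    nlinarith
  have h2 := hc.density_le hF₀ hm hA hu'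
  rw [norm_mul, norm_mul, Real.norm_of_nonneg hK0, Real.norm_eq_abs, Real.norm_eq_abs]
  calc K (A u) ^ γ * (|f (h⁻¹ • Φ (h • u))| * |G (h • u)|)
      ≤ K (A u) ^ γ * (Cf * ((1 + ‖A‖ ^ 4) * (1 + ‖u‖ ^ 4)) * (F₀ + C * (ρ / m))) := by gcongr
    _ = _ := by ring

lemma IsRadialChart.integrableOn_integrand (hc : IsRadialChart ν x₀ A F₀ Φ G ρ C) (hF₀ : 0 < F₀)
    (hm : 0 < m) (hA : ∀ u, m * ‖u‖ ≤ ‖A u‖) (hK : IsKernel K) {γ : ℕ} {f : Eucl p → ℝ}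
    (hint : Integrable fun u : Eucl d => K (A u) ^ γ * (1 + ‖u‖ ^ 4)) (hf : Measurable f)
    {Cf : ℝ} (hfb : ∀ y, |f y| ≤ Cf * (1 + ‖y‖ ^ 4)) {h R : ℝ} (hh : 0 < h) (hR : R ≤ ρ / h) :
    IntegrableOn (fun u => K (A u) ^ γ * (f (h⁻¹ • Φ (h • u)) * G (h • u)))
      {u | ‖A u‖ < R} := by
  have hKc := hK.continuous
  have h1 := hc.meas_chart
  have h2 := hc.meas_density
  refine Integrable.mono' ((hint.const_mul
    (Cf * (1 + ‖A‖ ^ 4) * (F₀ + C * (ρ / m)))).integrableOn) ?_ ?_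
  · exact Measurable.aestronglyMeasurable (by fun_prop)
  · refine (ae_restrict_iff' (measurableSet_norm_apply_lt A R)).2 (Eventually.of_forall
      fun u hu => hc.norm_integrand_le hF₀ hm hA hK γ hfb hh (lt_of_lt_of_le hu hR))

lemma IsRadialChart.abs_setIntegral_kernel_le (hc : IsRadialChart ν x₀ A F₀ Φ G ρ C)
    (hF₀ : 0 < F₀) (hm : 0 < m) (hA : ∀ u, m * ‖u‖ ≤ ‖A u‖) (hK : IsKernel K) {γ : ℕ}
    {f : Eucl p → ℝ} (hint : Integrable fun u : Eucl d => K (A u) ^ γ * (1 + ‖u‖ ^ 4))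
    (hf : Measurable f) {Cf : ℝ} (hfb : ∀ y, |f y| ≤ Cf * (1 + ‖y‖ ^ 4)) :
    ∃ c, 0 ≤ c ∧ ∀ h s : ℝ, 0 < h → s ≤ ρ →
      |∫ x in Metric.ball x₀ s, K (h⁻¹ • (x - x₀)) ^ γ * f (h⁻¹ • (x - x₀)) ∂ν| ≤ c * h ^ d := by
  have hCf : 0 ≤ Cf := by
    have := (abs_nonneg _).trans (hfb 0)
    simpa using this
  have hC := hc.nonneg
  have hρ := hc.pos
  have hI0 : ∀ u : Eucl d, 0 ≤ K (A u) ^ γ * (1 + ‖u‖ ^ 4) := fun u =>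
    mul_nonneg (pow_nonneg (hK.nonneg _) _) (by positivity)
  set b := Cf * (1 + ‖A‖ ^ 4) * (F₀ + C * (ρ / m)) with hb
  have hb0 : 0 ≤ b := by positivity
  refine ⟨b * ∫ u : Eucl d, K (A u) ^ γ * (1 + ‖u‖ ^ 4),
    mul_nonneg hb0 (integral_nonneg hI0), fun h s hh hs => ?_⟩
  rw [hc.setIntegral_kernel_eq hF₀ hK γ hf hh hs, abs_mul, abs_of_pos (by positivity), mul_comm]
  gcongr
  rw [← Real.norm_eq_abs]
  calc _ ≤ ∫ u in {u | ‖A u‖ < s / h}, b * (K (A u) ^ γ * (1 + ‖u‖ ^ 4)) := by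
        refine norm_integral_le_of_norm_le (hint.const_mul b).integrableOn
          ((ae_restrict_iff' (measurableSet_norm_apply_lt A _)).2 (Eventually.of_forall
            fun u hu => hc.norm_integrand_le hF₀ hm hA hK γ hfb hh (lt_of_lt_of_le hu ?_)))
        gcongr
    _ ≤ ∫ u, b * (K (A u) ^ γ * (1 + ‖u‖ ^ 4)) :=
        setIntegral_le_integral (hint.const_mul b) (Eventually.of_forall fun u =>
          mul_nonneg hb0 (hI0 u))
    _ = _ := integral_const_mul _ _

lemma IsRadialChart.tendsto_setIntegral_kernel (hc : IsRadialChart ν x₀ A F₀ Φ G ρ C)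
    (hF₀ : 0 < F₀) (hm : 0 < m) (hA : ∀ u, m * ‖u‖ ≤ ‖A u‖) (hK : IsKernel K) {γ : ℕ}
    {f : Eucl p → ℝ} (hint : Integrable fun u : Eucl d => K (A u) ^ γ * (1 + ‖u‖ ^ 4))
    (hf : Continuous f) {Cf : ℝ} (hfb : ∀ y, |f y| ≤ Cf * (1 + ‖y‖ ^ 4))
    {h s : ℕ → ℝ} (hpos : ∀ᶠ n in atTop, 0 < h n) (h0 : Tendsto h atTop (𝓝 0))
    (hs : Tendsto s atTop (𝓝 0)) (hsh : Tendsto (fun n => s n / h n) atTop atTop) :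
    Tendsto (fun n => (h n ^ d)⁻¹ * ∫ x in Metric.ball x₀ (s n),
      K ((h n)⁻¹ • (x - x₀)) ^ γ * f ((h n)⁻¹ • (x - x₀)) ∂ν) atTop
      (𝓝 (F₀ * ∫ u, K (A u) ^ γ * f (A u))) := by
  have hKc := hK.continuous
  have h1 := hc.meas_chart
  have h2 := hc.meas_density
  have hsρ : ∀ᶠ n in atTop, s n ≤ ρ := hs.eventually_le_const hc.pos
  have hI0 : ∀ u : Eucl d, 0 ≤ K (A u) ^ γ * (1 + ‖u‖ ^ 4) := fun u =>
    mul_nonneg (pow_nonneg (hK.nonneg _) _) (by positivity)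
  have hCf : 0 ≤ Cf := by
    have := (abs_nonneg _).trans (hfb 0)
    simpa using this
  have hC := hc.nonneg
  have hρ := hc.pos
  set b := Cf * (1 + ‖A‖ ^ 4) * (F₀ + C * (ρ / m)) with hb
  have hb0 : 0 ≤ b := by positivity
  rw [← integral_const_mul]
  have key : Tendsto (fun n => ∫ u, ({u | ‖A u‖ < s n / h n}.indicator fun u =>
      K (A u) ^ γ * (f ((h n)⁻¹ • Φ (h n • u)) * G (h n • u))) u) atTop
      (𝓝 (∫ u, F₀ * (K (A u) ^ γ * f (A u)))) := by
    refine tendsto_integral_filter_of_dominated_convergence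
      (fun u => b * (K (A u) ^ γ * (1 + ‖u‖ ^ 4))) ?_ ?_ (hint.const_mul b) ?_
    · exact Eventually.of_forall fun n => Measurable.aestronglyMeasurable
        (Measurable.indicator (by fun_prop) (measurableSet_norm_apply_lt A _))
    · filter_upwards [hpos, hsρ] with n hn hn'
      refine Eventually.of_forall fun u => ?_
      by_cases hu : ‖A u‖ < s n / h n
      · rw [Set.indicator_of_mem (show u ∈ {u | ‖A u‖ < s n / h n} from hu)]
        refine hc.norm_integrand_le hF₀ hm hA hK γ hfb hn (hu.trans_le ?_)
        gcongr
      · rw [Set.indicator_of_notMem (show u ∉ {u | ‖A u‖ < s n / h n} from hu), norm_zero]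
        exact mul_nonneg hb0 (hI0 u)
    · refine Eventually.of_forall fun u => ?_
      have hhu : Tendsto (fun n => h n • u) atTop (𝓝 0) := by
        simpa using h0.smul_const u
      have hsm : ∀ᶠ n in atTop, ‖A (h n • u)‖ < ρ := by
        have : Tendsto (fun n => ‖A (h n • u)‖) atTop (𝓝 0) := by
          have := (A.continuous.norm.tendsto 0).comp hhu
          simpa [Function.comp_def] using this
        exact this.eventually_lt_const hc.pos
      have hG : Tendsto (fun n => G (h n • u)) atTop (𝓝 F₀) := by
        rw [tendsto_iff_norm_sub_tendsto_zero]
        refine squeeze_zero' (Eventually.of_forall fun n => norm_nonneg _)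
          (hsm.mono fun n hn => hc.density_sub _ hn) ?_
        simpa using hhu.norm.const_mul C
      have hΦ : Tendsto (fun n => (h n)⁻¹ • Φ (h n • u)) atTop (𝓝 (A u)) := by
        rw [tendsto_iff_norm_sub_tendsto_zero]
        refine squeeze_zero' (g := fun n => C * (h n * ‖u‖ ^ 2))
          (Eventually.of_forall fun n => norm_nonneg _) ?_ ?_
        · filter_upwards [hsm, hpos] with n hn hn'
          have e : (h n)⁻¹ • Φ (h n • u) - A u = (h n)⁻¹ • (Φ (h n • u) - A (h n • u)) := by
            rw [smul_sub, map_smul, smul_smul, inv_mul_cancel₀ hn'.ne', one_smul]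
          rw [e, norm_smul, norm_inv, Real.norm_of_nonneg hn'.le, inv_mul_le_iff₀ hn']
          refine (hc.sub_linear _ hn).trans (le_of_eq ?_)
          rw [norm_smul, Real.norm_of_nonneg hn'.le]
          ring
        · simpa using (h0.mul_const (‖u‖ ^ 2)).const_mul C
      have hlim : Tendsto (fun n => K (A u) ^ γ * (f ((h n)⁻¹ • Φ (h n • u)) * G (h n • u))) atTop
          (𝓝 (F₀ * (K (A u) ^ γ * f (A u)))) := by
        have := (((hf.tendsto (A u)).comp hΦ).mul hG).const_mul (K (A u) ^ γ)
        rwa [show K (A u) ^ γ * (f (A u) * F₀) = F₀ * (K (A u) ^ γ * f (A u)) by ring] at this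
      refine hlim.congr' ?_
      filter_upwards [hsh.eventually_gt_atTop ‖A u‖] with n hn
      rw [Set.indicator_of_mem (show u ∈ {u | ‖A u‖ < s n / h n} from hn)]
  refine key.congr' ?_
  filter_upwards [hpos, hsρ] with n hn hn'
  rw [hc.setIntegral_kernel_eq hF₀ hK γ hf.measurable hn hn',
    integral_indicator (measurableSet_norm_apply_lt A _), ← mul_assoc,
    inv_mul_cancel₀ (by positivity), one_mul]

lemma abs_inner_mul_inner_le (a b y : Eucl p) :
    |inner ℝ a y * inner ℝ b y| ≤ ‖a‖ * ‖b‖ * (1 + ‖y‖ ^ 4) := by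
  rw [abs_mul]
  calc |inner ℝ a y| * |inner ℝ b y| ≤ (‖a‖ * ‖y‖) * (‖b‖ * ‖y‖) := by
        gcongr <;> exact abs_real_inner_le_norm _ _
    _ = ‖a‖ * ‖b‖ * ‖y‖ ^ 2 := by ring
    _ ≤ _ := by
        gcongr
        nlinarith [sq_nonneg (‖y‖ ^ 2 - 1), sq_nonneg ‖y‖]

/-- The mixed tangential-normal product is odd at leading order. -/
lemma IsRadialChart.abs_mixed_add_neg_le (hc : IsRadialChart ν x₀ A F₀ Φ G ρ C) (hF₀ : 0 < F₀)
    (hm : 0 < m) (hA : ∀ u, m * ‖u‖ ≤ ‖A u‖) (a : Eucl p) {b : Eucl p}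
    (hb : ∀ u, inner ℝ b (A u) = 0) :
    ∃ c, 0 ≤ c ∧ ∀ y, ‖A y‖ < ρ →
      |inner ℝ a (Φ y) * inner ℝ b (Φ y) * G y +
        inner ℝ a (Φ (-y)) * inner ℝ b (Φ (-y)) * G (-y)| ≤ c * ‖y‖ ^ 4 := by
  have hC := hc.nonneg
  have hρ := hc.pos
  set g := F₀ + C * (ρ / m) with hg
  have hg0 : 0 ≤ g := by positivity
  refine ⟨(‖a‖ * (2 * C)) * (‖b‖ * C) * g + (‖a‖ * ‖A‖) * (C * ‖b‖) * g
    + (‖a‖ * ‖A‖) * (‖b‖ * C) * (2 * C), by positivity, fun y hy => ?_⟩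
  have hy' : ‖A (-y)‖ < ρ := by simpa using hy
  have hbn : ∀ z, ‖A z‖ < ρ → |inner ℝ b (Φ z)| ≤ ‖b‖ * C * ‖z‖ ^ 2 := fun z hz => by
    have e : inner ℝ b (Φ z) = inner ℝ b (Φ z - A z) := by rw [inner_sub_right, hb, sub_zero]
    rw [e, mul_assoc]
    exact (abs_real_inner_le_norm _ _).trans (by gcongr; exact hc.sub_linear z hz)
  have h1 : |inner ℝ a (Φ y) + inner ℝ a (Φ (-y))| ≤ ‖a‖ * (2 * C) * ‖y‖ ^ 2 := by
    have e : inner ℝ a (Φ y) + inner ℝ a (Φ (-y)) =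
        inner ℝ a ((Φ y - A y) + (Φ (-y) - A (-y))) := by
      rw [map_neg, ← inner_add_right]; congr 1; abel
    rw [e, mul_assoc]
    refine (abs_real_inner_le_norm _ _).trans ?_
    gcongr
    refine (norm_add_le _ _).trans ?_
    have h2 := hc.sub_linear y hy
    have h3 := hc.sub_linear (-y) hy'
    rw [norm_neg] at h3
    linarith
  have h2 := hbn y hy
  have h3 := hbn (-y) hy'
  rw [norm_neg] at h3
  have h4 : |inner ℝ a (Φ (-y))| ≤ ‖a‖ * ‖A‖ * ‖y‖ := by
    rw [mul_assoc]
    refine (abs_real_inner_le_norm _ _).trans ?_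
    gcongr
    rw [hc.norm_eq _ hy', map_neg, norm_neg]
    exact A.le_opNorm y
  have h5 : |inner ℝ b (Φ (-y)) - inner ℝ b (Φ y)| ≤ C * ‖b‖ * ‖y‖ ^ 3 := by
    rw [abs_sub_comm]; exact hc.normal_even b hb y hy
  have h6 := hc.density_le hF₀ hm hA hy
  have h7 : |G (-y) - G y| ≤ 2 * C * ‖y‖ := by
    have e1 := hc.density_sub y hy
    have e2 := hc.density_sub (-y) hy'
    rw [norm_neg] at e2
    calc |G (-y) - G y| = |(G (-y) - F₀) - (G y - F₀)| := by congr 1; ring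
      _ ≤ _ := abs_sub _ _
      _ ≤ _ := by linarith
  set a₁ := inner ℝ a (Φ y)
  set a₂ := inner ℝ a (Φ (-y))
  set b₁ := inner ℝ b (Φ y)
  set b₂ := inner ℝ b (Φ (-y))
  -- Under y ↦ -y the tangential factor is odd, the normal factor and the density are even, all up
  -- to one further order. Each telescoped term contains one such gain and is therefore quartic
  -- instead of cubic.
  calc |a₁ * b₁ * G y + a₂ * b₂ * G (-y)|
      = |(a₁ + a₂) * b₁ * G y + a₂ * (b₂ - b₁) * G y + a₂ * b₂ * (G (-y) - G y)| := by
        congr 1; ring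
    _ ≤ |(a₁ + a₂) * b₁ * G y| + |a₂ * (b₂ - b₁) * G y| + |a₂ * b₂ * (G (-y) - G y)| :=
        abs_add_three _ _ _
    _ ≤ (‖a‖ * (2 * C) * ‖y‖ ^ 2) * (‖b‖ * C * ‖y‖ ^ 2) * g
        + (‖a‖ * ‖A‖ * ‖y‖) * (C * ‖b‖ * ‖y‖ ^ 3) * g
        + (‖a‖ * ‖A‖ * ‖y‖) * (‖b‖ * C * ‖y‖ ^ 2) * (2 * C * ‖y‖) := by
        simp only [abs_mul]
        gcongr
    _ = _ := by ring

/-- The normal component of h⁻¹ Φ(h u) is of order h, so the crude bound is h. Averaging the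
integrand over u and -u on the symmetric domain cancels the odd leading term and leaves h⁻²‖h u‖⁴ =
h²‖u‖⁴, integrable against the kernel. -/
lemma IsRadialChart.abs_setIntegral_mixed_le (hc : IsRadialChart ν x₀ A F₀ Φ G ρ C)
    (hF₀ : 0 < F₀) (hm : 0 < m) (hA : ∀ u, m * ‖u‖ ≤ ‖A u‖) (hK : IsKernel K)
    (hint : Integrable fun u : Eucl d => K (A u) ^ 1 * (1 + ‖u‖ ^ 4))
    (a : Eucl p) {b : Eucl p} (hb : ∀ u, inner ℝ b (A u) = 0) :
    ∃ c, 0 ≤ c ∧ ∀ h s : ℝ, 0 < h → s ≤ ρ →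
      |(h ^ d)⁻¹ * ∫ x in Metric.ball x₀ s, K (h⁻¹ • (x - x₀)) ^ 1 *
        (inner ℝ a (h⁻¹ • (x - x₀)) * inner ℝ b (h⁻¹ • (x - x₀))) ∂ν| ≤ c * h ^ 2 := by
  obtain ⟨c, hc0, hcb⟩ := hc.abs_mixed_add_neg_le hF₀ hm hA a hb
  have hI0 : ∀ u : Eucl d, 0 ≤ K (A u) ^ 1 * (1 + ‖u‖ ^ 4) := fun u =>
    mul_nonneg (pow_nonneg (hK.nonneg _) _) (by positivity)
  refine ⟨c * ∫ u : Eucl d, K (A u) ^ 1 * (1 + ‖u‖ ^ 4),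
    mul_nonneg hc0 (integral_nonneg hI0), fun h s hh hs => ?_⟩
  set f : Eucl p → ℝ := fun y => inner ℝ a y * inner ℝ b y with hf
  have hfm : Measurable f := by fun_prop
  have hR : s / h ≤ ρ / h := by gcongr
  rw [hc.setIntegral_kernel_eq hF₀ hK 1 hfm hh hs, ← mul_assoc,
    inv_mul_cancel₀ (by positivity), one_mul]
  set D : Set (Eucl d) := {u | ‖A u‖ < s / h} with hD
  have hDm : MeasurableSet D := measurableSet_norm_apply_lt A _
  set J : Eucl d → ℝ := fun u => K (A u) ^ 1 * (f (h⁻¹ • Φ (h • u)) * G (h • u)) with hJ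
  have hJi : IntegrableOn J D := hc.integrableOn_integrand hF₀ hm hA hK hint hfm
    (abs_inner_mul_inner_le a b) hh hR
  have hneg : ∫ u in D, J (-u) = ∫ u in D, J u := by
    rw [← integral_indicator hDm, ← integral_indicator hDm,
      ← integral_neg_eq_self (D.indicator J)]
    congr 1
    ext u
    have : (-u ∈ D) ↔ u ∈ D := by simp [hD]
    by_cases hu : u ∈ D
    · rw [Set.indicator_of_mem hu, Set.indicator_of_mem (this.2 hu)]
    · rw [Set.indicator_of_notMem hu, Set.indicator_of_notMem (mt this.1 hu)]
  have hJneg : IntegrableOn (fun u => J (-u)) D := by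
    rw [← integrable_indicator_iff hDm] at hJi ⊢
    refine hJi.comp_neg.congr (Eventually.of_forall fun u => ?_)
    dsimp only
    have : (-u ∈ D) ↔ u ∈ D := by simp [hD]
    by_cases hu : u ∈ D
    · rw [Set.indicator_of_mem hu, Set.indicator_of_mem (this.2 hu)]
    · rw [Set.indicator_of_notMem hu, Set.indicator_of_notMem (mt this.1 hu)]
  have hsum : 2 * ∫ u in D, J u = ∫ u in D, (J u + J (-u)) := by
    rw [integral_add hJi hJneg, hneg, two_mul]
  have hbound : ∀ u ∈ D, ‖J u + J (-u)‖ ≤ c * h ^ 2 * (K (A u) ^ 1 * (1 + ‖u‖ ^ 4)) := by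
    intro u hu
    have hu' : ‖A (h • u)‖ < ρ := by
      rw [map_smul, norm_smul, Real.norm_of_nonneg hh.le, mul_comm]
      exact (lt_div_iff₀ hh).1 (lt_of_lt_of_le hu hR)
    have hKn : K (A (-u)) = K (A u) := hK.radial _ _ (by simp)
    have hK0 : 0 ≤ K (A u) ^ 1 := pow_nonneg (hK.nonneg _) _
    have e : J u + J (-u) = K (A u) ^ 1 * ((h ^ 2)⁻¹ *
        (inner ℝ a (Φ (h • u)) * inner ℝ b (Φ (h • u)) * G (h • u) +
        inner ℝ a (Φ (-(h • u))) * inner ℝ b (Φ (-(h • u))) * G (-(h • u)))) := by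
      simp only [hJ, hf, hKn, smul_neg, real_inner_smul_right]
      field_simp
    rw [e, norm_mul, Real.norm_of_nonneg hK0, norm_mul, norm_inv,
      Real.norm_of_nonneg (by positivity), Real.norm_eq_abs]
    calc K (A u) ^ 1 * ((h ^ 2)⁻¹ * _) ≤ K (A u) ^ 1 * ((h ^ 2)⁻¹ * (c * ‖h • u‖ ^ 4)) := by
          gcongr; exact hcb _ hu'
      _ = c * h ^ 2 * (K (A u) ^ 1 * ‖u‖ ^ 4) := by
          rw [norm_smul, Real.norm_of_nonneg hh.le]
          field_simp
      _ ≤ _ := by gcongr; linarith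
  have hfin : |∫ u in D, (J u + J (-u))| ≤
      c * h ^ 2 * ∫ u : Eucl d, K (A u) ^ 1 * (1 + ‖u‖ ^ 4) := by
    rw [← Real.norm_eq_abs]
    calc _ ≤ ∫ u in D, c * h ^ 2 * (K (A u) ^ 1 * (1 + ‖u‖ ^ 4)) :=
          norm_integral_le_of_norm_le (hint.const_mul _).integrableOn
            ((ae_restrict_iff' hDm).2 (Eventually.of_forall hbound))
      _ ≤ ∫ u, c * h ^ 2 * (K (A u) ^ 1 * (1 + ‖u‖ ^ 4)) :=
          setIntegral_le_integral (hint.const_mul _) (Eventually.of_forall fun u =>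
            mul_nonneg (by positivity) (hI0 u))
      _ = _ := integral_const_mul _ _
  rw [← hsum, abs_mul, abs_of_pos (by norm_num : (0 : ℝ) < 2)] at hfin
  calc |∫ u in D, J u| ≤ 2 * |∫ u in D, J u| := by linarith [abs_nonneg (∫ u in D, J u)]
    _ ≤ _ := hfin
    _ = _ := by ring

end LocalMeans

/-! ### Deviation inequalities for i.i.d. sums -/

section Deviation

variable {Ω : Type*} [MeasurableSpace Ω] {P : Measure Ω}
  {S : Type*} [MeasurableSpace S] {X : ℕ → Ω → S}

/-- Markov's inequality for a sum of identically distributed variables. -/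
lemma measure_sum_ge_le (hXmeas : ∀ i, Measurable (X i))
    (hXident : ∀ i, IdentDistrib (X i) (X 0) P P) {q : S → ℝ} (hq : Measurable q)
    {n : ℕ} (hn : 0 < n) {t I : ℝ} (ht : 0 < t)
    (hI : ∫⁻ x, ENNReal.ofReal (|q x|) ∂(P.map (X 0)) ≤ ENNReal.ofReal I) :
    P {ω | n * t ≤ |∑ i ∈ Finset.range n, q (X i ω)|} ≤ ENNReal.ofReal (I / t) := by
  have hn' : (0 : ℝ) < n := by exact_mod_cast hn
  set g : Ω → ENNReal := fun ω => ∑ i ∈ Finset.range n, ENNReal.ofReal |q (X i ω)| with hg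
  have hqm : ∀ i, Measurable fun ω => ENNReal.ofReal |q (X i ω)| := fun i =>
    ((hq.comp (hXmeas i)).abs).ennreal_ofReal
  have hgm : Measurable g := Finset.measurable_fun_sum _ fun i _ => hqm i
  have hint : ∫⁻ ω, g ω ∂P ≤ n * ENNReal.ofReal I := by
    rw [hg, lintegral_finsetSum _ fun i _ => hqm i]
    calc _ ≤ ∑ i ∈ Finset.range n, ENNReal.ofReal I := by
          refine Finset.sum_le_sum fun i _ => ?_
          have e := ((hXident i).comp (u := fun x => ENNReal.ofReal |q x|)
            (hq.abs.ennreal_ofReal)).lintegral_eq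
          have e2 := lintegral_map (μ := P) (hq.abs.ennreal_ofReal) (hXmeas 0)
          simp only [Function.comp_def] at e
          rw [e, ← e2]
          exact hI
      _ = _ := by simp
  have hsub : {ω | n * t ≤ |∑ i ∈ Finset.range n, q (X i ω)|} ⊆
      {ω | ENNReal.ofReal (n * t) ≤ g ω} := fun ω hω => by
    have h1 : n * t ≤ ∑ i ∈ Finset.range n, |q (X i ω)| :=
      le_trans hω (Finset.abs_sum_le_sum_abs _ _)
    change ENNReal.ofReal (n * t) ≤ g ω
    rw [hg]
    dsimp only
    rw [← ENNReal.ofReal_sum_of_nonneg fun i _ => abs_nonneg _]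
    exact ENNReal.ofReal_le_ofReal h1
  refine (measure_mono hsub).trans ?_
  have hm := mul_meas_ge_le_lintegral (μ := P) hgm (ENNReal.ofReal (n * t))
  have hpos : 0 < ENNReal.ofReal (n * t) := ENNReal.ofReal_pos.2 (by positivity)
  rw [mul_comm, ← ENNReal.le_div_iff_mul_le (Or.inl hpos.ne') (Or.inl ENNReal.ofReal_ne_top)] at hm
  refine hm.trans ?_
  rw [ENNReal.div_le_iff hpos.ne' ENNReal.ofReal_ne_top]
  refine hint.trans (le_of_eq ?_)
  rw [← ENNReal.ofReal_mul' (by positivity), ← ENNReal.ofReal_natCast n,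
    ← ENNReal.ofReal_mul (by positivity)]
  congr 1
  field_simp

variable [IsProbabilityMeasure P]

/-- Chebyshev's inequality for a sum of i.i.d. bounded variables. -/
lemma measure_sum_sub_ge_le (hXmeas : ∀ i, Measurable (X i)) (hXindep : iIndepFun X P)
    (hXident : ∀ i, IdentDistrib (X i) (X 0) P P) {q : S → ℝ} (hq : Measurable q) {b : ℝ}
    (hb : ∀ x, |q x| ≤ b) {n : ℕ} (hn : 0 < n) {t : ℝ} (ht : 0 < t) :
    P {ω | n * t ≤ |∑ i ∈ Finset.range n, q (X i ω) - n * ∫ x, q x ∂(P.map (X 0))|} ≤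
      ENNReal.ofReal ((∫ x, q x ^ 2 ∂(P.map (X 0))) / (n * t ^ 2)) := by
  have hn' : (0 : ℝ) < n := by exact_mod_cast hn
  have hmem : ∀ i, MemLp (fun ω => q (X i ω)) 2 P := fun i =>
    MemLp.of_bound (hq.comp (hXmeas i)).aestronglyMeasurable b
      (Eventually.of_forall fun ω => by simpa using hb (X i ω))
  set Y : ℕ → Ω → ℝ := fun i ω => q (X i ω) with hY
  have hident : ∀ i, IdentDistrib (Y i) (Y 0) P P := fun i => (hXident i).comp hq
  have hmean : ∀ i, ∫ ω, Y i ω ∂P = ∫ x, q x ∂(P.map (X 0)) := fun i => by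
    rw [(hident i).integral_eq, integral_map (hXmeas 0).aemeasurable hq.aestronglyMeasurable]
  have hindep : iIndepFun Y P := hXindep.comp (fun _ => q) (fun _ => hq)
  have hvar : variance (∑ i ∈ Finset.range n, Y i) P ≤ n * ∫ x, q x ^ 2 ∂(P.map (X 0)) := by
    rw [IndepFun.variance_sum (fun i _ => hmem i) (fun i _ j _ hij => hindep.indepFun hij)]
    calc ∑ i ∈ Finset.range n, variance (Y i) P
        ≤ ∑ i ∈ Finset.range n, ∫ x, q x ^ 2 ∂(P.map (X 0)) := by
          refine Finset.sum_le_sum fun i _ => ?_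
          rw [(hident i).variance_eq, integral_map (hXmeas 0).aemeasurable
            (hq.pow_const 2).aestronglyMeasurable]
          exact variance_le_expectation_sq (hmem 0).1
      _ = _ := by simp
  have hsum : MemLp (∑ i ∈ Finset.range n, Y i) 2 P := memLp_finsetSum' _ fun i _ => hmem i
  have hE : ∫ ω, (∑ i ∈ Finset.range n, Y i) ω ∂P = n * ∫ x, q x ∂(P.map (X 0)) := by
    simp only [Finset.sum_apply]
    rw [integral_finsetSum _ fun i _ => (hmem i).integrable (by norm_num)]
    rw [Finset.sum_congr rfl fun i _ => hmean i]
    simp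
  have key := meas_ge_le_variance_div_sq hsum (c := n * t) (by positivity)
  rw [hE] at key
  simp only [Finset.sum_apply] at key
  refine key.trans (ENNReal.ofReal_le_ofReal ?_)
  rw [div_le_div_iff₀ (by positivity) (by positivity)]
  calc _ ≤ (n * ∫ x, q x ^ 2 ∂(P.map (X 0))) * (n * t ^ 2) := by gcongr
    _ = _ := by ring

/-- Deviation inequality: Chebyshev on `B`, Markov on the complement of `B`. -/
lemma measure_sum_sub_gt_le (hXmeas : ∀ i, Measurable (X i)) (hXindep : iIndepFun X P)
    (hXident : ∀ i, IdentDistrib (X i) (X 0) P P) {q : S → ℝ} (hq : Measurable q)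
    {B : Set S} (hB : MeasurableSet B) {b : ℝ} (hb : ∀ x ∈ B, |q x| ≤ b)
    {n : ℕ} (hn : 0 < n) {t I : ℝ} (ht : 0 < t)
    (hI : ∫⁻ x in Bᶜ, ENNReal.ofReal (|q x|) ∂(P.map (X 0)) ≤ ENNReal.ofReal I) :
    P {ω | n * (2 * t) < |∑ i ∈ Finset.range n, q (X i ω) - n * ∫ x in B, q x ∂(P.map (X 0))|} ≤
      ENNReal.ofReal ((∫ x in B, q x ^ 2 ∂(P.map (X 0))) / (n * t ^ 2)) +
        ENNReal.ofReal (I / t) := by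
  set ν := P.map (X 0) with hν
  have h1 := measure_sum_sub_ge_le hXmeas hXindep hXident (hq.indicator hB) (b := max b 0)
    (fun x => by
      by_cases hx : x ∈ B
      · rw [Set.indicator_of_mem hx]; exact (hb x hx).trans (le_max_left _ _)
      · rw [Set.indicator_of_notMem hx, abs_zero]; exact le_max_right _ _) hn ht
  have h2 := measure_sum_ge_le (P := P) hXmeas hXident (hq.indicator hB.compl) hn ht (I := I) (by
    refine le_trans (le_of_eq ?_) hI
    rw [← lintegral_indicator hB.compl]
    refine lintegral_congr fun x => ?_
    by_cases hx : x ∈ Bᶜ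
    · rw [Set.indicator_of_mem hx, Set.indicator_of_mem hx]
    · rw [Set.indicator_of_notMem hx, Set.indicator_of_notMem hx, abs_zero, ENNReal.ofReal_zero])
  have e1 : ∫ x, B.indicator q x ∂ν = ∫ x in B, q x ∂ν := integral_indicator hB
  have e2 : ∫ x, B.indicator q x ^ 2 ∂ν = ∫ x in B, q x ^ 2 ∂ν := by
    rw [← integral_indicator hB]
    congr 1
    ext x
    by_cases hx : x ∈ B
    · rw [Set.indicator_of_mem hx, Set.indicator_of_mem hx]
    · rw [Set.indicator_of_notMem hx, Set.indicator_of_notMem hx]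
      norm_num
  rw [← hν, e1, e2] at h1
  refine (measure_mono ?_).trans ((measure_union_le _ _).trans (add_le_add h1 h2))
  intro ω hω
  by_contra hcon
  simp only [Set.mem_union, Set.mem_ofPred_eq, not_or, not_le] at hcon hω
  have hsplit : ∑ i ∈ Finset.range n, q (X i ω) =
      ∑ i ∈ Finset.range n, B.indicator q (X i ω) + ∑ i ∈ Finset.range n, Bᶜ.indicator q (X i ω) := by
    rw [← Finset.sum_add_distrib]
    refine Finset.sum_congr rfl fun i _ => ?_
    exact (congrFun (Set.indicator_self_add_compl B q) _).symm
  rw [hsplit, add_sub_right_comm] at hω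
  have := abs_add_le (∑ i ∈ Finset.range n, B.indicator q (X i ω) - n * ∫ x in B, q x ∂ν)
    (∑ i ∈ Finset.range n, Bᶜ.indicator q (X i ω))
  linarith [hcon.1, hcon.2]

end Deviation

/-- The kernel average `(n h^d)⁻¹ ∑_{i<n} K((x_i - x₀)/h) f((x_i - x₀)/h)`. -/
noncomputable def kernelAverage {p : ℕ} (K : Eucl p → ℝ) (d : ℕ) (h : ℝ) (x₀ : Eucl p)
    (f : Eucl p → ℝ) (n : ℕ) (x : ℕ → Eucl p) : ℝ :=
  (n * h ^ d)⁻¹ * ∑ i ∈ Finset.range n, K (h⁻¹ • (x i - x₀)) ^ 1 * f (h⁻¹ • (x i - x₀))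

/-! ### Stochastic behaviour of kernel averages -/

section Kernel

variable {Ω : Type*} [MeasurableSpace Ω] {P : Measure Ω} [IsProbabilityMeasure P] {d p : ℕ}
  {X : ℕ → Ω → Eucl p} {x₀ : Eucl p} {A : Eucl d →L[ℝ] Eucl p}
  {F₀ : ℝ} {Φ : Eucl d → Eucl p} {G : Eucl d → ℝ} {ρ C : ℝ} {K : Eucl p → ℝ} {m κ M ε : ℝ}

/-- Inside the ball the second moment is O(h^d), so Chebyshev at level L h^{d+2} gives a probability
of order h^d/(n L² h^{2d+4}) = 1/(L² κ^{d+4}). Outside, rescaling a quadratic f costs h⁻², and the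
tail condition turns this into a small multiple of h^{d+2}, which suits Markov at the same level.
Centring is at the truncated mean, so the full expectation never appears. -/
theorem kernelAverage_deviation (hXmeas : ∀ i, Measurable (X i)) (hXindep : iIndepFun X P)
    (hXident : ∀ i, IdentDistrib (X i) (X 0) P P)
    (hc : IsRadialChart (P.map (X 0)) x₀ A F₀ Φ G ρ C) (hF₀ : 0 < F₀)
    (hm : 0 < m) (hA : ∀ u, m * ‖u‖ ≤ ‖A u‖) (hK : IsKernel K) (hκ : 0 < κ)
    (hM : 0 < M) (hε0 : 0 < ε) (hε1 : ε < 1)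
    (htail : TailCondition K (P.map (X 0)) x₀ d (bandwidth κ d) ε M)
    {f : Eucl p → ℝ} (hf : Continuous f) {Cf : ℝ} (hfb : ∀ y, |f y| ≤ Cf * (1 + ‖y‖ ^ 2))
    {δ : ℝ} (hδ : 0 < δ) :
    ∃ L, 0 < L ∧ ∀ᶠ n in atTop, P {ω | L * bandwidth κ d n ^ 2 <
      |kernelAverage K d (bandwidth κ d n) x₀ f n (fun i => X i ω) - (bandwidth κ d n ^ d)⁻¹ *
        ∫ x in Metric.ball x₀ (Real.sqrt (bandwidth κ d n ^ (1 - ε))),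
          K ((bandwidth κ d n)⁻¹ • (x - x₀)) ^ 1 * f ((bandwidth κ d n)⁻¹ • (x - x₀))
            ∂(P.map (X 0))|} ≤ ENNReal.ofReal δ := by
  have hKc := hK.continuous
  have hCf : 0 ≤ Cf := by
    have := (abs_nonneg _).trans (hfb 0)
    simpa using this
  have hint2 := integrable_kernel_pow_mul hc hF₀ hm hA hK hκ hM hε0 hε1 htail (γ := 2) (Or.inr rfl)
  obtain ⟨c, hc0, hcb⟩ := hc.abs_setIntegral_kernel_le hF₀ hm hA hK hint2
    (f := fun y => f y ^ 2) (by fun_prop) (Cf := 2 * Cf ^ 2) (fun y => by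
      have h1 := hfb y
      have h2 : |f y| ^ 2 ≤ (Cf * (1 + ‖y‖ ^ 2)) ^ 2 := by gcongr
      rw [abs_pow]
      refine h2.trans ?_
      rw [mul_pow]
      nlinarith [mul_nonneg (sq_nonneg Cf) (sq_nonneg (‖y‖ ^ 2 - 1))])
  -- The quotient makes the Chebyshev term at most δ/2; the added 1 gives L ≥ 1, used in L ≤ L² and
  -- in the Markov term.
  set L := 8 * c / (κ ^ (d + 4) * δ) + 1 with hL
  have hL1 : 1 ≤ L := by
    have : 0 ≤ 8 * c / (κ ^ (d + 4) * δ) := by positivity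
    linarith
  have hL0 : 0 < L := by linarith
  -- This constant converts growth in x - x₀ into the weight 1 + ‖x‖² of the tail condition; the
  -- added 1 keeps it positive when `Cf = 0`.
  set B₀ := Cf * (2 + 2 * ‖x₀‖ ^ 2) + 1 with hB₀
  have hB₀pos : 0 < B₀ := by positivity
  have hθ : 0 < δ / (4 * B₀) := by positivity
  refine ⟨L, hL0, ?_⟩
  have h0 : Tendsto (bandwidth κ d) atTop (𝓝 0) := tendsto_bandwidth
  have hsρ : ∀ᶠ n in atTop, Real.sqrt (bandwidth κ d n ^ (1 - ε)) ≤ ρ :=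
    (tendsto_sqrt_rpow h0 hε1).eventually_le_const hc.pos
  filter_upwards [htail.eventually_lintegral_le hK hM (eventually_bandwidth_pos hκ) (Or.inl rfl) hθ,
    hsρ, h0.eventually_le_const one_pos, eventually_gt_atTop 0] with n hn1 hn2 hn3 hn
  have hpos : 0 < bandwidth κ d n := bandwidth_pos hκ hn
  have hnh := natCast_mul_bandwidth_pow (κ := κ) (d := d) hn
  have hn' : (0 : ℝ) < n := by exact_mod_cast hn
  set h := bandwidth κ d n with hh
  set s := Real.sqrt (h ^ (1 - ε)) with hs
  set q : Eucl p → ℝ := fun x => K (h⁻¹ • (x - x₀)) ^ 1 * f (h⁻¹ • (x - x₀)) with hq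
  have hqc : Continuous q := by fun_prop
  have hBm : MeasurableSet (Metric.ball x₀ s) := Metric.isOpen_ball.measurableSet
  obtain ⟨b, hb⟩ := (isCompact_closedBall x₀ s).exists_bound_of_continuousOn hqc.continuousOn
  have htpos : 0 < L * h ^ (d + 2) / 2 := by positivity
  have htail1 : ∫⁻ x in (Metric.ball x₀ s)ᶜ, ENNReal.ofReal |q x| ∂(P.map (X 0)) ≤
      ENNReal.ofReal (B₀ * (h ^ 2)⁻¹ * (δ / (4 * B₀) * h ^ (d + 4))) := by
    rw [ENNReal.ofReal_mul (by positivity)]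
    refine le_trans ?_ (mul_le_mul_right hn1 _)
    rw [← lintegral_const_mul' _ _ ENNReal.ofReal_ne_top]
    refine lintegral_mono fun x => ?_
    rw [← ENNReal.ofReal_mul (by positivity)]
    refine ENNReal.ofReal_le_ofReal ?_
    have hK0 : 0 ≤ K (h⁻¹ • (x - x₀)) ^ 1 := pow_nonneg (hK.nonneg _) _
    have h1 : |f (h⁻¹ • (x - x₀))| ≤ B₀ * (h ^ 2)⁻¹ * (1 + ‖x‖ ^ 2) := by
      refine (hfb _).trans ?_
      rw [norm_smul, norm_inv, Real.norm_of_nonneg hpos.le, mul_pow, inv_pow]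
      have e1 : ‖x - x₀‖ ^ 2 ≤ 2 * ‖x‖ ^ 2 + 2 * ‖x₀‖ ^ 2 := by
        have := norm_sub_le x x₀
        have : ‖x - x₀‖ ^ 2 ≤ (‖x‖ + ‖x₀‖) ^ 2 := by gcongr
        nlinarith [sq_nonneg (‖x‖ - ‖x₀‖)]
      have e2 : 1 ≤ (h ^ 2)⁻¹ := by
        rw [one_le_inv₀ (by positivity)]
        exact pow_le_one₀ hpos.le hn3
      have e3 : 1 + ‖x - x₀‖ ^ 2 ≤ (2 + 2 * ‖x₀‖ ^ 2) * (1 + ‖x‖ ^ 2) := by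
        nlinarith [mul_nonneg (sq_nonneg ‖x₀‖) (sq_nonneg ‖x‖)]
      calc Cf * (1 + (h ^ 2)⁻¹ * ‖x - x₀‖ ^ 2)
          ≤ Cf * ((h ^ 2)⁻¹ * (1 + ‖x - x₀‖ ^ 2)) := by
            gcongr
            rw [mul_add, mul_one]
            gcongr
        _ ≤ Cf * ((h ^ 2)⁻¹ * ((2 + 2 * ‖x₀‖ ^ 2) * (1 + ‖x‖ ^ 2))) := by gcongr
        _ = (Cf * (2 + 2 * ‖x₀‖ ^ 2)) * (h ^ 2)⁻¹ * (1 + ‖x‖ ^ 2) := by ring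
        _ ≤ _ := by gcongr; linarith
    rw [hq]
    dsimp only
    rw [abs_mul, abs_of_nonneg hK0]
    calc _ ≤ K (h⁻¹ • (x - x₀)) ^ 1 * (B₀ * (h ^ 2)⁻¹ * (1 + ‖x‖ ^ 2)) := by gcongr
      _ = _ := by ring
  have key := measure_sum_sub_gt_le hXmeas hXindep hXident hqc.measurable hBm (b := b)
    (fun x hx => by simpa using hb x (Metric.ball_subset_closedBall hx)) hn htpos htail1
  refine (measure_mono ?_).trans (key.trans ?_)
  · intro ω hω
    simp only [Set.mem_ofPred_eq] at hω ⊢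
    rw [kernelAverage] at hω
    change L * h ^ 2 < |(n * h ^ d)⁻¹ * ∑ i ∈ Finset.range n, q (X i ω) - (h ^ d)⁻¹ *
      ∫ x in Metric.ball x₀ s, q x ∂(P.map (X 0))| at hω
    set T := ∑ i ∈ Finset.range n, q (X i ω)
    set I := ∫ x in Metric.ball x₀ s, q x ∂(P.map (X 0))
    have e : (n * h ^ d)⁻¹ * T - (h ^ d)⁻¹ * I = (n * h ^ d)⁻¹ * (T - n * I) := by
      field_simp
    rw [e, abs_mul, abs_of_pos (by positivity), lt_inv_mul_iff₀ (by positivity)] at hω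
    refine lt_of_eq_of_lt ?_ hω
    rw [pow_add]
    ring
  · rw [← ENNReal.ofReal_add (div_nonneg (integral_nonneg fun x => sq_nonneg _) (by positivity))
      (by positivity)]
    refine ENNReal.ofReal_le_ofReal ?_
    have e1 : ∫ x in Metric.ball x₀ s, q x ^ 2 ∂(P.map (X 0)) ≤ c * h ^ d := by
      refine le_trans (le_of_eq ?_) ((le_abs_self _).trans (hcb h s hpos hn2))
      refine integral_congr_ae (Eventually.of_forall fun x => ?_)
      simp only [hq, pow_one, mul_pow]
    have e2 : (∫ x in Metric.ball x₀ s, q x ^ 2 ∂(P.map (X 0))) /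
        (n * (L * h ^ (d + 2) / 2) ^ 2) ≤ δ / 2 := by
      rw [div_le_iff₀ (by positivity)]
      refine e1.trans ?_
      have e3 : (n : ℝ) * (L * h ^ (d + 2) / 2) ^ 2 = (n * h ^ (d + 4)) * (L ^ 2 * h ^ d / 4) := by
        ring
      rw [e3, hnh]
      have e4 : 8 * c ≤ L * (κ ^ (d + 4) * δ) := by
        rw [hL, add_mul, div_mul_cancel₀ _ (by positivity)]
        have : 0 < κ ^ (d + 4) * δ := by positivity
        linarith
      have e5 : 8 * c ≤ L ^ 2 * (κ ^ (d + 4) * δ) := by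
        refine e4.trans ?_
        gcongr
        nlinarith
      calc c * h ^ d = (8 * c) * (h ^ d / 8) := by ring
        _ ≤ (L ^ 2 * (κ ^ (d + 4) * δ)) * (h ^ d / 8) := by gcongr
        _ = _ := by ring
    have e6 : B₀ * (h ^ 2)⁻¹ * (δ / (4 * B₀) * h ^ (d + 4)) / (L * h ^ (d + 2) / 2) ≤ δ / 2 := by
      rw [div_le_iff₀ (by positivity)]
      have : B₀ * (h ^ 2)⁻¹ * (δ / (4 * B₀) * h ^ (d + 4)) = δ / 4 * h ^ (d + 2) := by
        rw [show d + 4 = (d + 2) + 2 by ring, pow_add h (d + 2) 2]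
        field_simp
      rw [this]
      have : 0 < δ * h ^ (d + 2) := by positivity
      nlinarith
    linarith

theorem kernelAverage_consistent (hXmeas : ∀ i, Measurable (X i)) (hXindep : iIndepFun X P)
    (hXident : ∀ i, IdentDistrib (X i) (X 0) P P)
    (hc : IsRadialChart (P.map (X 0)) x₀ A F₀ Φ G ρ C) (hF₀ : 0 < F₀)
    (hm : 0 < m) (hA : ∀ u, m * ‖u‖ ≤ ‖A u‖) (hK : IsKernel K) (hκ : 0 < κ)
    (hM : 0 < M) (hε0 : 0 < ε) (hε1 : ε < 1)
    (htail : TailCondition K (P.map (X 0)) x₀ d (bandwidth κ d) ε M)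
    {f : Eucl p → ℝ} (hf : Continuous f) {Cf : ℝ} (hfb : ∀ y, |f y| ≤ Cf * (1 + ‖y‖ ^ 2))
    {t δ : ℝ} (ht : 0 < t) (hδ : 0 < δ) :
    ∀ᶠ n in atTop, P {ω | t < |kernelAverage K d (bandwidth κ d n) x₀ f n (fun i => X i ω) -
      F₀ * ∫ u, K (A u) * f (A u)|} ≤ ENNReal.ofReal δ := by
  have hCf : 0 ≤ Cf := by
    have := (abs_nonneg _).trans (hfb 0)
    simpa using this
  have h0 : Tendsto (bandwidth κ d) atTop (𝓝 0) := tendsto_bandwidth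
  have hint := integrable_kernel_pow_mul hc hF₀ hm hA hK hκ hM hε0 hε1 htail (γ := 1) (Or.inl rfl)
  obtain ⟨L, hL, hdev⟩ := kernelAverage_deviation hXmeas hXindep hXident hc hF₀ hm hA hK hκ hM hε0
    hε1 htail hf hfb hδ
  have hmean := hc.tendsto_setIntegral_kernel hF₀ hm hA hK hint hf (Cf := 2 * Cf) (fun y => by
      refine (hfb y).trans ?_
      nlinarith [mul_nonneg hCf (sq_nonneg (‖y‖ ^ 2 - 1)), mul_nonneg hCf (sq_nonneg (‖y‖ ^ 2))])
    (eventually_bandwidth_pos hκ) h0 (tendsto_sqrt_rpow h0 hε1)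
    (tendsto_sqrt_rpow_div h0 (eventually_bandwidth_pos hκ) hε0)
  have hLh : Tendsto (fun n => L * bandwidth κ d n ^ 2) atTop (𝓝 0) := by
    simpa using (h0.pow 2).const_mul L
  filter_upwards [hdev, hLh.eventually_le_const (half_pos ht),
    (Metric.tendsto_nhds.1 hmean) (t / 2) (half_pos ht)] with n hn1 hn2 hn3
  refine (measure_mono fun ω hω => ?_).trans hn1
  simp only [Set.mem_ofPred_eq, Real.dist_eq, pow_one] at hω hn3 ⊢
  refine hn2.trans_lt ?_
  set a := kernelAverage K d (bandwidth κ d n) x₀ f n (fun i => X i ω)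
  set v := F₀ * ∫ u, K (A u) * f (A u)
  have := abs_sub_le a ((bandwidth κ d n ^ d)⁻¹ *
    ∫ x in Metric.ball x₀ (Real.sqrt (bandwidth κ d n ^ (1 - ε))),
      K ((bandwidth κ d n)⁻¹ • (x - x₀)) * f ((bandwidth κ d n)⁻¹ • (x - x₀)) ∂(P.map (X 0))) v
  linarith

/-- Fluctuation and bias are both of order h²: the former for every quadratic f, the latter only
because b is normal. -/
theorem kernelAverage_mixed (hXmeas : ∀ i, Measurable (X i)) (hXindep : iIndepFun X P)
    (hXident : ∀ i, IdentDistrib (X i) (X 0) P P)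
    (hc : IsRadialChart (P.map (X 0)) x₀ A F₀ Φ G ρ C) (hF₀ : 0 < F₀)
    (hm : 0 < m) (hA : ∀ u, m * ‖u‖ ≤ ‖A u‖) (hK : IsKernel K) (hκ : 0 < κ)
    (hM : 0 < M) (hε0 : 0 < ε) (hε1 : ε < 1)
    (htail : TailCondition K (P.map (X 0)) x₀ d (bandwidth κ d) ε M)
    (a : Eucl p) {b : Eucl p} (hb : ∀ u, inner ℝ b (A u) = 0) {δ : ℝ} (hδ : 0 < δ) :
    ∃ L, 0 < L ∧ ∀ᶠ n in atTop, P {ω | L * bandwidth κ d n ^ 2 <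
      |kernelAverage K d (bandwidth κ d n) x₀ (fun y => inner ℝ a y * inner ℝ b y) n
        (fun i => X i ω)|} ≤ ENNReal.ofReal δ := by
  have h0 : Tendsto (bandwidth κ d) atTop (𝓝 0) := tendsto_bandwidth
  have hint := integrable_kernel_pow_mul hc hF₀ hm hA hK hκ hM hε0 hε1 htail (γ := 1) (Or.inl rfl)
  obtain ⟨L, hL, hdev⟩ := kernelAverage_deviation hXmeas hXindep hXident hc hF₀ hm hA hK hκ hM hε0
    hε1 htail (f := fun y => inner ℝ a y * inner ℝ b y) (by fun_prop) (Cf := ‖a‖ * ‖b‖)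
    (fun y => by
      rw [abs_mul]
      calc |inner ℝ a y| * |inner ℝ b y| ≤ (‖a‖ * ‖y‖) * (‖b‖ * ‖y‖) := by
            gcongr <;> exact abs_real_inner_le_norm _ _
        _ = ‖a‖ * ‖b‖ * ‖y‖ ^ 2 := by ring
        _ ≤ _ := by gcongr; linarith) hδ
  obtain ⟨c, hc0, hcb⟩ := hc.abs_setIntegral_mixed_le hF₀ hm hA hK hint a hb
  refine ⟨L + c, by linarith, ?_⟩
  filter_upwards [hdev, eventually_bandwidth_pos hκ,
    (tendsto_sqrt_rpow h0 hε1).eventually_le_const hc.pos] with n hn1 hn2 hn3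
  refine (measure_mono fun ω hω => ?_).trans hn1
  have h1 := hcb _ _ hn2 hn3
  simp only [Set.mem_ofPred_eq] at hω ⊢
  have h2 := abs_sub_abs_le_abs_sub
    (kernelAverage K d (bandwidth κ d n) x₀ (fun y => inner ℝ a y * inner ℝ b y) n
        (fun i => X i ω)) ((bandwidth κ d n ^ d)⁻¹ *
    ∫ x in Metric.ball x₀ (Real.sqrt (bandwidth κ d n ^ (1 - ε))),
      K ((bandwidth κ d n)⁻¹ • (x - x₀)) ^ 1 * (inner ℝ a ((bandwidth κ d n)⁻¹ • (x - x₀)) *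
        inner ℝ b ((bandwidth κ d n)⁻¹ • (x - x₀))) ∂(P.map (X 0)))
  rw [add_mul] at hω
  linarith

end Kernel

/-! ### Orthogonal matrices and quadratic forms -/

section LinearAlgebra

variable {p : ℕ}

lemma orthogonal_transpose_mul {U : Matrix (Fin p) (Fin p) ℝ}
    (hU : U ∈ Matrix.orthogonalGroup (Fin p) ℝ) : Uᵀ * U = 1 :=
  (Matrix.mem_orthogonalGroup_iff' _ _).1 hU

lemma orthogonal_mul_transpose {U : Matrix (Fin p) (Fin p) ℝ}
    (hU : U ∈ Matrix.orthogonalGroup (Fin p) ℝ) : U * Uᵀ = 1 :=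
  (Matrix.mem_orthogonalGroup_iff _ _).1 hU

lemma sum_sq_transpose_mulVec {V : Matrix (Fin p) (Fin p) ℝ} (hV : V * Vᵀ = 1) (x : Fin p → ℝ) :
    ∑ k, (Vᵀ *ᵥ x) k ^ 2 = ∑ k, x k ^ 2 := by
  have h1 : (Vᵀ *ᵥ x) ⬝ᵥ (Vᵀ *ᵥ x) = x ⬝ᵥ x := by
    rw [Matrix.dotProduct_mulVec, Matrix.vecMul_transpose, Matrix.mulVec_mulVec, hV,
      Matrix.one_mulVec]
  simpa [dotProduct, pow_two] using h1

lemma dotProduct_conj_diagonal_mulVec (V : Matrix (Fin p) (Fin p) ℝ) (l x : Fin p → ℝ) :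
    x ⬝ᵥ (V * Matrix.diagonal l * Vᵀ) *ᵥ x = ∑ k, l k * (Vᵀ *ᵥ x) k ^ 2 := by
  rw [← Matrix.mulVec_mulVec, ← Matrix.mulVec_mulVec, Matrix.dotProduct_mulVec,
    ← Matrix.mulVec_transpose, dotProduct]
  refine Finset.sum_congr rfl fun k _ => ?_
  rw [Matrix.mulVec_diagonal]
  ring

lemma abs_dotProduct_mulVec_le {ι : Type*} [Fintype ι] {E : Matrix ι ι ℝ} {η : ℝ}
    (hE : ∀ i j, |E i j| ≤ η) (x : ι → ℝ) :
    |x ⬝ᵥ E *ᵥ x| ≤ Fintype.card ι * η * ∑ i, x i ^ 2 := by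
  have h1 : ∀ i j, |x i * (E i j * x j)| ≤ η * ((x i ^ 2 + x j ^ 2) / 2) := fun i j => by
    rw [abs_mul, abs_mul]
    have h2 : |x i| * |x j| ≤ (x i ^ 2 + x j ^ 2) / 2 := by
      nlinarith [sq_nonneg (|x i| - |x j|), sq_abs (x i), sq_abs (x j)]
    have h3 : 0 ≤ |x i| * |x j| := by positivity
    calc |x i| * (|E i j| * |x j|) = |E i j| * (|x i| * |x j|) := by ring
      _ ≤ η * ((x i ^ 2 + x j ^ 2) / 2) :=
        mul_le_mul (hE i j) h2 h3 ((abs_nonneg _).trans (hE i j))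
  have h2 : x ⬝ᵥ E *ᵥ x = ∑ i, ∑ j, x i * (E i j * x j) := by
    simp only [dotProduct, Matrix.mulVec, Finset.mul_sum]
  rw [h2]
  calc |∑ i, ∑ j, x i * (E i j * x j)| ≤ ∑ i, ∑ j, η * ((x i ^ 2 + x j ^ 2) / 2) :=
        (Finset.abs_sum_le_sum_abs _ _).trans (Finset.sum_le_sum fun i _ =>
          (Finset.abs_sum_le_sum_abs _ _).trans (Finset.sum_le_sum fun j _ => h1 i j))
    _ = _ := by
      simp only [← Finset.mul_sum, ← Finset.sum_div, Finset.sum_add_distrib, Finset.sum_const,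
        Finset.card_univ, nsmul_eq_mul]
      ring

/-- A nonzero vector with few prescribed zero coordinates, in two bases. -/
lemma exists_ne_zero_coords_eq_zero (V : Matrix (Fin p) (Fin p) ℝ) (s t : Finset (Fin p))
    (hst : s.card + t.card < p) :
    ∃ x : Fin p → ℝ, x ≠ 0 ∧ (∀ i ∈ s, x i = 0) ∧ ∀ k ∈ t, (Vᵀ *ᵥ x) k = 0 := by
  let f : (Fin p → ℝ) →ₗ[ℝ] (s → ℝ) × (t → ℝ) :=
    (LinearMap.funLeft ℝ ℝ (Subtype.val : s → Fin p)).prod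
      ((LinearMap.funLeft ℝ ℝ (Subtype.val : t → Fin p)).comp (Matrix.mulVecLin Vᵀ))
  have hker : LinearMap.ker f ≠ ⊥ := LinearMap.ker_ne_bot_of_finrank_lt (by simpa using hst)
  obtain ⟨x, hx, hx0⟩ := (Submodule.ne_bot_iff _).1 hker
  rw [LinearMap.mem_ker] at hx
  refine ⟨x, hx0, fun i hi => ?_, fun k hk => ?_⟩
  · exact congrFun (congrArg Prod.fst hx) ⟨i, hi⟩
  · exact congrFun (congrArg Prod.snd hx) ⟨k, hk⟩

lemma card_Iio_add_card_Ioi_lt (j : Fin p) :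
    (Finset.Iio j).card + (Finset.Ioi j).card < p := by
  rw [Fin.card_Iio, Fin.card_Ioi]
  have := j.2
  omega

lemma sum_sq_pos {ι : Type*} [Fintype ι] {x : ι → ℝ} (hx : x ≠ 0) : 0 < ∑ i, x i ^ 2 := by
  obtain ⟨i, hi⟩ := Function.ne_iff.1 hx
  exact Finset.sum_pos' (fun _ _ => sq_nonneg _) ⟨i, Finset.mem_univ _, by
    have : x i ≠ 0 := hi
    positivity⟩

/-! ### Perturbation of a diagonal matrix -/

section Perturbation

variable {d : ℕ} {V : Matrix (Fin p) (Fin p) ℝ} {l ev : Fin p → ℝ} {η c₀ : ℝ}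

lemma dotProduct_le_of_entries {B : Matrix (Fin p) (Fin p) ℝ}
    (hη : ∀ i j, |(B - Matrix.diagonal ev) i j| ≤ η) (x : Fin p → ℝ) :
    |x ⬝ᵥ B *ᵥ x - ∑ i, ev i * x i ^ 2| ≤ p * η * ∑ i, x i ^ 2 := by
  have h1 := abs_dotProduct_mulVec_le hη x
  rw [Matrix.sub_mulVec, dotProduct_sub, Fintype.card_fin] at h1
  have h2 : x ⬝ᵥ Matrix.diagonal ev *ᵥ x = ∑ i, ev i * x i ^ 2 := by
    simp only [dotProduct, Matrix.mulVec_diagonal]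
    exact Finset.sum_congr rfl fun i _ => by ring
  rwa [h2] at h1

/-- A min-max argument: a dimension count yields x ≠ 0 supported on standard coordinates ≥ j and on
eigendirections ≤ j. Its form under the perturbed matrix is at least l j ‖x‖², and under the
diagonal matrix it vanishes. The opposite inequality below exchanges the two supports. -/
lemma eigenvalue_le_of_near (hV : V * Vᵀ = 1) (hl : Antitone l)
    (hη : ∀ i j, |(V * Matrix.diagonal l * Vᵀ - Matrix.diagonal ev) i j| ≤ η)
    (hev : ∀ i : Fin p, d ≤ (i : ℕ) → ev i = 0) {j : Fin p} (hj : d ≤ (j : ℕ)) :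
    l j ≤ p * η := by
  obtain ⟨x, hx, hx1, hx2⟩ := exists_ne_zero_coords_eq_zero V (Finset.Iio j) (Finset.Ioi j)
    (card_Iio_add_card_Ioi_lt j)
  have h1 := dotProduct_le_of_entries hη x
  have h2 : ∑ i, ev i * x i ^ 2 = 0 := Finset.sum_eq_zero fun i _ => by
    by_cases hi : i < j
    · rw [hx1 i (Finset.mem_Iio.2 hi)]; ring
    · rw [hev i (hj.trans (by simpa using hi))]; ring
  rw [h2, sub_zero, dotProduct_conj_diagonal_mulVec] at h1
  have h3 : l j * ∑ i, x i ^ 2 ≤ ∑ k, l k * (Vᵀ *ᵥ x) k ^ 2 := by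
    rw [← sum_sq_transpose_mulVec hV x, Finset.mul_sum]
    refine Finset.sum_le_sum fun k _ => ?_
    by_cases hk : j < k
    · rw [hx2 k (Finset.mem_Ioi.2 hk)]; simp
    · exact mul_le_mul_of_nonneg_right (hl (not_lt.1 hk)) (sq_nonneg _)
  have h4 := sum_sq_pos hx
  exact le_of_mul_le_mul_right (h3.trans ((le_abs_self _).trans h1)) h4

lemma le_eigenvalue_of_near (hV : V * Vᵀ = 1) (hl : Antitone l)
    (hη : ∀ i j, |(V * Matrix.diagonal l * Vᵀ - Matrix.diagonal ev) i j| ≤ η)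
    (hev : ∀ i : Fin p, (i : ℕ) < d → c₀ ≤ ev i) {j : Fin p} (hj : (j : ℕ) < d) :
    c₀ - p * η ≤ l j := by
  obtain ⟨x, hx, hx1, hx2⟩ := exists_ne_zero_coords_eq_zero V (Finset.Ioi j) (Finset.Iio j)
    (by rw [add_comm]; exact card_Iio_add_card_Ioi_lt j)
  have h1 := dotProduct_le_of_entries hη x
  have h2 : c₀ * ∑ i, x i ^ 2 ≤ ∑ i, ev i * x i ^ 2 := by
    rw [Finset.mul_sum]
    refine Finset.sum_le_sum fun i _ => ?_
    by_cases hi : j < i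
    · rw [hx1 i (Finset.mem_Ioi.2 hi)]; simp
    · exact mul_le_mul_of_nonneg_right (hev i (lt_of_le_of_lt (by simpa using hi) hj)) (sq_nonneg _)
  rw [dotProduct_conj_diagonal_mulVec] at h1
  have h3 : ∑ k, l k * (Vᵀ *ᵥ x) k ^ 2 ≤ l j * ∑ i, x i ^ 2 := by
    rw [← sum_sq_transpose_mulVec hV x, Finset.mul_sum]
    refine Finset.sum_le_sum fun k _ => ?_
    by_cases hk : k < j
    · rw [hx2 k (Finset.mem_Iio.2 hk)]; simp
    · exact mul_le_mul_of_nonneg_right (hl (not_lt.1 hk)) (sq_nonneg _)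
  have h4 := sum_sq_pos hx
  have h5 := (abs_le.1 h1).1
  have h6 : (c₀ - p * η) * ∑ i, x i ^ 2 ≤ l j * ∑ i, x i ^ 2 := by
    rw [sub_mul]; linarith
  exact le_of_mul_le_mul_right h6 h4

/-- If `B v = θ v`, the part of `v` supported on `s` is controlled by the off-diagonal block of
`B`, provided the diagonal block is separated from `θ`. -/
lemma sum_abs_le_of_eigenvector {B : Matrix (Fin p) (Fin p) ℝ} {v : Fin p → ℝ} {θ τ g : ℝ}
    (hBv : B *ᵥ v = θ • v) (hv : ∀ k, |v k| ≤ 1) (s : Fin p → Prop) [DecidablePred s]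
    (hτ : ∀ i k, s i → ¬ s k → |B i k| ≤ τ) (hτ0 : 0 ≤ τ) (hg : 0 < g)
    (hsep : g * ∑ i, (if s i then v i else 0) ^ 2 ≤
      |(fun i => if s i then v i else 0) ⬝ᵥ B *ᵥ (fun i => if s i then v i else 0) -
        θ * ∑ i, (if s i then v i else 0) ^ 2|) :
    ∑ i, |if s i then v i else 0| ≤ p ^ 2 * τ / g := by
  set y : Fin p → ℝ := fun i => if s i then v i else 0 with hy
  set z : Fin p → ℝ := fun i => if s i then 0 else v i with hz
  have hvyz : v = y + z := by
    ext i; by_cases hi : s i <;> simp [hy, hz, hi]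
  -- Pairing the eigenvector equation with y leaves only the off-diagonal block on the right.
  -- Separation bounds the left side below by a multiple of ‖y‖², while the right side is linear in
  -- y, so one factor of y cancels.
  have h1 : y ⬝ᵥ B *ᵥ y - θ * ∑ i, y i ^ 2 = -(y ⬝ᵥ B *ᵥ z) := by
    have h2 : y ⬝ᵥ B *ᵥ v = θ * ∑ i, y i ^ 2 := by
      rw [hBv, dotProduct_smul, smul_eq_mul]
      congr 1
      rw [dotProduct]
      refine Finset.sum_congr rfl fun i _ => ?_
      by_cases hi : s i <;> simp [hy, hi, pow_two]
    rw [← h2, hvyz, Matrix.mulVec_add, dotProduct_add]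
    ring
  set T := ∑ i, |y i| with hT
  have hT0 : 0 ≤ T := Finset.sum_nonneg fun i _ => abs_nonneg _
  have h3 : |y ⬝ᵥ B *ᵥ z| ≤ T * (p * τ) := by
    have e : y ⬝ᵥ B *ᵥ z = ∑ i, y i * ∑ k, B i k * z k := rfl
    rw [e, hT, Finset.sum_mul]
    refine (Finset.abs_sum_le_sum_abs _ _).trans (Finset.sum_le_sum fun i _ => ?_)
    rw [abs_mul]
    by_cases hi : s i
    · refine mul_le_mul_of_nonneg_left ?_ (abs_nonneg _)
      refine (Finset.abs_sum_le_sum_abs _ _).trans ?_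
      calc ∑ k, |B i k * z k| ≤ ∑ _k : Fin p, τ := by
            refine Finset.sum_le_sum fun k _ => ?_
            by_cases hk : s k
            · simp [hz, hk, hτ0]
            · have hzk : z k = v k := by simp [hz, hk]
              rw [abs_mul, hzk]
              calc |B i k| * |v k| ≤ τ * 1 :=
                    mul_le_mul (hτ i k hi hk) (hv k) (abs_nonneg _) hτ0
                _ = τ := mul_one _
        _ = p * τ := by simp
    · have : y i = 0 := by simp [hy, hi]
      simp [this]
  have h4 : T ^ 2 ≤ p * ∑ i, y i ^ 2 := by
    have := sq_sum_le_card_mul_sum_sq (s := (Finset.univ : Finset (Fin p))) (f := fun i => |y i|)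
    simpa [sq_abs] using this
  have h5 : g * ∑ i, y i ^ 2 ≤ T * (p * τ) := by
    refine le_trans hsep ?_
    rw [h1, abs_neg]
    exact h3
  rw [le_div_iff₀ hg]
  have hp0 : (0 : ℝ) ≤ p := Nat.cast_nonneg p
  by_cases hT' : T = 0
  · rw [hT']; simp; positivity
  · have hTpos : 0 < T := lt_of_le_of_ne hT0 (Ne.symm hT')
    have h6 : (T * g) * T ≤ (p ^ 2 * τ) * T := by
      calc (T * g) * T = g * T ^ 2 := by ring
        _ ≤ g * (p * ∑ i, y i ^ 2) := by gcongr
        _ = p * (g * ∑ i, y i ^ 2) := by ring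
        _ ≤ p * (T * (p * τ)) := by gcongr
        _ = _ := by ring
    exact le_of_mul_le_mul_right h6 hTpos

lemma abs_entry_le_one (hV : V * Vᵀ = 1) (i k : Fin p) : |V i k| ≤ 1 := by
  have h1 : ∑ j, V i j ^ 2 = 1 := by
    have := congrFun (congrFun hV i) i
    simpa [Matrix.mul_apply, pow_two] using this
  have h2 : V i k ^ 2 ≤ 1 := by
    rw [← h1]
    exact Finset.single_le_sum (f := fun j => V i j ^ 2) (fun _ _ => sq_nonneg _)
      (Finset.mem_univ k)
  exact (sq_le_one_iff_abs_le_one _).1 h2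

lemma conj_diagonal_mulVec_col (hV' : Vᵀ * V = 1) (j : Fin p) :
    (V * Matrix.diagonal l * Vᵀ) *ᵥ (fun i => V i j) = l j • fun i => V i j := by
  have h1 : V * Matrix.diagonal l * Vᵀ * V = V * Matrix.diagonal l := by
    rw [Matrix.mul_assoc, hV', Matrix.mul_one]
  ext i
  have := congrFun (congrFun h1 i) j
  rw [Matrix.mul_diagonal] at this
  simp only [Pi.smul_apply, smul_eq_mul]
  rw [mul_comm (l j), ← this]
  rfl

/-- The off-diagonal blocks of the eigenvector matrix of a perturbed diagonal matrix. -/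
lemma abs_entry_le_of_near (hV : V * Vᵀ = 1) (hV' : Vᵀ * V = 1) (hl : Antitone l) (hc₀ : 0 < c₀)
    (hη : ∀ i j, |(V * Matrix.diagonal l * Vᵀ - Matrix.diagonal ev) i j| ≤ η)
    (hev0 : ∀ i : Fin p, d ≤ (i : ℕ) → ev i = 0)
    (hev1 : ∀ i : Fin p, (i : ℕ) < d → c₀ ≤ ev i) (hsmall : 4 * (p * η) ≤ c₀)
    {τ : ℝ} (hτ0 : 0 ≤ τ)
    (hτ : ∀ i j : Fin p, (i : ℕ) < d → d ≤ (j : ℕ) → |(V * Matrix.diagonal l * Vᵀ) i j| ≤ τ)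
    (i j : Fin p) (hij : ((i : ℕ) < d ∧ d ≤ (j : ℕ)) ∨ ((j : ℕ) < d ∧ d ≤ (i : ℕ))) :
    |V i j| ≤ p ^ 2 * τ / (c₀ / 2) := by
  set B := V * Matrix.diagonal l * Vᵀ with hB
  have hBs : Bᵀ = B := by
    rw [hB]; simp [Matrix.transpose_mul, Matrix.mul_assoc]
  have hv : ∀ k, |V k j| ≤ 1 := fun k => abs_entry_le_one hV k j
  rcases hij with ⟨hi, hj⟩ | ⟨hj, hi⟩
  -- For a trailing eigenvector the eigenvalue is at most pη and the leading block at least c₀ - pη,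
  -- so the gap is at least c₀ - 2pη ≥ c₀/2. The other case exchanges the blocks, using symmetry of
  -- the matrix for the off-diagonal bound.
  · have hlj := eigenvalue_le_of_near hV hl hη hev0 hj
    have key := sum_abs_le_of_eigenvector (conj_diagonal_mulVec_col hV' j) hv
      (fun i : Fin p => (i : ℕ) < d) (fun i k hi hk => hτ i k hi (not_lt.1 hk)) hτ0
      (half_pos hc₀) (by
        set y : Fin p → ℝ := fun i => if (i : ℕ) < d then V i j else 0 with hy
        have h1 := (abs_le.1 (dotProduct_le_of_entries hη y)).1
        have h2 : c₀ * ∑ i, y i ^ 2 ≤ ∑ i, ev i * y i ^ 2 := by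
          rw [Finset.mul_sum]
          refine Finset.sum_le_sum fun i _ => ?_
          by_cases hi : (i : ℕ) < d
          · exact mul_le_mul_of_nonneg_right (hev1 i hi) (sq_nonneg _)
          · simp [hy, hi]
        have h3 : 0 ≤ ∑ i, y i ^ 2 := Finset.sum_nonneg fun i _ => sq_nonneg _
        have h4 : l j * ∑ i, y i ^ 2 ≤ p * η * ∑ i, y i ^ 2 := by gcongr
        refine le_trans ?_ (le_abs_self _)
        have h5 : 4 * (p * η) * ∑ i, y i ^ 2 ≤ c₀ * ∑ i, y i ^ 2 := by gcongr
        change c₀ / 2 * ∑ i, y i ^ 2 ≤ y ⬝ᵥ B *ᵥ y - l j * ∑ i, y i ^ 2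
        linarith)
    refine le_trans ?_ key
    have := Finset.single_le_sum (f := fun i : Fin p => |if (i : ℕ) < d then V i j else 0|)
      (fun _ _ => abs_nonneg _) (Finset.mem_univ i)
    simpa [hi] using this
  · have hlj := le_eigenvalue_of_near hV hl hη hev1 hj
    have key := sum_abs_le_of_eigenvector (conj_diagonal_mulVec_col hV' j) hv
      (fun i : Fin p => d ≤ (i : ℕ)) (fun i k hi hk => by
        rw [← hB, ← hBs, Matrix.transpose_apply]
        exact hτ k i (not_le.1 hk) hi) hτ0 (half_pos hc₀) (by
        set y : Fin p → ℝ := fun i => if d ≤ (i : ℕ) then V i j else 0 with hy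
        have h1 := (abs_le.1 (dotProduct_le_of_entries hη y)).2
        have h2 : ∑ i, ev i * y i ^ 2 = 0 := Finset.sum_eq_zero fun i _ => by
          by_cases hi : d ≤ (i : ℕ)
          · rw [hev0 i hi, zero_mul]
          · simp [hy, hi]
        have h3 : 0 ≤ ∑ i, y i ^ 2 := Finset.sum_nonneg fun i _ => sq_nonneg _
        have h4 : (c₀ - p * η) * ∑ i, y i ^ 2 ≤ l j * ∑ i, y i ^ 2 := by gcongr
        refine le_trans ?_ (neg_le_abs _)
        have h5 : 4 * (p * η) * ∑ i, y i ^ 2 ≤ c₀ * ∑ i, y i ^ 2 := by gcongr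
        change c₀ / 2 * ∑ i, y i ^ 2 ≤ -(y ⬝ᵥ B *ᵥ y - l j * ∑ i, y i ^ 2)
        rw [sub_mul] at h4
        have h6 : y ⬝ᵥ B *ᵥ y ≤ p * η * ∑ i, y i ^ 2 := by linarith
        linarith)
    refine le_trans ?_ key
    have := Finset.single_le_sum (f := fun i : Fin p => |if d ≤ (i : ℕ) then V i j else 0|)
      (fun _ _ => abs_nonneg _) (Finset.mem_univ i)
    simpa [hi] using this

/-- The diagonal projection onto the coordinates `j ≥ d`. -/
def tailProj (p d : ℕ) : Matrix (Fin p) (Fin p) ℝ :=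
  Matrix.diagonal fun j => if d ≤ (j : ℕ) then 1 else 0

/-- Entries of the conjugate are sums of V i j V k j over j ≥ d. If i or k is below d, every term
has a factor in an off-diagonal block. If neither is, orthonormality of rows rewrites the difference
as minus the sum over j < d, again with such factors. -/
lemma abs_conj_tailProj_sub_le (hV : V * Vᵀ = 1) {θ : ℝ}
    (hθ : ∀ i j : Fin p, ((i : ℕ) < d ∧ d ≤ (j : ℕ)) ∨ ((j : ℕ) < d ∧ d ≤ (i : ℕ)) → |V i j| ≤ θ)
    (hθ0 : 0 ≤ θ) (i k : Fin p) :
    |(V * tailProj p d * Vᵀ - tailProj p d) i k| ≤ p * θ := by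
  have hone : ∀ i k, |V i k| ≤ 1 := abs_entry_le_one hV
  have hsum : ∀ w : Fin p → ℝ, (∀ j, |w j| ≤ θ) → |∑ j, w j| ≤ p * θ := fun w hw => by
    calc |∑ j, w j| ≤ ∑ _j : Fin p, θ :=
          (Finset.abs_sum_le_sum_abs _ _).trans (Finset.sum_le_sum fun j _ => hw j)
      _ = _ := by simp
  have hentry : (V * tailProj p d * Vᵀ) i k =
      ∑ j : Fin p, (if d ≤ (j : ℕ) then V i j * V k j else 0) := by
    rw [Matrix.mul_apply]
    refine Finset.sum_congr rfl fun j _ => ?_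
    rw [tailProj, Matrix.mul_diagonal, Matrix.transpose_apply]
    split_ifs <;> ring
  have hprod : ∀ a b : ℝ, |a| ≤ θ → |b| ≤ 1 → |a * b| ≤ θ := fun a b ha hb => by
    rw [abs_mul]
    calc |a| * |b| ≤ θ * 1 := mul_le_mul ha hb (abs_nonneg _) hθ0
      _ = θ := mul_one _
  rw [Matrix.sub_apply, hentry]
  by_cases hi : (i : ℕ) < d
  · have hz : tailProj p d i k = 0 := by
      rw [tailProj, Matrix.diagonal_apply]
      split_ifs with h1 h2
      · exact absurd h2 (not_le.2 hi)
      · rfl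
      · rfl
    rw [hz, sub_zero]
    refine hsum _ fun j => ?_
    split_ifs with hj
    · exact hprod _ _ (hθ i j (Or.inl ⟨hi, hj⟩)) (hone k j)
    · simpa using hθ0
  · by_cases hk : (k : ℕ) < d
    · have hz : tailProj p d i k = 0 := by
        rw [tailProj, Matrix.diagonal_apply]
        split_ifs with h1 h2
        · rw [h1] at h2; exact absurd h2 (not_le.2 hk)
        · rfl
        · rfl
      rw [hz, sub_zero]
      refine hsum _ fun j => ?_
      split_ifs with hj
      · rw [mul_comm]; exact hprod _ _ (hθ k j (Or.inl ⟨hk, hj⟩)) (hone i j)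
      · simpa using hθ0
    · have h1 : tailProj p d i k = ∑ j, V i j * V k j := by
        have h2 := congrFun (congrFun hV i) k
        rw [Matrix.mul_apply] at h2
        simp only [Matrix.transpose_apply] at h2
        rw [h2, tailProj, Matrix.diagonal_apply, Matrix.one_apply, if_pos (not_lt.1 hi)]
      rw [h1, ← Finset.sum_sub_distrib]
      refine hsum _ fun j => ?_
      split_ifs with hj
      · simpa using hθ0
      · rw [zero_sub, abs_neg]
        exact hprod _ _ (hθ i j (Or.inr ⟨not_le.1 hj, not_lt.1 hi⟩)) (hone k j)

end Perturbation

/-- Trading the rectangular block of eigenvectors for a square diagonal projection lets all later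
computations be conjugations. -/
lemma IsNormalProjection.exists_eq {d : ℕ} {A Q : Matrix (Fin p) (Fin p) ℝ}
    (h : IsNormalProjection d A Q) :
    ∃ (U : Matrix (Fin p) (Fin p) ℝ) (ev : Fin p → ℝ), U * Uᵀ = 1 ∧ Uᵀ * U = 1 ∧ Antitone ev ∧
      A = U * Matrix.diagonal ev * Uᵀ ∧ Q = U * tailProj p d * Uᵀ := by
  obtain ⟨U, ev, hU, hev, hA, hQ⟩ := h
  refine ⟨U, ev, orthogonal_mul_transpose hU, orthogonal_transpose_mul hU, hev, hA, ?_⟩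
  rw [hQ]
  ext i k
  rw [Matrix.mul_apply, Matrix.mul_apply]
  simp only [Matrix.submatrix_apply, Matrix.transpose_apply, id, tailProj, Matrix.mul_diagonal]
  refine (Finset.sum_subtype (p := fun j : Fin p => d ≤ (j : ℕ))
    (Finset.univ.filter fun j : Fin p => d ≤ (j : ℕ)) (by simp)
    (fun j => U i j * U k j)).symm.trans ?_
  rw [Finset.sum_filter]
  refine Finset.sum_congr rfl fun j _ => ?_
  split_ifs <;> ring

lemma exists_norm_le_of_entries (p : ℕ) : ∃ c : ℝ, 0 ≤ c ∧ ∀ (Q : Matrix (Fin p) (Fin p) ℝ) (θ : ℝ),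
    (∀ i j, |Q i j| ≤ θ) → ‖Q‖ ≤ c * θ := by
  refine ⟨∑ i : Fin p, ∑ j : Fin p, ‖Matrix.single i j (1 : ℝ)‖,
    Finset.sum_nonneg fun i _ => Finset.sum_nonneg fun j _ => norm_nonneg _, fun Q θ hQ => ?_⟩
  rw [Matrix.matrix_eq_sum_single Q, Finset.sum_mul]
  refine (norm_sum_le _ _).trans (Finset.sum_le_sum fun i _ => ?_)
  rw [Finset.sum_mul]
  refine (norm_sum_le _ _).trans (Finset.sum_le_sum fun j _ => ?_)
  have : Matrix.single i j (Q i j) = Q i j • Matrix.single i j (1 : ℝ) := by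
    rw [Matrix.smul_single, smul_eq_mul, mul_one]
  rw [this, norm_smul, mul_comm, Real.norm_eq_abs]
  gcongr
  exact hQ i j

/-- With J the isometric inclusion of the spatial coordinates, each matrix is obtained from the
other by multiplying on both sides with J and its adjoint, which are contractions. -/
lemma norm_augment (Q : Matrix (Fin p) (Fin p) ℝ) : ‖augment Q‖ = ‖Q‖ := by
  set J : Matrix (Unit ⊕ Fin p) (Fin p) ℝ := Matrix.fromRows 0 1 with hJ
  have hJJ : Jᴴ * J = 1 := by
    rw [hJ, Matrix.conjTranspose_fromRows_eq_fromCols_conjTranspose, Matrix.fromCols_mul_fromRows]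
    simp
  have hJn : ‖J‖ ≤ 1 := by
    have h1 : ‖J‖ * ‖J‖ = ‖(1 : Matrix (Fin p) (Fin p) ℝ)‖ := by
      rw [← Matrix.l2_opNorm_conjTranspose_mul_self, hJJ]
    have h2 : ‖(1 : Matrix (Fin p) (Fin p) ℝ)‖ ≤ 1 := by
      -- For p = 0 the identity matrix is zero, so its norm is not one.
      cases isEmpty_or_nonempty (Fin p)
      · have : (1 : Matrix (Fin p) (Fin p) ℝ) = 0 := Subsingleton.elim _ _
        rw [this, norm_zero]; norm_num
      · rw [norm_one]
    nlinarith [norm_nonneg J]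
  have hJn' : ‖Jᴴ‖ ≤ 1 := by rwa [Matrix.l2_opNorm_conjTranspose]
  have e1 : augment Q = J * Q * Jᴴ := by
    rw [hJ, Matrix.conjTranspose_fromRows_eq_fromCols_conjTranspose, Matrix.fromRows_mul,
      Matrix.fromRows_mul_fromCols]
    simp [augment]
  have e2 : Q = Jᴴ * augment Q * J := by
    rw [e1]
    calc Q = (Jᴴ * J) * Q * (Jᴴ * J) := by rw [hJJ]; simp
      _ = _ := by simp only [Matrix.mul_assoc]
  have hmul : ∀ {a b c e : Type} [Fintype a] [Fintype b] [Fintype c] [Fintype e]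
      [DecidableEq a] [DecidableEq b] [DecidableEq c] [DecidableEq e]
      (L : Matrix a b ℝ) (N : Matrix b c ℝ) (R : Matrix c e ℝ), ‖L‖ ≤ 1 → ‖R‖ ≤ 1 →
      ‖L * N * R‖ ≤ ‖N‖ := by
    intro a b c e _ _ _ _ _ _ _ _ L N R hL hR
    calc ‖L * N * R‖ ≤ ‖L * N‖ * ‖R‖ := Matrix.l2_opNorm_mul _ _
      _ ≤ (‖L‖ * ‖N‖) * ‖R‖ := by gcongr; exact Matrix.l2_opNorm_mul _ _
      _ ≤ (1 * ‖N‖) * 1 := by gcongr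
      _ = ‖N‖ := by ring
  apply le_antisymm
  · rw [e1]; exact hmul _ _ _ hJn hJn'
  · conv_lhs => rw [e2]
    exact hmul _ _ _ hJn' hJn

end LinearAlgebra

lemma inner_toLp_left {p : ℕ} (a : Fin p → ℝ) (y : Eucl p) :
    inner ℝ (WithLp.toLp 2 a : Eucl p) y = ∑ k, a k * y k := by
  simp [PiLp.inner_apply, mul_comm]

/-! ### The Gram matrix as an array of kernel averages -/

section Gram

variable {p d n : ℕ} {K : Eucl p → ℝ} {h : ℝ} {x₀ : Eucl p}

lemma bandwidthRoot_eq_diagonal (p d n : ℕ) (h : ℝ) :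
    bandwidthRoot p d n h =
      Matrix.diagonal (Sum.elim (fun _ => Real.sqrt (n * h ^ d)) fun _ =>
        Real.sqrt (n * h ^ d) * h) := by
  rw [bandwidthRoot]
  ext a b
  rcases a with a | a <;> rcases b with b | b <;>
    simp [Matrix.diagonal_apply, Matrix.one_apply]

lemma bandwidthRoot_inv (hn : 0 < n) (hh : 0 < h) :
    (bandwidthRoot p d n h)⁻¹ =
      Matrix.diagonal (Sum.elim (fun _ => (Real.sqrt (n * h ^ d))⁻¹) fun _ =>
        (Real.sqrt (n * h ^ d))⁻¹ * h⁻¹) := by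
  have hn' : (0 : ℝ) < n := by exact_mod_cast hn
  have hs : 0 < Real.sqrt (n * h ^ d) := Real.sqrt_pos.2 (by positivity)
  refine Matrix.inv_eq_right_inv ?_
  rw [bandwidthRoot_eq_diagonal, Matrix.diagonal_mul_diagonal, ← Matrix.diagonal_one]
  congr 1
  ext a
  rcases a with a | a
  · simp only [Sum.elim_inl]
    exact mul_inv_cancel₀ hs.ne'
  · simp only [Sum.elim_inr]
    field_simp

/-- The augmented coordinates `(1, y)`. -/
def augCoord (y : Eucl p) : Unit ⊕ Fin p → ℝ := Sum.elim (fun _ => 1) fun j => y j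

/-- The factor h^p undoes the normalisation of the scaled kernel. The two copies of H^{-1/2} supply
1/(n h^d) and rescale the spatial coordinates by 1/h. -/
lemma gram_apply (hn : 0 < n) (hh : 0 < h) (x : ℕ → Eucl p) (a b : Unit ⊕ Fin p) :
    gram K d h x₀ (fun i : Fin n => x i) a b =
      kernelAverage K d h x₀ (fun y => augCoord y a * augCoord y b) n x := by
  have hn' : (0 : ℝ) < n := by exact_mod_cast hn
  have hs : 0 < Real.sqrt (n * h ^ d) := Real.sqrt_pos.2 (by positivity)
  have hsq : (Real.sqrt (n * h ^ d))⁻¹ * (Real.sqrt (n * h ^ d))⁻¹ = (n * h ^ d)⁻¹ := by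
    rw [← mul_inv, Real.mul_self_sqrt (by positivity)]
  have hw : ∀ (i : Fin n) (a : Unit ⊕ Fin p),
      Sum.elim (fun _ => (Real.sqrt (n * h ^ d))⁻¹) (fun _ : Fin p =>
        (Real.sqrt (n * h ^ d))⁻¹ * h⁻¹) a * dataMatrix x₀ (fun i : Fin n => x i) i a =
      (Real.sqrt (n * h ^ d))⁻¹ * augCoord (h⁻¹ • (x i - x₀)) a := fun i a => by
    rcases a with a | a
    · simp [dataMatrix, augCoord]
    · simp [dataMatrix, augCoord, mul_assoc]
  rw [gram, bandwidthRoot_inv hn hh, Matrix.smul_apply, Matrix.mul_diagonal, Matrix.mul_assoc,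
    Matrix.mul_assoc, Matrix.diagonal_mul, kernelAverage, Finset.sum_range, Matrix.mul_apply,
    smul_eq_mul, Finset.mul_sum, Finset.sum_mul, Finset.mul_sum, Finset.mul_sum]
  refine Finset.sum_congr rfl fun i _ => ?_
  rw [weightMatrix, Matrix.diagonal_mul, Matrix.transpose_apply, scaledKernel]
  have e1 := hw i a
  have e2 := hw i b
  set w := Sum.elim (fun _ => (Real.sqrt (n * h ^ d))⁻¹) (fun _ : Fin p =>
        (Real.sqrt (n * h ^ d))⁻¹ * h⁻¹)
  set D := dataMatrix x₀ (fun i : Fin n => x i)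
  set k := K (h⁻¹ • (x i - x₀))
  calc h ^ p * (w a * (D i a * ((h ^ p)⁻¹ * k * D i b)) * w b)
      = (h ^ p * (h ^ p)⁻¹) * k * (w a * D i a) * (w b * D i b) := by ring
    _ = k * ((Real.sqrt (n * h ^ d))⁻¹ * (Real.sqrt (n * h ^ d))⁻¹) *
        (augCoord (h⁻¹ • (x i - x₀)) a * augCoord (h⁻¹ • (x i - x₀)) b) := by
        rw [mul_inv_cancel₀ (by positivity), e1, e2]; ring
    _ = _ := by rw [hsq, pow_one]; ring

lemma kernelAverage_sum {ι : Type*} (s : Finset ι) (c : ι → ℝ) (f : ι → Eucl p → ℝ)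
    (x : ℕ → Eucl p) :
    kernelAverage K d h x₀ (fun y => ∑ k ∈ s, c k * f k y) n x =
      ∑ k ∈ s, c k * kernelAverage K d h x₀ (f k) n x := by
  simp only [kernelAverage, Finset.mul_sum]
  rw [Finset.sum_comm]
  refine Finset.sum_congr rfl fun k _ => Finset.sum_congr rfl fun i _ => ?_
  ring

lemma dotProduct_gram_mulVec (hn : 0 < n) (hh : 0 < h) (x : ℕ → Eucl p)
    (v w : Unit ⊕ Fin p → ℝ) :
    v ⬝ᵥ gram K d h x₀ (fun i : Fin n => x i) *ᵥ w =
      kernelAverage K d h x₀ (fun y => (∑ a, v a * augCoord y a) * ∑ b, w b * augCoord y b) n x := by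
  have e : (fun y : Eucl p => (∑ a, v a * augCoord y a) * ∑ b, w b * augCoord y b) =
      fun y => ∑ a, v a * ∑ b, w b * (augCoord y a * augCoord y b) := by
    ext y
    rw [Finset.sum_mul]
    refine Finset.sum_congr rfl fun a _ => ?_
    rw [mul_assoc, Finset.mul_sum]
    congr 1
    exact Finset.sum_congr rfl fun b _ => by ring
  rw [e, kernelAverage_sum _ v (fun a y => ∑ b, w b * (augCoord y a * augCoord y b)), dotProduct]
  refine Finset.sum_congr rfl fun a _ => ?_
  rw [kernelAverage_sum _ w (fun b y => augCoord y a * augCoord y b), Matrix.mulVec, dotProduct]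
  congr 1
  refine Finset.sum_congr rfl fun b _ => ?_
  rw [gram_apply hn hh, mul_comm]

lemma dotProduct_gram_mulVec_nonneg (hK : IsKernel K) (hn : 0 < n) (hh : 0 < h)
    (x : ℕ → Eucl p) (v : Unit ⊕ Fin p → ℝ) :
    0 ≤ v ⬝ᵥ gram K d h x₀ (fun i : Fin n => x i) *ᵥ v := by
  rw [dotProduct_gram_mulVec hn hh, kernelAverage]
  refine mul_nonneg (by positivity) (Finset.sum_nonneg fun i _ => ?_)
  exact mul_nonneg (pow_nonneg (hK.nonneg _) _) (mul_self_nonneg _)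

lemma dotProduct_toBlocks₂₂_gram_mulVec (hn : 0 < n) (hh : 0 < h) (x : ℕ → Eucl p)
    (v w : Fin p → ℝ) :
    v ⬝ᵥ (gram K d h x₀ (fun i : Fin n => x i)).toBlocks₂₂ *ᵥ w =
      kernelAverage K d h x₀ (fun y => inner ℝ (WithLp.toLp 2 v : Eucl p) y *
        inner ℝ (WithLp.toLp 2 w : Eucl p) y) n x := by
  have h1 := dotProduct_gram_mulVec (K := K) (d := d) (x₀ := x₀) hn hh x
    (Sum.elim (fun _ => 0) v) (Sum.elim (fun _ => 0) w)
  simp only [Fintype.sum_sum_type, Sum.elim_inl, Sum.elim_inr, augCoord, zero_mul,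
    Finset.sum_const_zero, zero_add] at h1
  simp only [inner_toLp_left]
  rw [← h1]
  simp [dotProduct, Matrix.mulVec, Fintype.sum_sum_type, Matrix.toBlocks₂₂]

end Gram

/-! ### The population matrix -/

section PopCov

variable {p d : ℕ} {K : Eucl p → ℝ} {φ : Eucl d → Eucl p} {F : Eucl d → ℝ}

lemma inner_fderiv_eq_sum (v : Fin p → ℝ) (u : Eucl d) :
    inner ℝ (WithLp.toLp 2 v : Eucl p) (fderiv ℝ φ 0 u) =
      ∑ i, ((jacobian φ)ᵀ *ᵥ v) i * u i := by
  have h1 : fderiv ℝ φ 0 u = ∑ i, u i • fderiv ℝ φ 0 (EuclideanSpace.single i 1) := by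
    conv_lhs => rw [← (EuclideanSpace.basisFun (Fin d) ℝ).sum_repr u]
    simp [map_sum]
  rw [h1, inner_sum]
  refine Finset.sum_congr rfl fun i _ => ?_
  rw [real_inner_smul_right, inner_toLp_left, mul_comm]
  congr 1
  simp only [Matrix.mulVec, dotProduct, Matrix.transpose_apply, jacobian, Matrix.of_apply]
  exact Finset.sum_congr rfl fun k _ => mul_comm _ _

lemma integrable_kernel_mul_coord (hK : IsKernel K) {A : Eucl d →L[ℝ] Eucl p}
    (hint : Integrable fun u : Eucl d => K (A u) ^ 1 * (1 + ‖u‖ ^ 4)) (i j : Fin d) :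
    Integrable fun u : Eucl d => K (A u) * (u i * u j) := by
  have hKc := hK.continuous
  refine hint.mono' (Continuous.aestronglyMeasurable (by fun_prop))
    (Eventually.of_forall fun u => ?_)
  rw [norm_mul, Real.norm_of_nonneg (hK.nonneg _), pow_one]
  refine mul_le_mul_of_nonneg_left ?_ (hK.nonneg _)
  rw [norm_mul]
  have h1 := PiLp.norm_apply_le u i
  have h2 := PiLp.norm_apply_le u j
  have h3 : ‖u i‖ * ‖u j‖ ≤ ‖u‖ * ‖u‖ := by gcongr
  nlinarith [sq_nonneg (‖u‖ ^ 2 - 1), sq_nonneg ‖u‖]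

/-- In this form the matrix is visibly the limit of the kernel averages of products of linear
functionals, and its diagonal values are integrals of squares. -/
lemma dotProduct_popCov_mulVec (hK : IsKernel K)
    (hint : Integrable fun u : Eucl d => K (fderiv ℝ φ 0 u) ^ 1 * (1 + ‖u‖ ^ 4))
    (v w : Fin p → ℝ) :
    v ⬝ᵥ popCov K φ F *ᵥ w = F 0 * ∫ u, K (fderiv ℝ φ 0 u) *
      (inner ℝ (WithLp.toLp 2 v : Eucl p) (fderiv ℝ φ 0 u) *
        inner ℝ (WithLp.toLp 2 w : Eucl p) (fderiv ℝ φ 0 u)) := by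
  have hi := integrable_kernel_mul_coord hK hint
  simp only [inner_fderiv_eq_sum]
  set a := (jacobian φ)ᵀ *ᵥ v with ha
  set b := (jacobian φ)ᵀ *ᵥ w with hb
  have e1 : ∀ u : Eucl d, K (fderiv ℝ φ 0 u) * ((∑ i, a i * u i) * ∑ j, b j * u j) =
      ∑ i, ∑ j, (a i * b j) * (K (fderiv ℝ φ 0 u) * (u i * u j)) := fun u => by
    rw [Finset.sum_mul_sum, Finset.mul_sum]
    refine Finset.sum_congr rfl fun i _ => ?_
    rw [Finset.mul_sum]
    exact Finset.sum_congr rfl fun j _ => by ring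
  simp only [e1]
  rw [integral_finsetSum _ fun i _ => integrable_finsetSum _ fun j _ => (hi i j).const_mul _]
  rw [popCov, Matrix.smul_mulVec, dotProduct_smul, smul_eq_mul]
  congr 1
  rw [← Matrix.mulVec_mulVec, ← Matrix.mulVec_mulVec, Matrix.dotProduct_mulVec,
    ← Matrix.mulVec_transpose, ← ha, ← hb, dotProduct]
  refine Finset.sum_congr rfl fun i _ => ?_
  rw [integral_finsetSum _ fun j _ => (hi i j).const_mul _, Matrix.mulVec, dotProduct,
    Finset.mul_sum]
  refine Finset.sum_congr rfl fun j _ => ?_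
  rw [integral_const_mul, Matrix.of_apply]
  ring

lemma IsKernel.exists_ne_zero (hK : IsKernel K) [Nontrivial (Eucl p)] :
    ∃ y : Eucl p, y ≠ 0 ∧ K y ≠ 0 := by
  have hopen : IsOpen {y | K y ≠ 0} := isOpen_ne_fun hK.continuous continuous_const
  obtain ⟨y, hy1, hy2⟩ :=
    (dense_compl_singleton (0 : Eucl p)).inter_open_nonempty _ hopen hK.ne_zero
  exact ⟨y, hy2, hy1⟩

/-- The quadratic form of the population matrix is positive off the normal space. -/
lemma inner_eq_zero_of_integral_eq_zero (hK : IsKernel K) {A : Eucl d →L[ℝ] Eucl p}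
    (hA : Function.Injective A)
    (hint : Integrable fun u : Eucl d => K (A u) ^ 1 * (1 + ‖u‖ ^ 4)) {v : Eucl p}
    (h0 : ∫ u, K (A u) * (inner ℝ v (A u) * inner ℝ v (A u)) = 0) (u : Eucl d) :
    inner ℝ v (A u) = 0 := by
  have hKc := hK.continuous
  by_cases hu : u = 0
  · simp [hu]
  have hAu : A u ≠ 0 := fun h => hu (hA (by rw [h, map_zero]))
  have : Nontrivial (Eucl p) := ⟨A u, 0, hAu⟩
  obtain ⟨y, hy0, hKy⟩ := hK.exists_ne_zero
  have hcont : Continuous fun u => K (A u) * (inner ℝ v (A u) * inner ℝ v (A u)) := by fun_prop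
  have hnn : ∀ u, 0 ≤ K (A u) * (inner ℝ v (A u) * inner ℝ v (A u)) := fun u =>
    mul_nonneg (hK.nonneg _) (mul_self_nonneg _)
  have hi : Integrable fun u => K (A u) * (inner ℝ v (A u) * inner ℝ v (A u)) := by
    refine (hint.const_mul (‖v‖ ^ 2 * ‖A‖ ^ 2)).mono' hcont.aestronglyMeasurable
      (Eventually.of_forall fun u => ?_)
    rw [Real.norm_of_nonneg (hnn u), pow_one]
    have h1 : |inner ℝ v (A u)| ≤ ‖v‖ * (‖A‖ * ‖u‖) :=
      (abs_real_inner_le_norm _ _).trans (by gcongr; exact A.le_opNorm u)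
    have h2 : inner ℝ v (A u) * inner ℝ v (A u) ≤ (‖v‖ * (‖A‖ * ‖u‖)) ^ 2 := by
      rw [← pow_two, ← sq_abs]; gcongr
    have h3 : ‖u‖ ^ 2 ≤ 1 + ‖u‖ ^ 4 := by nlinarith [sq_nonneg (‖u‖ ^ 2 - 1), sq_nonneg ‖u‖]
    calc K (A u) * (inner ℝ v (A u) * inner ℝ v (A u))
        ≤ K (A u) * (‖v‖ * (‖A‖ * ‖u‖)) ^ 2 := mul_le_mul_of_nonneg_left h2 (hK.nonneg _)
      _ = ‖v‖ ^ 2 * ‖A‖ ^ 2 * (K (A u) * ‖u‖ ^ 2) := by ring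
      _ ≤ _ := by
        have := hK.nonneg (A u)
        gcongr
  have hae := (integral_eq_zero_iff_of_nonneg hnn hi).1 h0
  have hall := (hcont.ae_eq_iff_eq (μ := (volume : Measure (Eucl d))) continuous_const).1 hae
  -- Rescaling u moves A u to a radius where the kernel is nonzero; homogeneity brings the
  -- conclusion back to u.
  set t := ‖y‖ / ‖A u‖ with ht
  have ht0 : 0 < t := div_pos (norm_pos_iff.2 hy0) (norm_pos_iff.2 hAu)
  have h1 : K (A (t • u)) * (inner ℝ v (A (t • u)) * inner ℝ v (A (t • u))) = 0 :=
    congrFun hall (t • u)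
  have hKt : K (A (t • u)) = K y := hK.radial _ _ (by
    rw [map_smul, norm_smul, Real.norm_of_nonneg ht0.le, ht,
      div_mul_cancel₀ _ (norm_ne_zero_iff.2 hAu)])
  rw [hKt] at h1
  have h3 := mul_self_eq_zero.1 ((mul_eq_zero.1 h1).resolve_left hKy)
  rw [map_smul, real_inner_smul_right] at h3
  exact (mul_eq_zero.1 h3).resolve_left ht0.ne'

lemma popCov_isSymm (hK : IsKernel K)
    (hint : Integrable fun u : Eucl d => K (fderiv ℝ φ 0 u) ^ 1 * (1 + ‖u‖ ^ 4)) :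
    (popCov K φ F)ᵀ = popCov K φ F := by
  ext i j
  have h1 := dotProduct_popCov_mulVec (F := F) hK hint (Pi.single i 1) (Pi.single j 1)
  have h2 := dotProduct_popCov_mulVec (F := F) hK hint (Pi.single j 1) (Pi.single i 1)
  have h3 : ∀ a b, Pi.single a 1 ⬝ᵥ popCov K φ F *ᵥ Pi.single b 1 = popCov K φ F a b :=
    fun a b => by simp
  rw [h3] at h1 h2
  rw [Matrix.transpose_apply, h1, h2]
  congr 2
  ext u
  ring

lemma nullOf_popCov (hK : IsKernel K) (hF : 0 < F 0) (hA : Function.Injective (fderiv ℝ φ 0))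
    (hint : Integrable fun u : Eucl d => K (fderiv ℝ φ 0 u) ^ 1 * (1 + ‖u‖ ^ 4)) :
    nullOf (popCov K φ F) = (LinearMap.range (fderiv ℝ φ 0 : Eucl d →ₗ[ℝ] Eucl p))ᗮ := by
  ext v
  rw [LinearMap.mem_ker, Submodule.mem_orthogonal']
  constructor
  · rintro hv _ ⟨u, rfl⟩
    refine inner_eq_zero_of_integral_eq_zero hK hA hint ?_ u
    have h1 := dotProduct_popCov_mulVec (F := F) hK hint v.ofLp v.ofLp
    have h2 : popCov K φ F *ᵥ v.ofLp = 0 := by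
      have := congrArg WithLp.ofLp hv
      rwa [Matrix.toLpLin_apply] at this
    rw [h2, dotProduct_zero] at h1
    exact (mul_eq_zero.1 h1.symm).resolve_left hF.ne'
  · intro hv
    have h1 : (jacobian φ)ᵀ *ᵥ v.ofLp = 0 := by
      ext i
      have h2 := inner_fderiv_eq_sum (φ := φ) v.ofLp (EuclideanSpace.single i 1)
      have h3 : inner ℝ v (fderiv ℝ φ 0 (EuclideanSpace.single i 1)) = 0 := hv _ ⟨_, rfl⟩
      rw [WithLp.toLp_ofLp, h3] at h2
      simpa using h2.symm
    have h2 : popCov K φ F *ᵥ v.ofLp = 0 := by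
      rw [popCov, Matrix.smul_mulVec, ← Matrix.mulVec_mulVec, h1, Matrix.mulVec_zero, smul_zero]
    rw [Matrix.toLpLin_apply, h2]
    rfl

/-- By symmetry the range is the orthogonal complement of the null space, already identified as the
normal space. -/
lemma rangeOf_popCov (hK : IsKernel K) (hF : 0 < F 0) (hA : Function.Injective (fderiv ℝ φ 0))
    (hint : Integrable fun u : Eucl d => K (fderiv ℝ φ 0 u) ^ 1 * (1 + ‖u‖ ^ 4)) :
    rangeOf (popCov K φ F) = LinearMap.range (fderiv ℝ φ 0 : Eucl d →ₗ[ℝ] Eucl p) := by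
  have hsymm : (Matrix.toEuclideanLin (popCov K φ F)).IsSymmetric := by
    rw [Matrix.isSymmetric_toEuclideanLin_iff, Matrix.IsHermitian,
      Matrix.conjTranspose_eq_transpose_of_trivial]
    exact popCov_isSymm hK hint
  have h1 : (rangeOf (popCov K φ F))ᗮ = nullOf (popCov K φ F) := hsymm.orthogonal_range
  have h2 := nullOf_popCov (F := F) hK hF hA hint
  rw [← Submodule.orthogonal_orthogonal (rangeOf (popCov K φ F)), h1, h2,
    Submodule.orthogonal_orthogonal]

lemma rank_popCov (hK : IsKernel K) (hF : 0 < F 0) (hA : Function.Injective (fderiv ℝ φ 0))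
    (hint : Integrable fun u : Eucl d => K (fderiv ℝ φ 0 u) ^ 1 * (1 + ‖u‖ ^ 4)) :
    (popCov K φ F).rank = d := by
  rw [Matrix.rank_eq_finrank_range_toLin _ (EuclideanSpace.basisFun (Fin p) ℝ).toBasis
    (EuclideanSpace.basisFun (Fin p) ℝ).toBasis, ← Matrix.toEuclideanLin_eq_toLin_orthonormal]
  change Module.finrank ℝ (rangeOf (popCov K φ F)) = d
  rw [rangeOf_popCov hK hF hA hint, LinearMap.finrank_range_of_inj hA, finrank_euclideanSpace_fin]

/-- The eigenvalues of the population matrix: the first `d` are positive, the others vanish. -/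
lemma popCov_eigenvalues (hK : IsKernel K) (hF : 0 < F 0)
    (hA : Function.Injective (fderiv ℝ φ 0))
    (hint : Integrable fun u : Eucl d => K (fderiv ℝ φ 0 u) ^ 1 * (1 + ‖u‖ ^ 4))
    {U : Matrix (Fin p) (Fin p) ℝ} {ev : Fin p → ℝ} (hU : U * Uᵀ = 1) (hU' : Uᵀ * U = 1)
    (hev : Antitone ev) (hC : popCov K φ F = U * Matrix.diagonal ev * Uᵀ) :
    (∀ j : Fin p, (j : ℕ) < d → 0 < ev j) ∧ ∀ j : Fin p, d ≤ (j : ℕ) → ev j = 0 := by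
  have hdet : IsUnit U.det := by
    have : IsUnit U := ⟨⟨U, Uᵀ, hU, hU'⟩, rfl⟩
    exact (Matrix.isUnit_iff_isUnit_det _).1 this
  have hdet' : IsUnit (Uᵀ).det := by rwa [Matrix.det_transpose]
  have hcard : Fintype.card {i // ev i ≠ 0} = d := by
    rw [← Matrix.rank_diagonal, ← rank_popCov (F := F) hK hF hA hint, hC,
      Matrix.rank_mul_eq_left_of_isUnit_det _ _ hdet',
      Matrix.rank_mul_eq_right_of_isUnit_det _ _ hdet]
  have hcard' : (Finset.univ.filter fun i => ev i ≠ 0).card = d := by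
    rw [← hcard, Fintype.card_subtype]
  have hnn : ∀ j, 0 ≤ ev j := fun j => by
    have h1 := dotProduct_popCov_mulVec (F := F) hK hint (fun i => U i j) (fun i => U i j)
    rw [hC, conj_diagonal_mulVec_col hU', dotProduct_smul, smul_eq_mul] at h1
    have h2 : (fun i => U i j) ⬝ᵥ (fun i => U i j) = 1 := by
      have := congrFun (congrFun hU' j) j
      simpa [Matrix.mul_apply, dotProduct] using this
    rw [h2, mul_one] at h1
    rw [h1]
    exact mul_nonneg hF.le (integral_nonneg fun u => mul_nonneg (hK.nonneg _) (mul_self_nonneg _))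
  -- Exactly d eigenvalues are nonzero. By monotonicity a nonzero one at j makes all j + 1
  -- eigenvalues up to it nonzero, so j + 1 ≤ d.
  have hpos : ∀ j, ev j ≠ 0 → (j : ℕ) < d := fun j hj => by
    have hsub : Finset.Iic j ⊆ Finset.univ.filter fun i => ev i ≠ 0 := fun i hi => by
      rw [Finset.mem_filter]
      exact ⟨Finset.mem_univ _, (lt_of_lt_of_le (lt_of_le_of_ne (hnn j) (Ne.symm hj))
        (hev (Finset.mem_Iic.1 hi))).ne'⟩
    have := Finset.card_le_card hsub
    rw [hcard', Fin.card_Iic] at this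
    omega
  refine ⟨fun j hj => lt_of_le_of_ne (hnn j) fun h0 => ?_, fun j hj => ?_⟩
  · have hsub : (Finset.univ.filter fun i => ev i ≠ 0) ⊆ Finset.Iio j := fun i hi => by
      rw [Finset.mem_filter] at hi
      rw [Finset.mem_Iio]
      by_contra hcon
      have h1 := hev (not_lt.1 hcon)
      rw [← h0] at h1
      exact hi.2 (le_antisymm h1 (hnn i))
    have := Finset.card_le_card hsub
    rw [hcard', Fin.card_Iio] at this
    omega
  · by_contra h0
    exact absurd (hpos j h0) (not_lt.2 hj)

end PopCov

/-! ### Range and null space of the limiting projection -/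

section Projection

variable {p d : ℕ} {A Q U : Matrix (Fin p) (Fin p) ℝ} {ev : Fin p → ℝ}

lemma toEuclideanLin_mul_apply (B C : Matrix (Fin p) (Fin p) ℝ) (x : Eucl p) :
    Matrix.toEuclideanLin (B * C) x = Matrix.toEuclideanLin B (Matrix.toEuclideanLin C x) := by
  simp [Matrix.toLpLin_apply, Matrix.mulVec_mulVec]

theorem range_null_of_spectral (hU : U * Uᵀ = 1) (hU' : Uᵀ * U = 1)
    (hA : A = U * Matrix.diagonal ev * Uᵀ) (hQ : Q = U * tailProj p d * Uᵀ)
    (hpos : ∀ j : Fin p, (j : ℕ) < d → 0 < ev j) (hzero : ∀ j : Fin p, d ≤ (j : ℕ) → ev j = 0) :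
    rangeOf Q = nullOf A ∧ nullOf Q = rangeOf A ∧ nullOf Q ⊓ nullOf A = ⊥ := by
  -- Since 0⁻¹ = 0, this yields the Moore-Penrose inverse R of A. Then A R + Q = R A + Q = 1 and A Q
  -- = Q A = 0 give all the claims.
  set D' : Matrix (Fin p) (Fin p) ℝ := Matrix.diagonal fun j => (ev j)⁻¹ with hD'
  have hconj : ∀ D E : Matrix (Fin p) (Fin p) ℝ, (U * D * Uᵀ) * (U * E * Uᵀ) = U * (D * E) * Uᵀ :=
    fun D E => by
      calc (U * D * Uᵀ) * (U * E * Uᵀ) = U * D * (Uᵀ * U) * E * Uᵀ := by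
            simp only [Matrix.mul_assoc]
        _ = _ := by rw [hU']; simp only [Matrix.mul_one, Matrix.mul_assoc]
  have hAQ : A * Q = 0 := by
    rw [hA, hQ, hconj, tailProj, Matrix.diagonal_mul_diagonal]
    have : (fun i : Fin p => ev i * if d ≤ (i : ℕ) then (1 : ℝ) else 0) = 0 := by
      ext i
      by_cases hi : d ≤ (i : ℕ) <;> simp [hi, hzero]
    rw [this]
    simp
  have hQA : Q * A = 0 := by
    rw [hA, hQ, hconj, tailProj, Matrix.diagonal_mul_diagonal]
    have : (fun i : Fin p => (if d ≤ (i : ℕ) then (1 : ℝ) else 0) * ev i) = 0 := by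
      ext i
      by_cases hi : d ≤ (i : ℕ) <;> simp [hi, hzero]
    rw [this]
    simp
  have hdiag : Matrix.diagonal ev * D' + tailProj p d = 1 ∧
      D' * Matrix.diagonal ev + tailProj p d = 1 := by
    rw [hD', tailProj, Matrix.diagonal_mul_diagonal, Matrix.diagonal_mul_diagonal,
      Matrix.diagonal_add, Matrix.diagonal_add, ← Matrix.diagonal_one]
    constructor <;>
    · congr 1
      ext i
      by_cases hi : d ≤ (i : ℕ)
      · simp [hi, hzero i hi]
      · have := (hpos i (not_le.1 hi)).ne'
        simp [hi, this]
  have hsum : ∀ D : Matrix (Fin p) (Fin p) ℝ, D + tailProj p d = 1 → U * D * Uᵀ + Q = 1 :=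
    fun D hD => by rw [hQ, ← Matrix.add_mul, ← Matrix.mul_add, hD, Matrix.mul_one, hU]
  set R := U * D' * Uᵀ with hR
  have hARQ : A * R + Q = 1 := by rw [hA, hR, hconj]; exact hsum _ hdiag.1
  have hRAQ : R * A + Q = 1 := by rw [hA, hR, hconj]; exact hsum _ hdiag.2
  have happ : ∀ {B : Matrix (Fin p) (Fin p) ℝ}, B + Q = 1 → ∀ x : Eucl p,
      Matrix.toEuclideanLin B x + Matrix.toEuclideanLin Q x = x := fun {B} hB x => by
    rw [← LinearMap.add_apply, ← map_add, hB]
    simp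
  have hfix : ∀ x ∈ nullOf A, Matrix.toEuclideanLin Q x = x := fun x hx => by
    have h1 := happ hRAQ x
    rw [toEuclideanLin_mul_apply, LinearMap.mem_ker.1 hx, map_zero, zero_add] at h1
    exact h1
  refine ⟨le_antisymm ?_ fun x hx => ⟨x, hfix x hx⟩, le_antisymm (fun x hx => ?_) ?_, ?_⟩
  · rintro _ ⟨x, rfl⟩
    rw [LinearMap.mem_ker, ← toEuclideanLin_mul_apply, hAQ]
    simp
  · have h1 := happ hARQ x
    rw [toEuclideanLin_mul_apply, LinearMap.mem_ker.1 hx, add_zero] at h1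
    exact ⟨_, h1⟩
  · rintro _ ⟨x, rfl⟩
    rw [LinearMap.mem_ker, ← toEuclideanLin_mul_apply, hQA]
    simp
  · rw [eq_bot_iff]
    rintro x ⟨hx1, hx2⟩
    have h1 := hfix x hx2
    rw [LinearMap.mem_ker.1 hx1] at h1
    exact h1.symm

end Projection

/-! ### Deterministic bounds for the sample matrices -/

section Deterministic

variable {p d : ℕ} {U : Matrix (Fin p) (Fin p) ℝ} {ev : Fin p → ℝ} {c₀ : ℝ}

lemma transpose_mul_mul_apply (U B : Matrix (Fin p) (Fin p) ℝ) (i j : Fin p) :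
    (Uᵀ * B * U) i j = (fun k => U k i) ⬝ᵥ B *ᵥ fun k => U k j := by
  rw [Matrix.mul_assoc, Matrix.mul_apply]
  rfl

/-- A version of the Davis–Kahan theorem: the projection onto the last `p - d` eigenvectors is
perturbed by at most a multiple of the off-diagonal block of the perturbation. -/
theorem exists_norm_projection_sub_le (hU : U * Uᵀ = 1) (hU' : Uᵀ * U = 1) (hc₀ : 0 < c₀)
    (hev0 : ∀ i : Fin p, d ≤ (i : ℕ) → ev i = 0) (hev1 : ∀ i : Fin p, (i : ℕ) < d → c₀ ≤ ev i) :
    ∃ c : ℝ, 0 ≤ c ∧ ∀ (η τ : ℝ) (B Q : Matrix (Fin p) (Fin p) ℝ), IsNormalProjection d B Q →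
      4 * (p * η) ≤ c₀ → 0 ≤ τ → (∀ i j, |(Uᵀ * B * U - Matrix.diagonal ev) i j| ≤ η) →
      (∀ i j : Fin p, (i : ℕ) < d → d ≤ (j : ℕ) → |(Uᵀ * B * U) i j| ≤ τ) →
      ‖Q - U * tailProj p d * Uᵀ‖ ≤ c * τ := by
  obtain ⟨c, hc, hnorm⟩ := exists_norm_le_of_entries p
  refine ⟨‖U‖ * (c * (p * (p ^ 2 / (c₀ / 2)))) * ‖Uᵀ‖, by positivity,
    fun η τ B Q hQ hsmall hτ0 hη hτ => ?_⟩
  obtain ⟨W, l, hW, hW', hl, rfl, rfl⟩ := hQ.exists_eq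
  -- In the eigenbasis of the limit the eigenvectors of B are the columns of V, and the limit is
  -- diagonal.
  set V := Uᵀ * W with hV
  have hVT : Vᵀ = Wᵀ * U := by rw [hV, Matrix.transpose_mul, Matrix.transpose_transpose]
  have hVV : V * Vᵀ = 1 := by
    calc V * Vᵀ = Uᵀ * (W * Wᵀ) * U := by rw [hVT, hV]; simp only [Matrix.mul_assoc]
      _ = 1 := by rw [hW, Matrix.mul_one, hU']
  have hVV' : Vᵀ * V = 1 := by
    calc Vᵀ * V = Wᵀ * (U * Uᵀ) * W := by rw [hVT, hV]; simp only [Matrix.mul_assoc]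
      _ = 1 := by rw [hU, Matrix.mul_one, hW']
  have hconj : Uᵀ * (W * Matrix.diagonal l * Wᵀ) * U = V * Matrix.diagonal l * Vᵀ := by
    rw [hVT, hV]; simp only [Matrix.mul_assoc]
  rw [hconj] at hη
  simp only [hconj] at hτ
  have hent := abs_conj_tailProj_sub_le hVV (d := d) (θ := p ^ 2 * τ / (c₀ / 2))
    (fun i j hij => abs_entry_le_of_near hVV hVV' hl hc₀ hη hev0 hev1 hsmall hτ0 hτ i j hij)
    (by positivity)
  have hN := hnorm _ _ hent
  have hUV : U * V = W := by rw [hV, ← Matrix.mul_assoc, hU, Matrix.one_mul]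
  have hVU : Vᵀ * Uᵀ = Wᵀ := by rw [← Matrix.transpose_mul, hUV]
  have hdiff : W * tailProj p d * Wᵀ - U * tailProj p d * Uᵀ =
      U * (V * tailProj p d * Vᵀ - tailProj p d) * Uᵀ := by
    rw [Matrix.mul_sub, Matrix.sub_mul, ← hVU, ← hUV]
    simp only [Matrix.mul_assoc]
  rw [hdiff]
  calc ‖U * (V * tailProj p d * Vᵀ - tailProj p d) * Uᵀ‖
      ≤ ‖U‖ * ‖V * tailProj p d * Vᵀ - tailProj p d‖ * ‖Uᵀ‖ :=
        (Matrix.l2_opNorm_mul _ _).trans (by gcongr; exact Matrix.l2_opNorm_mul _ _)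
    _ ≤ ‖U‖ * (c * (p * (p ^ 2 * τ / (c₀ / 2)))) * ‖Uᵀ‖ := by gcongr
    _ = _ := by ring

lemma dotProduct_mulVec_sum (C : Matrix (Unit ⊕ Fin p) (Unit ⊕ Fin p) ℝ) (x : Unit ⊕ Fin p → ℝ) :
    x ⬝ᵥ C *ᵥ x = C (Sum.inl ()) (Sum.inl ()) * x (Sum.inl ()) ^ 2 +
      ∑ k, (C (Sum.inl ()) (Sum.inr k) + C (Sum.inr k) (Sum.inl ())) *
        (x (Sum.inl ()) * x (Sum.inr k)) +
      (fun k => x (Sum.inr k)) ⬝ᵥ C.toBlocks₂₂ *ᵥ fun k => x (Sum.inr k) := by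
  simp only [dotProduct, Matrix.mulVec, Fintype.sum_sum_type, Finset.univ_unique,
    Finset.sum_singleton,
    Matrix.toBlocks₂₂, Matrix.of_apply, mul_add, add_mul, Finset.sum_add_distrib, Finset.mul_sum,
    PUnit.default_eq_unit]
  have h1 : ∀ k, x (Sum.inl ()) * (C (Sum.inl ()) (Sum.inr k) * x (Sum.inr k)) =
      C (Sum.inl ()) (Sum.inr k) * (x (Sum.inl ()) * x (Sum.inr k)) := fun k => by ring
  have h2 : ∀ k, x (Sum.inr k) * (C (Sum.inr k) (Sum.inl ()) * x (Sum.inl ())) =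
      C (Sum.inr k) (Sum.inl ()) * (x (Sum.inl ()) * x (Sum.inr k)) := fun k => by ring
  simp only [h1, h2]
  ring

lemma dotProduct_augment_mulVec (Q : Matrix (Fin p) (Fin p) ℝ) (x : Unit ⊕ Fin p → ℝ) :
    x ⬝ᵥ augment Q *ᵥ x = (fun k => x (Sum.inr k)) ⬝ᵥ Q *ᵥ fun k => x (Sum.inr k) := by
  rw [dotProduct_mulVec_sum]
  simp [augment]

/-- A null vector (α, x₁) is null for both nonnegative forms, so x₁ lies in the span of the leading
d eigenvectors of the spatial block, where the form is at least (c₀ - pη)‖x₁‖². Cross terms cost at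
most η(pα² + ‖x₁‖²). Hence (c₁ - (p+1)η)α² + (c₀ - (p+1)η)‖x₁‖² ≤ 0 with positive coefficients. -/
theorem rank_add_smul_augment (hU' : Uᵀ * U = 1)
    (hev1 : ∀ i : Fin p, (i : ℕ) < d → c₀ ≤ ev i)
    {C : Matrix (Unit ⊕ Fin p) (Unit ⊕ Fin p) ℝ} {Q : Matrix (Fin p) (Fin p) ℝ} {η c₁ s : ℝ}
    (hC : ∀ v, 0 ≤ v ⬝ᵥ C *ᵥ v) (hQ : IsNormalProjection d C.toBlocks₂₂ Q)
    (hη : ∀ i j, |(Uᵀ * C.toBlocks₂₂ * U - Matrix.diagonal ev) i j| ≤ η)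
    (h11 : c₁ - η ≤ C (Sum.inl ()) (Sum.inl ()))
    (h12 : ∀ k, |C (Sum.inl ()) (Sum.inr k)| ≤ η) (h21 : ∀ k, |C (Sum.inr k) (Sum.inl ())| ≤ η)
    (hη1 : (p + 1) * η < c₁) (hη0 : (p + 1) * η < c₀) (hs : 0 < s) :
    (C + s • augment Q).rank = p + 1 := by
  obtain ⟨W, l, hW, hW', hl, hB, rfl⟩ := hQ.exists_eq
  suffices hdet : (C + s • augment (W * tailProj p d * Wᵀ)).det ≠ 0 by
    rw [Matrix.rank_of_isUnit _ ((Matrix.isUnit_iff_isUnit_det _).2 hdet.isUnit)]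
    simp [add_comm]
  intro hdet
  obtain ⟨x, hx0, hx⟩ := Matrix.exists_mulVec_eq_zero_iff.2 hdet
  set x₁ : Fin p → ℝ := fun k => x (Sum.inr k) with hx₁
  set α := x (Sum.inl ()) with hα
  set y := Wᵀ *ᵥ x₁ with hy
  have hquad : x ⬝ᵥ C *ᵥ x + s * ∑ k : Fin p, (if d ≤ (k : ℕ) then 1 else 0) * y k ^ 2 = 0 := by
    have h1 : x ⬝ᵥ (C + s • augment (W * tailProj p d * Wᵀ)) *ᵥ x = 0 := by
      rw [hx, dotProduct_zero]
    rwa [Matrix.add_mulVec, dotProduct_add, Matrix.smul_mulVec, dotProduct_smul, smul_eq_mul,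
      dotProduct_augment_mulVec, tailProj, dotProduct_conj_diagonal_mulVec] at h1
  have hterm : ∀ k ∈ (Finset.univ : Finset (Fin p)),
      0 ≤ (if d ≤ (k : ℕ) then (1 : ℝ) else 0) * y k ^ 2 :=
    fun k _ => mul_nonneg (by split_ifs <;> norm_num) (sq_nonneg _)
  have hsum0 := Finset.sum_nonneg hterm
  have hxC := hC x
  have hxC0 : x ⬝ᵥ C *ᵥ x = 0 := by nlinarith [mul_nonneg hs.le hsum0]
  have hy0 : ∀ k : Fin p, d ≤ (k : ℕ) → y k = 0 := fun k hk => by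
    have h1 : ∑ k : Fin p, (if d ≤ (k : ℕ) then (1 : ℝ) else 0) * y k ^ 2 = 0 := by
      rw [hxC0, zero_add] at hquad
      exact (mul_eq_zero.1 hquad).resolve_left hs.ne'
    have h2 := (Finset.sum_eq_zero_iff_of_nonneg hterm).1 h1 k (Finset.mem_univ _)
    rw [if_pos hk, one_mul] at h2
    exact pow_eq_zero_iff (two_ne_zero) |>.1 h2
  have hlow : (c₀ - p * η) * ∑ k, x₁ k ^ 2 ≤ x₁ ⬝ᵥ C.toBlocks₂₂ *ᵥ x₁ := by
    have hconj : Uᵀ * C.toBlocks₂₂ * U = (Uᵀ * W) * Matrix.diagonal l * (Uᵀ * W)ᵀ := by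
      rw [hB, Matrix.transpose_mul, Matrix.transpose_transpose]; simp only [Matrix.mul_assoc]
    have hVV : (Uᵀ * W) * (Uᵀ * W)ᵀ = 1 := by
      calc (Uᵀ * W) * (Uᵀ * W)ᵀ = Uᵀ * (W * Wᵀ) * U := by
            rw [Matrix.transpose_mul, Matrix.transpose_transpose]; simp only [Matrix.mul_assoc]
        _ = 1 := by rw [hW, Matrix.mul_one, hU']
    rw [hconj] at hη
    rw [hB, dotProduct_conj_diagonal_mulVec, ← sum_sq_transpose_mulVec hW x₁, Finset.mul_sum]
    refine Finset.sum_le_sum fun k _ => ?_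
    by_cases hk : d ≤ (k : ℕ)
    · have := hy0 k hk
      rw [hy] at this
      rw [this]; simp
    · exact mul_le_mul_of_nonneg_right (le_eigenvalue_of_near hVV hl hη hev1 (not_le.1 hk))
        (sq_nonneg _)
  have hcross : ∑ k, -(η * (α ^ 2 + x₁ k ^ 2)) ≤
      ∑ k, (C (Sum.inl ()) (Sum.inr k) + C (Sum.inr k) (Sum.inl ())) * (α * x₁ k) :=
    Finset.sum_le_sum fun k _ => by
      have h1 : |(C (Sum.inl ()) (Sum.inr k) + C (Sum.inr k) (Sum.inl ())) * (α * x₁ k)| ≤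
          (η + η) * ((α ^ 2 + x₁ k ^ 2) / 2) := by
        rw [abs_mul]
        refine mul_le_mul ((abs_add_le _ _).trans (add_le_add (h12 k) (h21 k))) ?_ (abs_nonneg _)
          (by linarith [(abs_nonneg _).trans (h12 k)])
        rw [abs_le]
        constructor <;> nlinarith [sq_nonneg (α + x₁ k), sq_nonneg (α - x₁ k)]
      have := neg_le_of_abs_le h1
      linarith
  rw [Finset.sum_neg_distrib, ← Finset.mul_sum, Finset.sum_add_distrib, Finset.sum_const,
    Finset.card_univ, Fintype.card_fin, nsmul_eq_mul] at hcross
  rw [dotProduct_mulVec_sum] at hxC0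
  have h11' : (c₁ - η) * α ^ 2 ≤ C (Sum.inl ()) (Sum.inl ()) * α ^ 2 :=
    mul_le_mul_of_nonneg_right h11 (sq_nonneg _)
  have htot : (c₁ - (p + 1) * η) * α ^ 2 + (c₀ - (p + 1) * η) * ∑ k, x₁ k ^ 2 ≤ 0 := by
    linarith
  have hS : 0 ≤ ∑ k, x₁ k ^ 2 := Finset.sum_nonneg fun _ _ => sq_nonneg _
  have e1 : 0 ≤ (c₁ - (p + 1) * η) * α ^ 2 := mul_nonneg (by linarith) (sq_nonneg _)
  have e2 : 0 ≤ (c₀ - (p + 1) * η) * ∑ k, x₁ k ^ 2 := mul_nonneg (by linarith) hS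
  have f1 : α = 0 := by
    have : (c₁ - (p + 1) * η) * α ^ 2 = 0 := by linarith
    exact pow_eq_zero_iff two_ne_zero |>.1 ((mul_eq_zero.1 this).resolve_left (by linarith))
  have f2 : x₁ = 0 := by
    by_contra hne
    have := sum_sq_pos hne
    have h3 : (c₀ - (p + 1) * η) * ∑ k, x₁ k ^ 2 = 0 := by linarith
    exact absurd ((mul_eq_zero.1 h3).resolve_left (by linarith)) this.ne'
  refine hx0 (funext fun a => ?_)
  rcases a with a | a
  · exact f1
  · exact congrFun f2 a

end Deterministic

/-! ### Union bounds and limits of probabilities -/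

section Probability

variable {Ω : Type*} [MeasurableSpace Ω] {P : Measure Ω}

/-- A union bound; the extra 1 in the denominator avoids dividing by zero for an empty index type.
-/
lemma eventually_measure_not_forall_le {ι : Type*} [Fintype ι] {G : ι → ℕ → Ω → Prop} {δ : ℝ}
    (h : ∀ i, ∀ᶠ n in atTop, P {ω | ¬ G i n ω} ≤ ENNReal.ofReal (δ / (Fintype.card ι + 1)))
    (hδ : 0 ≤ δ) :
    ∀ᶠ n in atTop, P {ω | ¬ ∀ i, G i n ω} ≤ ENNReal.ofReal δ := by
  filter_upwards [eventually_all.2 h] with n hn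
  have hsub : {ω | ¬ ∀ i, G i n ω} = ⋃ i, {ω | ¬ G i n ω} := by
    ext ω; simp
  have hcard : (0 : ℝ) ≤ Fintype.card ι := Nat.cast_nonneg _
  rw [hsub]
  calc P (⋃ i, {ω | ¬ G i n ω}) ≤ ∑ i, P {ω | ¬ G i n ω} := measure_iUnion_fintype_le _ _
    _ ≤ ∑ _i : ι, ENNReal.ofReal (δ / (Fintype.card ι + 1)) := Finset.sum_le_sum fun i _ => hn i
    _ = ENNReal.ofReal (Fintype.card ι * (δ / (Fintype.card ι + 1))) := by
        rw [Finset.sum_const, Finset.card_univ, nsmul_eq_mul, ENNReal.ofReal_mul hcard,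
          ENNReal.ofReal_natCast]
    _ ≤ ENNReal.ofReal δ := by
        refine ENNReal.ofReal_le_ofReal ?_
        rw [mul_div_assoc', div_le_iff₀ (by positivity)]
        nlinarith

lemma eventually_measure_not_and_le {G H : ℕ → Ω → Prop} {δ : ℝ} (hδ : 0 < δ)
    (hG : ∀ᶠ n in atTop, P {ω | ¬ G n ω} ≤ ENNReal.ofReal (δ / 2))
    (hH : ∀ᶠ n in atTop, P {ω | ¬ H n ω} ≤ ENNReal.ofReal (δ / 2)) :
    ∀ᶠ n in atTop, P {ω | ¬ (G n ω ∧ H n ω)} ≤ ENNReal.ofReal δ := by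
  filter_upwards [hG, hH] with n h1 h2
  have hsub : {ω | ¬ (G n ω ∧ H n ω)} = {ω | ¬ G n ω} ∪ {ω | ¬ H n ω} := by
    ext ω; exact not_and_or
  rw [hsub]
  calc _ ≤ P {ω | ¬ G n ω} + P {ω | ¬ H n ω} := measure_union_le _ _
    _ ≤ ENNReal.ofReal (δ / 2) + ENNReal.ofReal (δ / 2) := add_le_add h1 h2
    _ = _ := by rw [← ENNReal.ofReal_add (by positivity) (by positivity), add_halves]

lemma tendsto_measure_zero_of_eventually_le {E : ℕ → Set Ω}
    (h : ∀ δ : ℝ, 0 < δ → ∀ᶠ n in atTop, P (E n) ≤ ENNReal.ofReal δ) :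
    Tendsto (fun n => P (E n)) atTop (𝓝 0) := by
  rw [ENNReal.tendsto_nhds_zero]
  intro e he
  by_cases htop : e = ⊤
  · simp [htop]
  filter_upwards [h e.toReal (ENNReal.toReal_pos he.ne' htop)] with n hn
  rwa [ENNReal.ofReal_toReal htop] at hn

/-- The estimated projection is an arbitrary choice, so the events may fail to be measurable.
Subadditivity, 1 ≤ P(G) + P(not G), is enough. -/
lemma tendsto_measure_one_of_compl [IsProbabilityMeasure P] {G : ℕ → Ω → Prop}
    (h : Tendsto (fun n => P {ω | ¬ G n ω}) atTop (𝓝 0)) :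
    Tendsto (fun n => P {ω | G n ω}) atTop (𝓝 1) := by
  have h1 : Tendsto (fun n => 1 - P {ω | ¬ G n ω}) atTop (𝓝 1) := by
    have := ENNReal.Tendsto.sub (tendsto_const_nhds (x := (1 : ENNReal)) (f := atTop (α := ℕ))) h
      (Or.inl ENNReal.one_ne_top)
    simpa using this
  refine tendsto_of_tendsto_of_tendsto_of_le_of_le h1 tendsto_const_nhds (fun n => ?_)
    fun n => prob_le_one
  rw [tsub_le_iff_right, ← measure_univ (μ := P)]
  refine (measure_mono fun ω _ => ?_).trans (measure_union_le _ _)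
  exact em (G n ω)

end Probability

/-! ### Convergence of the Gram matrix -/

section Consistency

variable {Ω : Type*} [MeasurableSpace Ω] {P : Measure Ω} [IsProbabilityMeasure P] {d p : ℕ}
  {X : ℕ → Ω → Eucl p} {x₀ : Eucl p} {φ : Eucl d → Eucl p} {F : Eucl d → ℝ}
  {Φ : Eucl d → Eucl p} {G : Eucl d → ℝ} {ρ C : ℝ} {K : Eucl p → ℝ} {m κ M ε : ℝ}

lemma abs_augCoord_le (y : Eucl p) (a : Unit ⊕ Fin p) : |augCoord y a| ≤ 1 + ‖y‖ := by
  rcases a with a | a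
  · simp [augCoord]
  · have := PiLp.norm_apply_le y a
    rw [Real.norm_eq_abs] at this
    simp only [augCoord, Sum.elim_inr]
    linarith

lemma continuous_augCoord (a : Unit ⊕ Fin p) : Continuous fun y : Eucl p => augCoord y a := by
  rcases a with a | a <;> simp only [augCoord, Sum.elim_inl, Sum.elim_inr] <;> fun_prop

/-- The limit of the augmented Gram matrix. -/
noncomputable def popGram (K : Eucl p → ℝ) (A : Eucl d →L[ℝ] Eucl p) (F₀ : ℝ) :
    Matrix (Unit ⊕ Fin p) (Unit ⊕ Fin p) ℝ :=
  Matrix.of fun a b => F₀ * ∫ u, K (A u) * (augCoord (A u) a * augCoord (A u) b)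

theorem gram_consistent {A : Eucl d →L[ℝ] Eucl p} {F₀ : ℝ}
    (hXmeas : ∀ i, Measurable (X i)) (hXindep : iIndepFun X P)
    (hXident : ∀ i, IdentDistrib (X i) (X 0) P P)
    (hc : IsRadialChart (P.map (X 0)) x₀ A F₀ Φ G ρ C) (hF₀ : 0 < F₀)
    (hm : 0 < m) (hA : ∀ u, m * ‖u‖ ≤ ‖A u‖) (hK : IsKernel K) (hκ : 0 < κ)
    (hM : 0 < M) (hε0 : 0 < ε) (hε1 : ε < 1)
    (htail : TailCondition K (P.map (X 0)) x₀ d (bandwidth κ d) ε M)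
    {η δ : ℝ} (hη : 0 < η) (hδ : 0 < δ) :
    ∀ᶠ n in atTop, P {ω | ¬ ∀ ab : (Unit ⊕ Fin p) × (Unit ⊕ Fin p),
      |gram K d (bandwidth κ d n) x₀ (fun i : Fin n => X i ω) ab.1 ab.2 -
        popGram K A F₀ ab.1 ab.2| ≤ η} ≤ ENNReal.ofReal δ := by
  refine eventually_measure_not_forall_le (fun ab => ?_) hδ.le
  filter_upwards [kernelAverage_consistent hXmeas hXindep hXident hc hF₀ hm hA hK hκ hM hε0 hε1
    htail (f := fun y => augCoord y ab.1 * augCoord y ab.2)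
    ((continuous_augCoord _).mul (continuous_augCoord _)) (Cf := 2) (fun y => by
      rw [abs_mul]
      have h1 := mul_le_mul (abs_augCoord_le y ab.1) (abs_augCoord_le y ab.2) (abs_nonneg _)
        (by positivity)
      nlinarith [sq_nonneg (‖y‖ - 1)]) hη
    (δ := δ / (Fintype.card ((Unit ⊕ Fin p) × (Unit ⊕ Fin p)) + 1)) (by positivity),
    eventually_bandwidth_pos hκ, eventually_gt_atTop 0] with n hn hh hn0
  refine (measure_mono fun ω hω => ?_).trans hn
  rw [Set.mem_ofPred_eq, not_le, gram_apply hn0 hh (fun i => X i ω)] at hω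
  exact hω

theorem toBlocks₂₂_gram_consistent
    (hXmeas : ∀ i, Measurable (X i)) (hXindep : iIndepFun X P)
    (hXident : ∀ i, IdentDistrib (X i) (X 0) P P)
    (hc : IsRadialChart (P.map (X 0)) x₀ (fderiv ℝ φ 0) (F 0) Φ G ρ C) (hF₀ : 0 < F 0)
    (hm : 0 < m) (hA : ∀ u, m * ‖u‖ ≤ ‖fderiv ℝ φ 0 u‖) (hK : IsKernel K) (hκ : 0 < κ)
    (hM : 0 < M) (hε0 : 0 < ε) (hε1 : ε < 1)
    (htail : TailCondition K (P.map (X 0)) x₀ d (bandwidth κ d) ε M)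
    {U : Matrix (Fin p) (Fin p) ℝ} {ev : Fin p → ℝ} (hU' : Uᵀ * U = 1)
    (hC : popCov K φ F = U * Matrix.diagonal ev * Uᵀ)
    {η δ : ℝ} (hη : 0 < η) (hδ : 0 < δ) :
    ∀ᶠ n in atTop, P {ω | ¬ ∀ ij : Fin p × Fin p,
      |(Uᵀ * (gram K d (bandwidth κ d n) x₀ (fun i : Fin n => X i ω)).toBlocks₂₂ * U -
        Matrix.diagonal ev) ij.1 ij.2| ≤ η} ≤ ENNReal.ofReal δ := by
  have hint := integrable_kernel_pow_mul hc hF₀ hm hA hK hκ hM hε0 hε1 htail (γ := 1) (Or.inl rfl)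
  -- In rotated coordinates both matrices have entries given by the columns of U as linear
  -- functionals, so consistency applies entrywise.
  have hlim : Matrix.diagonal ev = Uᵀ * popCov K φ F * U := by
    calc Matrix.diagonal ev = (Uᵀ * U) * Matrix.diagonal ev * (Uᵀ * U) := by
          rw [hU', Matrix.mul_one, Matrix.one_mul]
      _ = _ := by rw [hC]; simp only [Matrix.mul_assoc]
  refine eventually_measure_not_forall_le (fun ij => ?_) hδ.le
  set a : Eucl p := WithLp.toLp 2 fun k => U k ij.1 with ha
  set b : Eucl p := WithLp.toLp 2 fun k => U k ij.2 with hb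
  filter_upwards [kernelAverage_consistent hXmeas hXindep hXident hc hF₀ hm hA hK hκ hM hε0 hε1
    htail (f := fun y => inner ℝ a y * inner ℝ b y) (by fun_prop) (Cf := ‖a‖ * ‖b‖) (fun y => by
      rw [abs_mul]
      calc |inner ℝ a y| * |inner ℝ b y| ≤ (‖a‖ * ‖y‖) * (‖b‖ * ‖y‖) := by
            gcongr <;> exact abs_real_inner_le_norm _ _
        _ = ‖a‖ * ‖b‖ * ‖y‖ ^ 2 := by ring
        _ ≤ _ := by gcongr; linarith) hη
    (δ := δ / (Fintype.card (Fin p × Fin p) + 1)) (by positivity),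
    eventually_bandwidth_pos hκ, eventually_gt_atTop 0] with n hn hh hn0
  refine (measure_mono fun ω hω => ?_).trans hn
  rw [Set.mem_ofPred_eq, not_le, Matrix.sub_apply, hlim, transpose_mul_mul_apply,
    transpose_mul_mul_apply, dotProduct_popCov_mulVec hK hint,
    dotProduct_toBlocks₂₂_gram_mulVec hn0 hh (fun i => X i ω)] at hω
  exact hω

theorem toBlocks₂₂_gram_mixed {A : Eucl d →L[ℝ] Eucl p} {F₀ : ℝ}
    (hXmeas : ∀ i, Measurable (X i)) (hXindep : iIndepFun X P)
    (hXident : ∀ i, IdentDistrib (X i) (X 0) P P)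
    (hc : IsRadialChart (P.map (X 0)) x₀ A F₀ Φ G ρ C) (hF₀ : 0 < F₀)
    (hm : 0 < m) (hA : ∀ u, m * ‖u‖ ≤ ‖A u‖) (hK : IsKernel K) (hκ : 0 < κ)
    (hM : 0 < M) (hε0 : 0 < ε) (hε1 : ε < 1)
    (htail : TailCondition K (P.map (X 0)) x₀ d (bandwidth κ d) ε M)
    {U : Matrix (Fin p) (Fin p) ℝ}
    (hUA : ∀ j : Fin p, d ≤ (j : ℕ) → ∀ u,
      inner ℝ (WithLp.toLp 2 fun k => U k j : Eucl p) (A u) = 0)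
    {δ : ℝ} (hδ : 0 < δ) :
    ∃ L, 0 ≤ L ∧ ∀ᶠ n in atTop, P {ω | ¬ ∀ ij : Fin p × Fin p, (ij.1 : ℕ) < d → d ≤ (ij.2 : ℕ) →
      |(Uᵀ * (gram K d (bandwidth κ d n) x₀ (fun i : Fin n => X i ω)).toBlocks₂₂ * U) ij.1 ij.2| ≤
        L * bandwidth κ d n ^ 2} ≤ ENNReal.ofReal δ := by
  have hδ' : 0 < δ / (Fintype.card (Fin p × Fin p) + 1 : ℝ) := by positivity
  have key : ∀ ij : Fin p × Fin p, ∃ L, 0 < L ∧ ∀ᶠ n in atTop,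
      P {ω | ¬ (d ≤ (ij.2 : ℕ) →
      |(Uᵀ * (gram K d (bandwidth κ d n) x₀ (fun i : Fin n => X i ω)).toBlocks₂₂ * U) ij.1 ij.2| ≤
        L * bandwidth κ d n ^ 2)} ≤ ENNReal.ofReal (δ / (Fintype.card (Fin p × Fin p) + 1)) := by
    intro ij
    by_cases hj : d ≤ (ij.2 : ℕ)
    · obtain ⟨L, hL, hev⟩ := kernelAverage_mixed hXmeas hXindep hXident hc hF₀ hm hA hK hκ hM hε0
        hε1 htail (WithLp.toLp 2 fun k => U k ij.1) (hUA ij.2 hj) hδ'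
      refine ⟨L, hL, ?_⟩
      filter_upwards [hev, eventually_bandwidth_pos hκ, eventually_gt_atTop 0] with n hn hh hn0
      refine (measure_mono fun ω hω => ?_).trans hn
      rw [Set.mem_ofPred_eq, Classical.not_imp, not_le, transpose_mul_mul_apply,
        dotProduct_toBlocks₂₂_gram_mulVec hn0 hh (fun i => X i ω)] at hω
      exact hω.2
    · exact ⟨1, one_pos, by simp [hj]⟩
  choose L hL hev using key
  refine ⟨∑ ij, L ij, Finset.sum_nonneg fun ij _ => (hL ij).le,
    eventually_measure_not_forall_le (fun ij => ?_) hδ.le⟩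
  filter_upwards [hev ij] with n hn
  refine (measure_mono fun ω hω => ?_).trans hn
  rw [Set.mem_ofPred_eq] at hω ⊢
  refine fun h1 => hω fun _ hj => (h1 hj).trans ?_
  gcongr
  exact Finset.single_le_sum (f := L) (fun ij _ => (hL ij).le) (Finset.mem_univ ij)

end Consistency

/-! ### Intercept entries of the limiting Gram matrix -/

section PopGram

variable {p d : ℕ} {K : Eucl p → ℝ} {A : Eucl d →L[ℝ] Eucl p} {F₀ : ℝ}

/-- A nonzero radial kernel is nonzero on some sphere, and an injective image of a space of positive
dimension meets every sphere about the origin. -/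
lemma popGram_inl_inl_pos [NeZero d] (hK : IsKernel K) (hA : Function.Injective A)
    (hint : Integrable fun u : Eucl d => K (A u) ^ 1 * (1 + ‖u‖ ^ 4)) (hF₀ : 0 < F₀) :
    0 < popGram K A F₀ (Sum.inl ()) (Sum.inl ()) := by
  have hKc := hK.continuous
  have hne : (EuclideanSpace.single (0 : Fin d) (1 : ℝ)) ≠ 0 := by simp
  have hAu : A (EuclideanSpace.single (0 : Fin d) (1 : ℝ)) ≠ 0 := fun h =>
    hne (hA (by rw [h, map_zero]))
  obtain ⟨y, hy⟩ := hK.ne_zero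
  set u := (‖y‖ / ‖A (EuclideanSpace.single (0 : Fin d) (1 : ℝ))‖) •
    (EuclideanSpace.single (0 : Fin d) (1 : ℝ)) with hu
  have hKu : K (A u) = K y := hK.radial _ _ (by
    rw [hu, map_smul, norm_smul, Real.norm_of_nonneg (by positivity),
      div_mul_cancel₀ _ (norm_ne_zero_iff.2 hAu)])
  have hcont : Continuous fun u => K (A u) := by fun_prop
  have hi : Integrable fun u : Eucl d => K (A u) := by
    refine hint.mono' hcont.aestronglyMeasurable (Eventually.of_forall fun u => ?_)
    rw [Real.norm_of_nonneg (hK.nonneg _), pow_one]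
    exact le_mul_of_one_le_right (hK.nonneg _) (by nlinarith [sq_nonneg (‖u‖ ^ 2)])
  have hpos : 0 < ∫ u, K (A u) :=
    integral_pos_of_integrable_nonneg_nonzero (x := u) hcont hi (fun u => hK.nonneg _)
      (by rwa [hKu])
  simp only [popGram, Matrix.of_apply, augCoord, Sum.elim_inl, mul_one]
  exact mul_pos hF₀ hpos

lemma integral_kernel_mul_coord_eq_zero (hK : IsKernel K) (k : Fin p) :
    ∫ u, K (A u) * (A u) k = 0 := by
  have h1 := integral_neg_eq_self (fun u => K (A u) * (A u) k) (volume : Measure (Eucl d))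
  have h2 : ∀ u : Eucl d, K (A (-u)) * (A (-u)) k = -(K (A u) * (A u) k) := fun u => by
    rw [hK.radial (A (-u)) (A u) (by rw [map_neg, norm_neg]), map_neg]
    simp
  simp only [h2, integral_neg] at h1
  linarith

lemma popGram_inl_inr (hK : IsKernel K) (k : Fin p) :
    popGram K A F₀ (Sum.inl ()) (Sum.inr k) = 0 ∧ popGram K A F₀ (Sum.inr k) (Sum.inl ()) = 0 := by
  have := integral_kernel_mul_coord_eq_zero (A := A) hK k
  simp [popGram, augCoord, this]

end PopGram

end ManifoldReg

/-! ### Assembling the theorem -/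

theorem theorem1 {Ω : Type*} [MeasurableSpace Ω] (P : Measure Ω) [IsProbabilityMeasure P]
    {d p : ℕ} (hd : 1 ≤ d)
    -- the local chart, the manifold, and the i.i.d. predictors
    (x₀ : Eucl p) (φ : Eucl d → Eucl p) (r μ : ℝ) (hr : 0 < r) (hμ : 0 < μ)
    (hφ : IsLocalChart φ r x₀)
    (X : ℕ → Ω → Eucl p) (hXmeas : ∀ i, Measurable (X i)) (hXindep : iIndepFun X P)
    (hXident : ∀ i, IdentDistrib (X i) (X 0) P P)
    (F : Eucl d → ℝ) (hF : HasChartDensity (P.map (X 0)) φ r x₀ μ F)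
    -- the kernel, the bandwidth and the tail condition
    (K : Eucl p → ℝ) (hK : IsKernel K)
    (κ : ℝ) (hκ : 0 < κ) (h : ℕ → ℝ) (hh : h = bandwidth κ d)
    (M : ℝ) (hM : 0 < M) (ε : ℝ) (hε0 : 0 < ε) (hε1 : ε < 1)
    (htail : TailCondition K (P.map (X 0)) x₀ d h ε M)
    -- the regularization parameter
    (lam : ℕ → ℝ) (hlam_mono : Monotone lam)
    (hlam_top : Tendsto (fun n => lam n / (n * h n ^ (d + 2))) atTop atTop)
    (hlam_zero : Tendsto (fun n => h n * lam n / (n * h n ^ (d + 2))) atTop (𝓝 0))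
    -- the sample Gram matrix, and any version of the projections
    (C : ∀ _ : ℕ, Ω → Matrix (Unit ⊕ Fin p) (Unit ⊕ Fin p) ℝ)
    (hC : ∀ n ω, C n ω = gram K d (h n) x₀ (fun i : Fin n => X i ω))
    (Pihat : ℕ → Ω → Matrix (Fin p) (Fin p) ℝ)
    (hPihat : ∀ n ω, IsNormalProjection d (C n ω).toBlocks₂₂ (Pihat n ω))
    (Pi₀ : Matrix (Fin p) (Fin p) ℝ) (hPi₀ : IsNormalProjection d (popCov K φ F) Pi₀) :
    -- (a)
    ((popCov K φ F).rank = d ∧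
      (rangeOf (popCov K φ F) : Set (Eucl p)) = tangentVectors (localManifold φ r x₀ μ) x₀) ∧
    -- (b)
    (rangeOf Pi₀ = nullOf (popCov K φ F) ∧ nullOf Pi₀ = rangeOf (popCov K φ F) ∧
      nullOf Pi₀ ⊓ nullOf (popCov K φ F) = ⊥) ∧
    -- (c)
    ((∀ n ω, ‖augment (Pihat n ω) - augment Pi₀‖ ^ 2 = ‖Pihat n ω - Pi₀‖ ^ 2) ∧
      IsBigOInProb P (fun n ω => ‖Pihat n ω - Pi₀‖ ^ 2) (fun n => 1 / (n * h n ^ d))) ∧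
    -- (d): the second line is the stronger form if the event is not measurable
    (Tendsto (fun n => P {ω | (C n ω + (lam n / (n * h n ^ (d + 2))) •
        augment (Pihat n ω)).rank = p + 1}) atTop (𝓝 1) ∧
      Tendsto (fun n => P {ω | (C n ω + (lam n / (n * h n ^ (d + 2))) •
        augment (Pihat n ω)).rank ≠ p + 1}) atTop (𝓝 0)) := by
  subst hh
  have hA : Function.Injective (fderiv ℝ φ 0) := hφ.immersion 0 (by simpa [sqBall] using hr)
  have hF₀ := hF.pos_zero
  obtain ⟨m, hm, hmA⟩ := exists_mul_norm_le _ hA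
  obtain ⟨Φ, G, ρ, C₀, hc⟩ := exists_isRadialChart hd hr hμ hφ hF
  have hint := integrable_kernel_pow_mul hc hF₀ hm hmA hK hκ hM hε0 hε1 htail (γ := 1) (Or.inl rfl)
  obtain ⟨U, ev, hU, hU', hev, hpop, rfl⟩ := hPi₀.exists_eq
  obtain ⟨hpos, hzero⟩ := popCov_eigenvalues hK hF₀ hA hint hU hU' hev hpop
  have hdp : d ≤ p := by
    have := LinearMap.finrank_le_finrank_of_injective
      (f := (fderiv ℝ φ 0 : Eucl d →ₗ[ℝ] Eucl p)) hA
    simpa using this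
  -- Indices start at zero, so this is the d-th and smallest positive eigenvalue: the spectral gap.
  set c₀ := ev ⟨d - 1, by omega⟩ with hc₀
  have hc₀pos : 0 < c₀ := hpos _ (by change d - 1 < d; omega)
  have hge : ∀ i : Fin p, (i : ℕ) < d → c₀ ≤ ev i := fun i hi =>
    hev (by rw [Fin.le_def]; change (i : ℕ) ≤ d - 1; omega)
  have hp : (0 : ℝ) < p + 1 := by positivity
  refine ⟨⟨rank_popCov hK hF₀ hA hint, ?_⟩, range_null_of_spectral hU hU' hpop rfl hpos hzero,
    ⟨fun n ω => ?_, fun δ hδ => ?_⟩, ?_⟩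
  · rw [rangeOf_popCov hK hF₀ hA hint, tangentVectors_localManifold hr hμ hφ]
    rfl
  · have : augment (Pihat n ω) - augment (U * tailProj p d * Uᵀ) =
        augment (Pihat n ω - U * tailProj p d * Uᵀ) := by
      rw [augment, augment, augment, sub_eq_add_neg, Matrix.fromBlocks_neg, Matrix.fromBlocks_add]
      simp [sub_eq_add_neg]
    rw [this, norm_augment]
  -- The trailing columns of U span the null space, so they are normal to the manifold and the mixed
  -- estimate applies to the whole off-diagonal block.
  · have hUA : ∀ j : Fin p, d ≤ (j : ℕ) → ∀ u,
        inner ℝ (WithLp.toLp 2 fun k => U k j : Eucl p) (fderiv ℝ φ 0 u) = 0 := fun j hj u => by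
      have hmem : (WithLp.toLp 2 fun k => U k j : Eucl p) ∈ nullOf (popCov K φ F) := by
        rw [LinearMap.mem_ker, Matrix.toLpLin_apply, hpop, conj_diagonal_mulVec_col hU', hzero j hj,
          zero_smul, WithLp.toLp_zero]
      rw [nullOf_popCov hK hF₀ hA hint, Submodule.mem_orthogonal'] at hmem
      exact hmem _ ⟨u, rfl⟩
    obtain ⟨c, hc0, hproj⟩ := exists_norm_projection_sub_le hU hU' hc₀pos hzero hge
    obtain ⟨L, hL, hmix⟩ := toBlocks₂₂_gram_mixed hXmeas hXindep hXident hc hF₀ hm hmA hK hκ hM hε0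
      hε1 htail hUA (half_pos hδ)
    have hcons := toBlocks₂₂_gram_consistent hXmeas hXindep hXident hc hF₀ hm hmA hK hκ hM hε0 hε1
      htail hU' hpop (η := c₀ / (4 * (p + 1))) (by positivity) (half_pos hδ)
    -- The squared error is at most (c L h²)², and h^4 = κ^{d+4}/(n h^d).
    refine ⟨(c * L) ^ 2 * κ ^ (d + 4), ?_⟩
    filter_upwards [eventually_measure_not_and_le hδ hcons hmix, eventually_bandwidth_pos hκ,
      eventually_gt_atTop 0] with n hn hh hn0
    refine (measure_mono fun ω hω => ?_).trans hn
    rw [Set.mem_ofPred_eq] at hω ⊢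
    rintro ⟨h1, h2⟩
    rw [← hC] at h1 h2
    have hle := hproj _ _ _ _ (hPihat n ω)
      (by rw [mul_div_assoc', mul_div_assoc', div_le_iff₀ (by positivity)]; nlinarith)
      (mul_nonneg hL (sq_nonneg (bandwidth κ d n))) (fun i j => h1 (i, j)) fun i j => h2 (i, j)
    have hn' : (0 : ℝ) < n := by exact_mod_cast hn0
    refine absurd hω (not_lt.2 ?_)
    rw [abs_of_nonneg (sq_nonneg _)]
    calc ‖Pihat n ω - U * tailProj p d * Uᵀ‖ ^ 2 ≤ (c * (L * bandwidth κ d n ^ 2)) ^ 2 := by gcongr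
      _ = (c * L) ^ 2 * κ ^ (d + 4) * (1 / (n * bandwidth κ d n ^ d)) := by
          rw [← natCast_mul_bandwidth_pow (κ := κ) (d := d) hn0]
          field_simp
          ring
  · have : NeZero d := ⟨by omega⟩
    have hc₁ := popGram_inl_inl_pos hK hA hint hF₀
    set c₁ := popGram K (fderiv ℝ φ 0) (F 0) (Sum.inl ()) (Sum.inl ()) with hc₁_def
    -- Half the critical size, so that (p + 1)η stays strictly below both lower bounds.
    set η := min c₀ c₁ / (2 * (p + 1)) with hη_def
    have hmin : 0 < min c₀ c₁ := lt_min hc₀pos hc₁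
    have hη : 0 < η := by positivity
    have hη' : (p + 1) * η < min c₀ c₁ := by
      have : (p + 1) * η = min c₀ c₁ / 2 := by rw [hη_def]; field_simp
      linarith
    have hlim : Tendsto (fun n => P {ω | ¬ (C n ω + (lam n / (n * bandwidth κ d n ^ (d + 2))) •
        augment (Pihat n ω)).rank = p + 1}) atTop (𝓝 0) := by
      refine tendsto_measure_zero_of_eventually_le fun δ hδ => ?_
      have hcons := toBlocks₂₂_gram_consistent hXmeas hXindep hXident hc hF₀ hm hmA hK hκ hM hε0
        hε1 htail hU' hpop hη (half_pos hδ)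
      have hgram := gram_consistent hXmeas hXindep hXident hc hF₀ hm hmA hK hκ hM hε0 hε1 htail hη
        (half_pos hδ)
      filter_upwards [eventually_measure_not_and_le hδ hcons hgram, eventually_bandwidth_pos hκ,
        eventually_gt_atTop 0, hlam_top.eventually_gt_atTop 0] with n hn hh hn0 hs
      refine (measure_mono fun ω hω => ?_).trans hn
      rw [Set.mem_ofPred_eq] at hω ⊢
      rintro ⟨h1, h2⟩
      have hnn := dotProduct_gram_mulVec_nonneg (d := d) (x₀ := x₀) hK hn0 hh fun i => X i ω
      rw [← hC] at h1 h2 hnn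
      refine hω (rank_add_smul_augment hU' hge hnn (hPihat n ω) (fun i j => h1 (i, j)) (c₁ := c₁)
        ?_ (fun k => ?_) (fun k => ?_) (hη'.trans_le (min_le_right _ _))
        (hη'.trans_le (min_le_left _ _)) hs)
      · linarith [(abs_le.1 (h2 (Sum.inl (), Sum.inl ()))).1]
      · have := h2 (Sum.inl (), Sum.inr k)
        rwa [(popGram_inl_inr hK k).1, sub_zero] at this
      · have := h2 (Sum.inr k, Sum.inl ())
        rwa [(popGram_inl_inr hK k).2, sub_zero] at this
    exact ⟨tendsto_measure_one_of_compl hlim, hlim⟩
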